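/- Let $\lambda>-\frac12$, $\mu\ge 0$, $\sigma=\max(\lambda,\mu)$, and $v_{\lambda,\mu}(t)=|t|^{2\mu}(1-t^2)^{\lambda-1/2}$ on $[-1,1]$. Let $L_p(v_{\lambda,\mu})$ be the space of complex-valued measurable functions $f$ on $[-1,1]$ with $\|f\|_{L_p(v_{\lambda,\mu})}=\bigl(\int_{-1}^1|f|^p v_{\lambda,\mu}\,dt\bigr)^{1/p}<\infty$. Let $\{\widetilde C_n^{(\lambda,\mu)}\}_{n\ge 0}$ be the orthonormal generalized Gegenbauer polynomials, i.e. the polynomials of degree $n$ with positive leading coefficient that are orthonormal with respect to $v_{\lambda,\mu}$ on $[-1,1]$; they are given by $$\widetilde C_{2m}^{(\lambda,\mu)}(t)=\Bigl(\tfrac{(2m+\lambda+\mu)\Gamma(m+1)\Gamma(m+\lambda+\mu)}{\Gamma(m+\lambda+\frac12)\Gamma(m+\mu+\frac12)}\Bigr)^{1/2}P_m^{(\lambda-\frac12,\mu-\frac12)}(2t^2-1),$$ $$\widetilde C_{2m+1}^{(\lambda,\mu)}(t)=\Bigl(\tfrac{(2m+\lambda+\mu+1)\Gamma(m+1)\Gamma(m+\lambda+\mu+1)}{\Gamma(m+\lambda+\frac12)\Gamma(m+\mu+\frac32)}\Bigr)^{1/2}\,t\,P_m^{(\lambda-\frac12,\mu+\frac12)}(2t^2-1),$$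 where $P_m^{(\alpha,\beta)}$ are the Jacobi polynomials and, for $m=0$, $(\lambda+\mu)\Gamma(\lambda+\mu)$ is read as $\Gamma(\lambda+\mu+1)$. Put $\hat f_n=\int_{-1}^1 f\,\widetilde C_n^{(\lambda,\mu)}\,v_{\lambda,\mu}\,dt$. For $1<p<\infty$ let $p'$ be given by $\frac1p+\frac1{p'}=1$. There are positive constants $A_p$, $B_p$ ($1<p\le 2$), depending only on $\lambda,\mu,p$, with $A_2=B_2=1$, such that for all $1<p\le2$ and all $f\in L_p(v_{\lambda,\mu})$ $$\Bigl\{\sum_{n=0}^\infty\bigl((n+1)^{(\frac1{p'}-\frac1p)(\sigma+1)}|\hat f_n|\bigr)^p\Bigr\}^{1/p}\le A_p\|f\|_{L_p(v_{\lambda,\mu})},\qquad \Bigl\{\sum_{n=0}^\infty\bigl((n+1)^{(\frac1{p'}-\frac1p)\sigma}|\hat f_n|\bigr)^{p'}\Bigr\}^{1/p'}\le B_p\|f\|_{L_p(v_{\lambda,\mu})}. \tag{1}$$ Moreover, for any constants $A_p,B_p$ ($1<p\le 2$) satisfying (1), put $C_p(s)=B_p^{1-t}A_p^{t}$ for $p\le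 s\le p'$, where $t\in[0,1]$ and $\frac1s=\frac{1-t}{p'}+\frac tp$ (for $p=2$ any $t\in[0,1]$ may be taken). Then: (a) If $1<p\le2$, $f\in L_p(v_{\lambda,\mu})$ and $p\le s\le p'$, then $$\Bigl\{\sum_{n=0}^\infty\bigl((n+1)^{(\frac1s-\frac1p)\sigma+(\frac1{p'}-\frac1s)(\sigma+1)}|\hat f_n|\bigr)^s\Bigr\}^{1/s}\le C_p(s)\,\|f\|_{L_p(v_{\lambda,\mu})}.$$ (b) If $2\le q<\infty$, $q'\le r\le q$, and $\phi$ is a complex-valued function on the non-negative integers with $$\sum_{n=0}^\infty\bigl((n+1)^{(\frac1{q'}-\frac1r)\sigma+(\frac1r-\frac1q)(\sigma+1)}|\phi(n)|\bigr)^{r'}<\infty,$$ then the polynomials $\Phi_N=\sum_{n=0}^N\phi(n)\widetilde C_n^{(\lambda,\mu)}$ converge in $L_q(v_{\lambda,\mu})$ to a function $f$ with $\hat f_n=\phi(n)$ for all $n\ge 0$, and $$\|f\|_{L_q(v_{\lambda,\mu})}\le C_{q'}(r)\Bigl\{\sum_{n=0}^\infty\bigl((n+1)^{(\frac1{q'}-\frac1r)\sigma+(\frac1r-\frac1q)(\sigma+1)}|\phi(n)|\bigr)^{r'}\Bigr\}^{1/r'}.$$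 -/

import Mathlib

open MeasureTheory Filter Topology

noncomputable section

namespace GenGegenbauer

/-- The Jacobi polynomial `P_n^{(α,β)}`, with the classical normalization
`P_n^{(α,β)}(1) = binom(n+α, n)`, as a function of `x`:
`∑_k binom(n+α, n-k) binom(n+β, k) ((x-1)/2)^k ((x+1)/2)^{n-k}`. -/
def jacobi (α β : ℝ) (n : ℕ) (x : ℝ) : ℝ :=
  ∑ k ∈ Finset.range (n + 1),
    Ring.choose ((n : ℝ) + α) (n - k) * Ring.choose ((n : ℝ) + β) k *
      ((x - 1) / 2) ^ k * ((x + 1) / 2) ^ (n - k)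

/-- The weight `v_{λ,μ}(t) = |t|^{2μ} (1 - t^2)^{λ - 1/2}`, used on `[-1, 1]`. -/
def weight (lam mu : ℝ) (t : ℝ) : ℝ :=
  |t| ^ (2 * mu) * (1 - t ^ 2) ^ (lam - 1 / 2)

/-- The measure `v_{λ,μ}(t) dt` on `[-1, 1]`. -/
def weightMeasure (lam mu : ℝ) : Measure ℝ :=
  (volume.restrict (Set.Icc (-1 : ℝ) 1)).withDensity
    (fun t => ENNReal.ofReal (weight lam mu t))

/-- The normalizing factor of the orthonormal polynomial of degree `2m`. For `m = 0` the product
`(2m+λ+μ) Γ(m+λ+μ)` is `(λ+μ) Γ(λ+μ)`, which is read as `Γ(λ+μ+1)`, so that it makes sense for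
`λ + μ = 0` too. -/
def evenCoeff (lam mu : ℝ) (m : ℕ) : ℝ :=
  Real.sqrt
    ((if m = 0 then Real.Gamma (lam + mu + 1)
      else (2 * m + lam + mu) * Real.Gamma (m + 1) * Real.Gamma (m + lam + mu)) /
      (Real.Gamma (m + lam + 1 / 2) * Real.Gamma (m + mu + 1 / 2)))

/-- The normalizing factor of the orthonormal polynomial of degree `2m + 1`. -/
def oddCoeff (lam mu : ℝ) (m : ℕ) : ℝ :=
  Real.sqrt
    ((2 * m + lam + mu + 1) * Real.Gamma (m + 1) * Real.Gamma (m + lam + mu + 1) /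
      (Real.Gamma (m + lam + 1 / 2) * Real.Gamma (m + mu + 3 / 2)))

/-- The orthonormal generalized Gegenbauer polynomial of degree `n`. -/
def orthoGegenbauer (lam mu : ℝ) (n : ℕ) (t : ℝ) : ℝ :=
  if Even n then
    evenCoeff lam mu (n / 2) * jacobi (lam - 1 / 2) (mu - 1 / 2) (n / 2) (2 * t ^ 2 - 1)
  else
    oddCoeff lam mu (n / 2) * (t * jacobi (lam - 1 / 2) (mu + 1 / 2) (n / 2) (2 * t ^ 2 - 1))

/-- Membership in `L_p(v_{λ,μ})` for a real exponent `p`. -/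
def MemLpW (lam mu p : ℝ) (f : ℝ → ℂ) : Prop :=
  MemLp f (ENNReal.ofReal p) (weightMeasure lam mu)

/-- The norm of `L_p(v_{λ,μ})` for a real exponent `p` (a finite number when `MemLpW`). -/
def normLpW (lam mu p : ℝ) (f : ℝ → ℂ) : ℝ :=
  (eLpNorm f (ENNReal.ofReal p) (weightMeasure lam mu)).toReal

/-- The `n`-th coefficient of the generalized Gegenbauer expansion of `f`. -/
def fourierCoeff (lam mu : ℝ) (f : ℝ → ℂ) (n : ℕ) : ℂ :=
  ∫ t, f t * (orthoGegenbauer lam mu n t : ℂ) ∂(weightMeasure lam mu)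

/-- The partial sum `Φ_N = ∑_{n ≤ N} φ(n) C̃_n`. -/
def partialSum (lam mu : ℝ) (φ : ℕ → ℂ) (N : ℕ) (t : ℝ) : ℂ :=
  ∑ n ∈ Finset.range (N + 1), φ n * (orthoGegenbauer lam mu n t : ℂ)

/-- The exponent `(1/s - 1/p) σ + (1/p' - 1/s) (σ + 1)` with `σ = max λ μ`. -/
def coeffExponent (lam mu p s : ℝ) : ℝ :=
  (1 / s - 1 / p) * max lam mu + (1 / p.conjExponent - 1 / s) * (max lam mu + 1)

/-- The exponent `(1/q' - 1/r) σ + (1/r - 1/q) (σ + 1)` with `σ = max λ μ`. -/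
def synthExponent (lam mu q r : ℝ) : ℝ :=
  (1 / q.conjExponent - 1 / r) * max lam mu + (1 / r - 1 / q) * (max lam mu + 1)

/-- The inequality
`(∑_n ((n+1)^{(1/s-1/p)σ + (1/p'-1/s)(σ+1)} |f̂_n|)^s)^{1/s} ≤ C ‖f‖_{L_p(v_{λ,μ})}`
for all `f ∈ L_p(v_{λ,μ})`, including the convergence of the series. For `s = p` it is the
Hardy-Littlewood-type inequality, for `s = p'` the Hausdorff-Young-type inequality. -/
def CoeffInequality (lam mu p s C : ℝ) : Prop :=
  ∀ f : ℝ → ℂ, MemLpW lam mu p f →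
    Summable (fun n : ℕ =>
      (((n : ℝ) + 1) ^ coeffExponent lam mu p s * ‖fourierCoeff lam mu f n‖) ^ s) ∧
    (∑' n : ℕ,
      (((n : ℝ) + 1) ^ coeffExponent lam mu p s * ‖fourierCoeff lam mu f n‖) ^ s) ^ (1 / s) ≤
        C * normLpW lam mu p f

end GenGegenbauer

end

noncomputable section

namespace GenGegenbauer

/-! Write `C̃_n` for `orthoGegenbauer lam mu n` and σ = max(λ, μ). Everything rests on two facts:
the `C̃_n` are orthonormal, which gives Bessel's inequality, and |C̃_n| ≤ K (n+1)^σ on [-1, 1],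
which gives |f̂_n| ≤ K (n+1)^σ ‖f‖₁. These are the L₂ and L₁ endpoints of the two inequalities in
(1), and the range 1 < p < 2 follows from them by Marcinkiewicz's argument.

Orthonormality (`integral_orthoGegenbauer_mul`): the substitution u = t² carries even and odd
degrees to Jacobi polynomials on [0, 1]. There differentiation and the one-step Rodrigues formula
are adjoint to each other, so integration by parts lowers both degrees and raises both parameters
until only a Beta integral is left.

Uniform bound (`exists_abs_orthoGegenbauer_le`): the Sonin function, a polynomial squared plus a
nonnegative multiple of the square of its derivative, is largest at an end point of [0, 1]. The end
point values are binomial coefficients, whose growth is read off from Euler's limit formula for Γ.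

Interpolation: take n ↦ w(n)|f̂_n| on ℕ with masses w(n)⁻², so that Bessel's inequality is the bound
from L₂ to L₂. For w(n) = (n+1)^(σ+1) the L₁ bound is of weak type (1,1), and cutting f at height y
gives the Hardy–Littlewood inequality (`exists_lintegral_hardyLittlewood_le`). For w(n) = (n+1)^(-σ)
it maps L₁ to ℓ_∞; a cut at a height proportional to a negative power of y makes the high part
invisible and gives Hausdorff–Young (`exists_lintegral_hausdorffYoung_le`).

Part (a) is then Hölder's inequality for series between the two (`CoeffInequality.interpolate`),
which is why the constant is B^(1-t) A^t for any admissible A and B. Part (b) is its dual: testing a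
finite sum Φ against conj(Φ)|Φ|^(q-2) bounds it by its coefficients, and completeness of L_q
supplies the limit (`exists_synthesis`). -/

/-! ### Binomial identities and Jacobi polynomials on [0, 1] -/

lemma succ_mul_choose_succ (r : ℝ) (k : ℕ) :
    ((k : ℝ) + 1) * Ring.choose r (k + 1) = (r - k) * Ring.choose r k := by
  simp only [Ring.choose_eq_smul, descPochhammer_succ_right, Polynomial.smeval_mul,
    Polynomial.smeval_sub, Polynomial.smeval_X, Polynomial.smeval_natCast, smul_eq_mul,
    Nat.factorial_succ]
  have : ((k.factorial : ℕ) : ℝ) ≠ 0 := by positivity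
  push_cast
  field_simp
  simp

lemma succ_mul_choose_succ_succ (r : ℝ) (k : ℕ) :
    ((k : ℝ) + 1) * Ring.choose (r + 1) (k + 1) = (r + 1) * Ring.choose r k := by
  have := succ_mul_choose_succ r k
  rw [Ring.choose_succ_succ]
  linear_combination this

lemma mul_choose_eq (r : ℝ) (k : ℕ) :
    (r + 1) * Ring.choose r k = (r + 1 - k) * Ring.choose (r + 1) k := by
  have h := succ_mul_choose_succ (r + 1) k
  have h' := succ_mul_choose_succ_succ r k
  linear_combination h - h'

/-- The Jacobi polynomial transplanted to `[0, 1]`. -/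
def jacUnit (α β : ℝ) (n : ℕ) (u : ℝ) : ℝ :=
  ∑ k ∈ Finset.range (n + 1),
    Ring.choose ((n : ℝ) + α) (n - k) * Ring.choose ((n : ℝ) + β) k * (u - 1) ^ k * u ^ (n - k)

lemma jacobi_two_mul_sub_one (α β : ℝ) (n : ℕ) (u : ℝ) :
    jacobi α β n (2 * u - 1) = jacUnit α β n u := by
  have h1 : (2 * u - 1 - 1) / 2 = u - 1 := by ring
  have h2 : (2 * u - 1 + 1) / 2 = u := by ring
  simp only [jacobi, jacUnit, h1, h2]

@[simp] lemma jacUnit_degree_zero (α β u : ℝ) : jacUnit α β 0 u = 1 := by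
  simp [jacUnit]

lemma jacUnit_one (α β : ℝ) (n : ℕ) : jacUnit α β n 1 = Ring.choose ((n : ℝ) + α) n := by
  rw [jacUnit, Finset.sum_eq_single 0]
  · simp
  · intro k _ hk
    simp [hk]
  · simp

lemma jacUnit_zero (α β : ℝ) (n : ℕ) :
    jacUnit α β n 0 = (-1) ^ n * Ring.choose ((n : ℝ) + β) n := by
  rw [jacUnit, Finset.sum_eq_single n]
  · simp [mul_comm]
  · intro k hk hkn
    have : n - k ≠ 0 := by have := Finset.mem_range.1 hk; omega
    simp [this]
  · simp

lemma continuous_jacUnit (α β : ℝ) (n : ℕ) : Continuous (jacUnit α β n) := by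
  unfold jacUnit; fun_prop

/-- Compares coefficients of (u-1)^k u^(n-k) in `hasDerivAt_jacUnit_succ`. Absorbing k+1 and n+1-k
into the binomials leaves the factors n+1+β-k and 1+α+k, whose sum does not depend on k. -/
lemma choose_derivative_identity (α β : ℝ) {n k : ℕ} (hk : k ≤ n) :
    ((k : ℝ) + 1) * (Ring.choose ((n : ℝ) + 1 + α) (n - k) * Ring.choose ((n : ℝ) + 1 + β) (k + 1))
      + (n + 1 - k) * (Ring.choose ((n : ℝ) + 1 + α) (n + 1 - k)
        * Ring.choose ((n : ℝ) + 1 + β) k) =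
    (n + 2 + α + β) *
      (Ring.choose ((n : ℝ) + (α + 1)) (n - k) * Ring.choose ((n : ℝ) + (β + 1)) k) := by
  obtain ⟨j, rfl⟩ := Nat.exists_eq_add_of_le hk
  have e1 : k + j - k = j := by omega
  have e2 : k + j + 1 - k = j + 1 := by omega
  have h1 := succ_mul_choose_succ ((k : ℝ) + j + 1 + α) j
  have h2 := succ_mul_choose_succ ((k : ℝ) + j + 1 + β) k
  have e3 : (k : ℝ) + j + (α + 1) = k + j + 1 + α := by ring
  have e4 : (k : ℝ) + j + (β + 1) = k + j + 1 + β := by ring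
  rw [e1, e2]
  push_cast
  rw [e3, e4]
  linear_combination (Ring.choose ((k : ℝ) + j + 1 + α) j) * h2
    + (Ring.choose ((k : ℝ) + j + 1 + β) k) * h1

lemma hasDerivAt_jacUnit_succ (α β : ℝ) (n : ℕ) (u : ℝ) :
    HasDerivAt (jacUnit α β (n + 1))
      ((n + 2 + α + β) * jacUnit (α + 1) (β + 1) n u) u := by
  have hd : HasDerivAt (jacUnit α β (n + 1)) (∑ k ∈ Finset.range (n + 2),
      (Ring.choose (((n + 1 : ℕ) : ℝ) + α) (n + 1 - k) * Ring.choose (((n + 1 : ℕ) : ℝ) + β) k *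
        (k * (u - 1) ^ (k - 1)) * u ^ (n + 1 - k) +
      Ring.choose (((n + 1 : ℕ) : ℝ) + α) (n + 1 - k) * Ring.choose (((n + 1 : ℕ) : ℝ) + β) k *
        (u - 1) ^ k * ((n + 1 - k : ℕ) * u ^ (n + 1 - k - 1)))) u := by
    unfold jacUnit
    refine HasDerivAt.fun_sum fun k _ => ?_
    have h1 : HasDerivAt (fun u : ℝ => (u - 1) ^ k) (k * (u - 1) ^ (k - 1)) u := by
      simpa using ((hasDerivAt_id u).sub_const 1).fun_pow k
    have h2 : HasDerivAt (fun u : ℝ => u ^ (n + 1 - k))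
        ((n + 1 - k : ℕ) * u ^ (n + 1 - k - 1)) u := hasDerivAt_pow _ u
    exact (h1.const_mul _).mul h2
  convert! hd using 1
  -- The k = 0 term of the first sum and the k = n+1 term of the second vanish; after the shift,
  -- terms k+1 and k meet on the same monomial.
  rw [Finset.sum_add_distrib, Finset.sum_range_succ', Finset.sum_range_succ (n := n + 1)
    (f := fun k => Ring.choose (((n + 1 : ℕ) : ℝ) + α) (n + 1 - k) *
      Ring.choose (((n + 1 : ℕ) : ℝ) + β) k * (u - 1) ^ k *
        ((n + 1 - k : ℕ) * u ^ (n + 1 - k - 1)))]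
  simp only [Nat.cast_zero, zero_mul, mul_zero, add_zero, Nat.sub_self]
  rw [← Finset.sum_add_distrib, jacUnit, Finset.mul_sum]
  refine Finset.sum_congr rfl fun k hk => ?_
  have hkn : k ≤ n := by have := Finset.mem_range.1 hk; omega
  have h := choose_derivative_identity α β hkn
  have e1 : n + 1 - (k + 1) = n - k := by omega
  have e2 : n + 1 - k - 1 = n - k := by omega
  rw [e1, e2, Nat.cast_sub (by omega : k ≤ n + 1)]
  push_cast
  linear_combination -(u - 1) ^ k * u ^ (n - k) * h

lemma choose_rodrigues_identity (α β : ℝ) {n k : ℕ} (hk : k < n) :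
    ((k : ℝ) + 1 + (α + 1)) *
        (Ring.choose ((n : ℝ) + (α + 1)) (n - (k + 1)) * Ring.choose ((n : ℝ) + (β + 1)) (k + 1))
      + (n - k + (β + 1)) *
        (Ring.choose ((n : ℝ) + (α + 1)) (n - k) * Ring.choose ((n : ℝ) + (β + 1)) k) =
    (n + 1) * (Ring.choose ((n : ℝ) + 1 + α) (n + 1 - (k + 1)) *
      Ring.choose ((n : ℝ) + 1 + β) (k + 1)) := by
  obtain ⟨j, rfl⟩ := Nat.exists_eq_add_of_lt hk
  have e1 : k + j + 1 - (k + 1) = j := by omega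
  have e2 : k + j + 1 - k = j + 1 := by omega
  have e3 : k + j + 1 + 1 - (k + 1) = j + 1 := by omega
  have h1 := succ_mul_choose_succ ((k : ℝ) + j + 1 + 1 + α) j
  have h2 := succ_mul_choose_succ ((k : ℝ) + j + 1 + 1 + β) k
  rw [e1, e2, e3]
  push_cast
  have e4 : (k : ℝ) + j + 1 + (α + 1) = k + j + 1 + 1 + α := by ring
  have e5 : (k : ℝ) + j + 1 + (β + 1) = k + j + 1 + 1 + β := by ring
  rw [e4, e5]
  linear_combination -(Ring.choose ((k : ℝ) + j + 1 + 1 + α) (j + 1)) * h2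
    - (Ring.choose ((k : ℝ) + j + 1 + 1 + β) (k + 1)) * h1

/-- One step of Rodrigues' formula with the weight divided out: the left side is the derivative of
u^(β+1) (1-u)^(α+1) P_n^(α+1,β+1), divided by u^β (1-u)^α. This operator is the adjoint, up to sign,
of differentiation. -/
lemma jacUnit_rodrigues {α β : ℝ} {n : ℕ} {u d : ℝ}
    (hd : HasDerivAt (jacUnit (α + 1) (β + 1) n) d u) :
    u * (1 - u) * d + ((β + 1) * (1 - u) - (α + 1) * u) * jacUnit (α + 1) (β + 1) n u =
      -(n + 1) * jacUnit α β (n + 1) u := by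
  have hd' : HasDerivAt (jacUnit (α + 1) (β + 1) n) (∑ k ∈ Finset.range (n + 1),
      (Ring.choose ((n : ℝ) + (α + 1)) (n - k) * Ring.choose ((n : ℝ) + (β + 1)) k *
        (k * (u - 1) ^ (k - 1)) * u ^ (n - k) +
      Ring.choose ((n : ℝ) + (α + 1)) (n - k) * Ring.choose ((n : ℝ) + (β + 1)) k *
        (u - 1) ^ k * ((n - k : ℕ) * u ^ (n - k - 1)))) u := by
    unfold jacUnit
    refine HasDerivAt.fun_sum fun k _ => ?_
    have h1 : HasDerivAt (fun u : ℝ => (u - 1) ^ k) (k * (u - 1) ^ (k - 1)) u := by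
      simpa using ((hasDerivAt_id u).sub_const 1).fun_pow k
    exact (h1.const_mul _).mul (hasDerivAt_pow _ u)
  have key : u * (u - 1) * d + ((β + 1) * (u - 1) + (α + 1) * u) * jacUnit (α + 1) (β + 1) n u =
      (∑ k ∈ Finset.range (n + 1), ((k : ℝ) + (α + 1)) * (Ring.choose ((n : ℝ) + (α + 1)) (n - k) *
          Ring.choose ((n : ℝ) + (β + 1)) k) * (u - 1) ^ k * u ^ (n + 1 - k)) +
      ∑ k ∈ Finset.range (n + 1), ((n : ℝ) - k + (β + 1)) *
        (Ring.choose ((n : ℝ) + (α + 1)) (n - k) *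
          Ring.choose ((n : ℝ) + (β + 1)) k) * (u - 1) ^ (k + 1) * u ^ (n - k) := by
    rw [hd.unique hd', jacUnit, Finset.mul_sum, Finset.mul_sum, ← Finset.sum_add_distrib,
      ← Finset.sum_add_distrib]
    refine Finset.sum_congr rfl fun k hk => ?_
    have hkn : k ≤ n := by have := Finset.mem_range.1 hk; omega
    obtain ⟨j, rfl⟩ := Nat.exists_eq_add_of_le hkn
    have e1 : k + j - k = j := by omega
    have e2 : k + j + 1 - k = j + 1 := by omega
    have hA : (k : ℝ) * (u - 1) ^ (k - 1) * (u - 1) = k * (u - 1) ^ k := by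
      rcases k with _ | k
      · simp
      · simp [pow_succ]; ring
    have hB : (j : ℝ) * u ^ (j - 1) * u = j * u ^ j := by
      rcases j with _ | j
      · simp
      · simp [pow_succ]; ring
    rw [e1, e2, pow_succ, pow_succ]
    push_cast
    set c := Ring.choose ((k : ℝ) + j + (α + 1)) j
    set c' := Ring.choose ((k : ℝ) + j + (β + 1)) k
    linear_combination c * c' * u ^ j * u * hA + c * c' * (u - 1) ^ k * (u - 1) * hB
  have h2 : ((n : ℝ) + 1) * jacUnit α β (n + 1) u =
      (∑ k ∈ Finset.range (n + 1), ((k : ℝ) + (α + 1)) * (Ring.choose ((n : ℝ) + (α + 1)) (n - k) *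
          Ring.choose ((n : ℝ) + (β + 1)) k) * (u - 1) ^ k * u ^ (n + 1 - k)) +
      ∑ k ∈ Finset.range (n + 1), ((n : ℝ) - k + (β + 1)) *
        (Ring.choose ((n : ℝ) + (α + 1)) (n - k) *
          Ring.choose ((n : ℝ) + (β + 1)) k) * (u - 1) ^ (k + 1) * u ^ (n - k) := by
    rw [jacUnit, Finset.sum_range_succ', Finset.sum_range_succ, Finset.sum_range_succ' (n := n),
      Finset.sum_range_succ (n := n) (f := fun k => ((n : ℝ) - k + (β + 1)) *
        (Ring.choose ((n : ℝ) + (α + 1)) (n - k) *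
          Ring.choose ((n : ℝ) + (β + 1)) k) * (u - 1) ^ (k + 1) * u ^ (n - k))]
    -- The two extreme monomials u^(n+1) and (u-1)^(n+1) each receive a single contribution; all
    -- others are covered by `choose_rodrigues_identity`.
    have hz : ((n : ℝ) + 1) * (Ring.choose (((n + 1 : ℕ) : ℝ) + α) (n + 1)) =
        (α + 1) * Ring.choose ((n : ℝ) + (α + 1)) n := by
      have := succ_mul_choose_succ ((n : ℝ) + 1 + α) n
      push_cast
      rw [this, ← add_assoc, add_right_comm (n : ℝ) α 1]
      ring
    have hl : ((n : ℝ) + 1) * (Ring.choose (((n + 1 : ℕ) : ℝ) + β) (n + 1)) =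
        (β + 1) * Ring.choose ((n : ℝ) + (β + 1)) n := by
      have := succ_mul_choose_succ ((n : ℝ) + 1 + β) n
      push_cast
      rw [this, ← add_assoc, add_right_comm (n : ℝ) β 1]
      ring
    have hm : ((n : ℝ) + 1) * ∑ k ∈ Finset.range n,
          Ring.choose (((n + 1 : ℕ) : ℝ) + α) (n + 1 - (k + 1)) *
            Ring.choose (((n + 1 : ℕ) : ℝ) + β) (k + 1) * (u - 1) ^ (k + 1) *
              u ^ (n + 1 - (k + 1)) =
        (∑ k ∈ Finset.range n, (((k + 1 : ℕ) : ℝ) + (α + 1)) *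
          (Ring.choose ((n : ℝ) + (α + 1)) (n - (k + 1)) *
          Ring.choose ((n : ℝ) + (β + 1)) (k + 1)) * (u - 1) ^ (k + 1) * u ^ (n + 1 - (k + 1))) +
        ∑ k ∈ Finset.range n, ((n : ℝ) - k + (β + 1)) *
          (Ring.choose ((n : ℝ) + (α + 1)) (n - k) *
          Ring.choose ((n : ℝ) + (β + 1)) k) * (u - 1) ^ (k + 1) * u ^ (n - k) := by
      rw [Finset.mul_sum, ← Finset.sum_add_distrib]
      refine Finset.sum_congr rfl fun k hk => ?_
      have h := choose_rodrigues_identity α β (Finset.mem_range.1 hk)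
      have e1 : n + 1 - (k + 1) = n - k := by omega
      rw [e1] at h ⊢
      push_cast
      linear_combination -(u - 1) ^ (k + 1) * u ^ (n - k) * h
    simp only [Nat.sub_self, Nat.sub_zero, Ring.choose_zero_right, pow_zero, mul_one, one_mul,
      Nat.cast_zero, zero_add, sub_self] at hm ⊢
    linear_combination hm + u ^ (n + 1) * hz + (u - 1) ^ (n + 1) * hl
  linear_combination -key + h2

/-- Trades the parameter β+1 for β at the cost of a factor u. It serves to bound P_n^(α,β+1) away
from u = 0 with the growth that belongs to (α, β). -/
lemma jacUnit_contiguous (α β : ℝ) (n : ℕ) (u : ℝ) :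
    (2 * n + α + β + 2) * (u * jacUnit α (β + 1) n u) =
      (n + β + 1) * jacUnit α β n u + (n + 1) * jacUnit α β (n + 1) u := by
  -- Multiplying by 1 = u - (u-1) makes this side homogeneous of degree n+1 in u and u-1, so that
  -- coefficients can be compared.
  have h1 : (n + β + 1) * jacUnit α β n u =
      (∑ k ∈ Finset.range (n + 1), ((n : ℝ) + 1 + β - k) * (Ring.choose ((n : ℝ) + α) (n - k) *
        Ring.choose ((n : ℝ) + 1 + β) k) * (u - 1) ^ k * u ^ (n + 1 - k)) -
      ∑ k ∈ Finset.range (n + 1), (((k + 1 : ℕ) : ℝ)) * (Ring.choose ((n : ℝ) + α) (n - k) *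
        Ring.choose ((n : ℝ) + 1 + β) (k + 1)) * (u - 1) ^ (k + 1) * u ^ (n - k) := by
    rw [jacUnit, Finset.mul_sum, ← Finset.sum_sub_distrib]
    refine Finset.sum_congr rfl fun k hk => ?_
    have hkn : k ≤ n := by have := Finset.mem_range.1 hk; omega
    have e : n + 1 - k = n - k + 1 := by omega
    have a1 := mul_choose_eq ((n : ℝ) + β) k
    have a2 := succ_mul_choose_succ_succ ((n : ℝ) + β) k
    rw [add_right_comm (n : ℝ) β 1] at a1 a2
    rw [e, pow_succ, pow_succ]
    push_cast
    linear_combination (Ring.choose ((n : ℝ) + α) (n - k)) * (u - 1) ^ k * u ^ (n - k) *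
      (u * a1 + (u - 1) * a2)
  have h2 : (2 * n + α + β + 2) * (u * jacUnit α (β + 1) n u) =
      ∑ k ∈ Finset.range (n + 1), (2 * n + α + β + 2) * (Ring.choose ((n : ℝ) + α) (n - k) *
        Ring.choose ((n : ℝ) + 1 + β) k) * (u - 1) ^ k * u ^ (n + 1 - k) := by
    rw [jacUnit, Finset.mul_sum, Finset.mul_sum]
    refine Finset.sum_congr rfl fun k hk => ?_
    have hkn : k ≤ n := by have := Finset.mem_range.1 hk; omega
    have e : n + 1 - k = n - k + 1 := by omega
    rw [e, pow_succ, ← add_assoc, add_right_comm (n : ℝ) β 1]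
    ring
  have hs : ∑ k ∈ Finset.range (n + 1), (((k + 1 : ℕ) : ℝ)) * (Ring.choose ((n : ℝ) + α) (n - k) *
        Ring.choose ((n : ℝ) + 1 + β) (k + 1)) * (u - 1) ^ (k + 1) * u ^ (n - k) =
      ∑ k ∈ Finset.range (n + 2), (k : ℝ) * (Ring.choose ((n : ℝ) + α) (n + 1 - k) *
        Ring.choose ((n : ℝ) + 1 + β) k) * (u - 1) ^ k * u ^ (n + 1 - k) := by
    rw [Finset.sum_range_succ' (n := n + 1)]
    simp
  rw [h1, h2, hs, jacUnit, Finset.sum_range_succ (n := n + 1), Finset.sum_range_succ (n := n + 1)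
    (f := fun k => Ring.choose (((n + 1 : ℕ) : ℝ) + α) (n + 1 - k) *
      Ring.choose (((n + 1 : ℕ) : ℝ) + β) k * (u - 1) ^ k * u ^ (n + 1 - k))]
  have hm : ∑ k ∈ Finset.range (n + 1), (2 * n + α + β + 2) * (Ring.choose ((n : ℝ) + α) (n - k) *
        Ring.choose ((n : ℝ) + 1 + β) k) * (u - 1) ^ k * u ^ (n + 1 - k) =
      (∑ k ∈ Finset.range (n + 1), ((n : ℝ) + 1 + β - k) * (Ring.choose ((n : ℝ) + α) (n - k) *
        Ring.choose ((n : ℝ) + 1 + β) k) * (u - 1) ^ k * u ^ (n + 1 - k)) -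
      (∑ k ∈ Finset.range (n + 1), (k : ℝ) * (Ring.choose ((n : ℝ) + α) (n + 1 - k) *
        Ring.choose ((n : ℝ) + 1 + β) k) * (u - 1) ^ k * u ^ (n + 1 - k)) +
      (n + 1) * ∑ k ∈ Finset.range (n + 1), Ring.choose (((n + 1 : ℕ) : ℝ) + α) (n + 1 - k) *
      Ring.choose (((n + 1 : ℕ) : ℝ) + β) k * (u - 1) ^ k * u ^ (n + 1 - k) := by
    rw [Finset.mul_sum, ← Finset.sum_sub_distrib, ← Finset.sum_add_distrib]
    refine Finset.sum_congr rfl fun k hk => ?_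
    have hkn : k ≤ n := by have := Finset.mem_range.1 hk; omega
    obtain ⟨j, rfl⟩ := Nat.exists_eq_add_of_le hkn
    have e1 : k + j - k = j := by omega
    have e2 : k + j + 1 - k = j + 1 := by omega
    have a1 := Ring.choose_succ_succ ((k : ℝ) + j + α) j
    have a2 := succ_mul_choose_succ ((k : ℝ) + j + α) j
    rw [add_right_comm _ α 1] at a1
    rw [e1, e2]
    push_cast
    rw [a1]
    linear_combination -(Ring.choose ((k : ℝ) + j + 1 + β) k * (u - 1) ^ k * u ^ (j + 1)) * a2
  rw [hm]
  simp only [Nat.sub_self, Ring.choose_zero_right]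
  push_cast
  ring

/-! ### Beta integrals and orthogonality on [0, 1] -/

lemma intervalIntegrable_rpow_mul_one_sub_rpow {α β : ℝ} (hα : -1 < α) (hβ : -1 < β) :
    IntervalIntegrable (fun u : ℝ => u ^ β * (1 - u) ^ α) volume 0 1 := by
  have h := (Complex.betaIntegral_convergent (u := ((β + 1 : ℝ) : ℂ)) (v := ((α + 1 : ℝ) : ℂ))
    (by rw [Complex.ofReal_re]; linarith) (by rw [Complex.ofReal_re]; linarith)).norm
  rw [intervalIntegrable_iff_integrableOn_Ioo_of_le zero_le_one] at h ⊢
  refine h.congr_fun (fun x hx => ?_) measurableSet_Ioo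
  have h1 : (0 : ℝ) < 1 - x := by linarith [hx.2]
  have e : (1 : ℂ) - (x : ℂ) = ((1 - x : ℝ) : ℂ) := by push_cast; rfl
  simp only [norm_mul]
  rw [e, Complex.norm_cpow_eq_rpow_re_of_pos hx.1, Complex.norm_cpow_eq_rpow_re_of_pos h1]
  simp

lemma integral_rpow_mul_one_sub_rpow {α β : ℝ} (hα : -1 < α) (hβ : -1 < β) :
    ∫ u in (0 : ℝ)..1, u ^ β * (1 - u) ^ α =
      Real.Gamma (α + 1) * Real.Gamma (β + 1) / Real.Gamma (α + β + 2) := by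
  have h := ProbabilityTheory.beta_eq_betaIntegralReal (β + 1) (α + 1) (by linarith) (by linarith)
  rw [ProbabilityTheory.beta] at h
  have e : α + β + 2 = β + 1 + (α + 1) := by ring
  rw [e, mul_comm (Real.Gamma (α + 1)), h, Complex.betaIntegral]
  have : ∫ x in (0 : ℝ)..1, (x : ℂ) ^ (((β + 1 : ℝ) : ℂ) - 1) * (1 - (x : ℂ)) ^
      (((α + 1 : ℝ) : ℂ) - 1) = ∫ x in (0 : ℝ)..1, ((x ^ β * (1 - x) ^ α : ℝ) : ℂ) := by
    refine intervalIntegral.integral_congr fun x hx => ?_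
    rw [Set.uIcc_of_le zero_le_one] at hx
    have h1 : (0 : ℝ) ≤ 1 - x := by linarith [hx.2]
    have e : (1 : ℂ) - (x : ℂ) = ((1 - x : ℝ) : ℂ) := by push_cast; rfl
    have e1 : ((β + 1 : ℝ) : ℂ) - 1 = (β : ℂ) := by push_cast; ring
    have e2 : ((α + 1 : ℝ) : ℂ) - 1 = (α : ℂ) := by push_cast; ring
    rw [e, e1, e2, Complex.ofReal_mul, Complex.ofReal_cpow hx.1, Complex.ofReal_cpow h1]
  rw [this, intervalIntegral.integral_ofReal, Complex.ofReal_re]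

/-- Integration by parts against `jacUnit_rodrigues`. The boundary terms vanish because α+1 and β+1
are positive. -/
lemma integral_jacUnit_succ_mul {α β : ℝ} (hα : -1 < α) (hβ : -1 < β) (n : ℕ) {g g' : ℝ → ℝ}
    (hg : ∀ u, HasDerivAt g (g' u) u) (hg' : Continuous g') :
    (n + 1) * ∫ u in (0 : ℝ)..1, u ^ β * (1 - u) ^ α * (jacUnit α β (n + 1) u * g u) =
      ∫ u in (0 : ℝ)..1, u ^ (β + 1) * (1 - u) ^ (α + 1) *
        (jacUnit (α + 1) (β + 1) n u * g' u) := by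
  have hgc : Continuous g := continuous_iff_continuousAt.2 fun u => (hg u).continuousAt
  obtain ⟨q, hq⟩ : ∃ q : ℝ → ℝ, ∀ u, HasDerivAt (jacUnit (α + 1) (β + 1) n) (q u) u := by
    rcases n with _ | n
    · exact ⟨fun _ => 0, fun u => by
        have : jacUnit (α + 1) (β + 1) 0 = fun _ => 1 := by ext; simp
        rw [this]; exact hasDerivAt_const _ _⟩
    · exact ⟨_, fun u => hasDerivAt_jacUnit_succ (α + 1) (β + 1) n u⟩
  have i1 : IntervalIntegrable (fun u : ℝ => u ^ β * (1 - u) ^ α *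
      (jacUnit α β (n + 1) u * g u)) volume 0 1 :=
    (intervalIntegrable_rpow_mul_one_sub_rpow hα hβ).mul_continuousOn
      ((continuous_jacUnit _ _ _).mul hgc).continuousOn
  have i2 : IntervalIntegrable (fun u : ℝ => u ^ (β + 1) * (1 - u) ^ (α + 1) *
      (jacUnit (α + 1) (β + 1) n u * g' u)) volume 0 1 :=
    (intervalIntegrable_rpow_mul_one_sub_rpow (by linarith) (by linarith)).mul_continuousOn
      ((continuous_jacUnit _ _ _).mul hg').continuousOn
  have key := intervalIntegral.integral_eq_sub_of_hasDerivAt_of_le (a := 0) (b := 1)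
    (f := fun u : ℝ => u ^ (β + 1) * (1 - u) ^ (α + 1) * (jacUnit (α + 1) (β + 1) n u * g u))
    (f' := fun u : ℝ => u ^ (β + 1) * (1 - u) ^ (α + 1) * (jacUnit (α + 1) (β + 1) n u * g' u) -
      (n + 1) * (u ^ β * (1 - u) ^ α * (jacUnit α β (n + 1) u * g u)))
    zero_le_one ?_ ?_ (i2.sub (i1.const_mul _))
  · rw [intervalIntegral.integral_sub i2 (i1.const_mul _), intervalIntegral.integral_const_mul,
      sub_self, Real.zero_rpow (by linarith : α + 1 ≠ 0),
      Real.zero_rpow (by linarith : β + 1 ≠ 0)] at key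
    linarith
  · refine ContinuousOn.mul (ContinuousOn.mul ?_ ?_)
      ((continuous_jacUnit _ _ _).mul hgc).continuousOn
    · exact (Real.continuous_rpow_const (by linarith)).continuousOn
    · exact ((Real.continuous_rpow_const (by linarith)).comp
        (continuous_const.sub continuous_id)).continuousOn
  · intro u hu
    have h0 : u ≠ 0 := hu.1.ne'
    have h1 : 1 - u ≠ 0 := by linarith [hu.2]
    have d1 := Real.hasDerivAt_rpow_const (x := u) (p := β + 1) (Or.inl h0)
    have d2 : HasDerivAt (fun u : ℝ => (1 - u) ^ (α + 1)) (-1 * (α + 1) * (1 - u) ^ (α + 1 - 1)) u :=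
      ((hasDerivAt_id u).const_sub 1).rpow_const (Or.inl h1)
    convert! (d1.fun_mul d2).fun_mul ((hq u).fun_mul (hg u)) using 1
    have r := jacUnit_rodrigues (α := α) (β := β) (hq u)
    have e1 : u ^ (β + 1) = u ^ β * u := Real.rpow_add_one h0 β
    have e2 : (1 - u) ^ (α + 1) = (1 - u) ^ α * (1 - u) := Real.rpow_add_one h1 α
    rw [add_sub_cancel_right, add_sub_cancel_right, e1, e2]
    linear_combination -(u ^ β * (1 - u) ^ α * g u) * r

/-- The squared norm of the Jacobi polynomial on `[0, 1]`. -/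
def jacUnitNormSq (α β : ℝ) (n : ℕ) : ℝ :=
  if n = 0 then Real.Gamma (α + 1) * Real.Gamma (β + 1) / Real.Gamma (α + β + 2)
  else Real.Gamma (n + α + 1) * Real.Gamma (n + β + 1) /
    ((2 * n + α + β + 1) * Real.Gamma (n + 1) * Real.Gamma (n + α + β + 1))

/-- The recursion that `integral_jacUnit_mul_jacUnit_succ` gives for the integrals, so that
induction reduces the norms to the Beta integral. At n = 0 the right side uses the separate clause
of the definition. -/
lemma jacUnitNormSq_succ {α β : ℝ} (hα : -1 < α) (hβ : -1 < β) (n : ℕ) :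
    (n + 1) * jacUnitNormSq α β (n + 1) =
      (n + 2 + α + β) * jacUnitNormSq (α + 1) (β + 1) n := by
  have hn : (0 : ℝ) ≤ n := n.cast_nonneg
  have g0 : Real.Gamma ((n : ℝ) + 1 + 1) = (n + 1) * Real.Gamma (n + 1) :=
    Real.Gamma_add_one (by positivity)
  have g1 : 0 < Real.Gamma ((n : ℝ) + 1) := Real.Gamma_pos_of_pos (by positivity)
  have g2 : 0 < Real.Gamma ((n : ℝ) + 2 + α + β) := Real.Gamma_pos_of_pos (by linarith)
  have g3 : Real.Gamma ((n : ℝ) + 2 + α + β + 1) =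
    (n + 2 + α + β) * Real.Gamma (n + 2 + α + β) := Real.Gamma_add_one (by linarith)
  have p2 : 0 < (n : ℝ) + 2 + α + β := by linarith
  have p3 : 0 < (n : ℝ) + 3 + α + β := by linarith
  have p4 : 0 < 2 * (n : ℝ) + 3 + α + β := by linarith
  rcases n with _ | n
  · have g4 : Real.Gamma (2 + α + β + 1 + 1) =
        (2 + α + β + 1) * Real.Gamma (2 + α + β + 1) := Real.Gamma_add_one (by linarith)
    simp only [Nat.cast_zero, zero_add] at g0 g1 g2 g3 p2 p3 p4
    simp only [jacUnitNormSq, Nat.cast_zero, zero_add, if_true, Nat.cast_one, one_ne_zero, if_false]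
    rw [show (1 : ℝ) + α + β + 1 = 2 + α + β by ring,
      show α + 1 + (β + 1) + 2 = 2 + α + β + 1 + 1 by ring, g4, g3, g0,
      show (2 : ℝ) * 1 + α + β + 1 = 3 + α + β by ring,
      show (2 : ℝ) + α + β + 1 = 3 + α + β by ring, show α + 1 + 1 = 1 + α + 1 by ring,
      show β + 1 + 1 = 1 + β + 1 by ring, Real.Gamma_one]
    field_simp
  · simp only [jacUnitNormSq, Nat.add_eq_zero_iff, one_ne_zero, and_false, if_false]
    push_cast at g0 g1 g2 g3 p2 p3 p4 ⊢
    rw [show (n : ℝ) + 1 + 1 + α + β + 1 = n + 1 + 2 + α + β by ring,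
      show (n : ℝ) + 1 + (α + 1) + (β + 1) + 1 = n + 1 + 2 + α + β + 1 by ring, g3, g0,
      show (2 : ℝ) * (n + 1 + 1) + α + β + 1 = 2 * (n + 1) + 3 + α + β by ring,
      show (2 : ℝ) * (n + 1) + (α + 1) + (β + 1) + 1 = 2 * (n + 1) + 3 + α + β by ring,
      show (n : ℝ) + 1 + (α + 1) + 1 = n + 1 + 1 + α + 1 by ring,
      show (n : ℝ) + 1 + (β + 1) + 1 = n + 1 + 1 + β + 1 by ring]
    have : (0 : ℝ) < n + 1 + 1 := by positivity
    field_simp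

/-- Integration by parts with g itself a Jacobi polynomial. Iterating it until one degree is 0
yields both the orthogonality and the norms. -/
lemma integral_jacUnit_mul_jacUnit_succ {α β : ℝ} (hα : -1 < α) (hβ : -1 < β) (n m : ℕ) :
    (n + 1) * ∫ u in (0 : ℝ)..1, u ^ β * (1 - u) ^ α *
        (jacUnit α β (n + 1) u * jacUnit α β (m + 1) u) =
      (m + 2 + α + β) * ∫ u in (0 : ℝ)..1, u ^ (β + 1) * (1 - u) ^ (α + 1) *
        (jacUnit (α + 1) (β + 1) n u * jacUnit (α + 1) (β + 1) m u) := by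
  rw [integral_jacUnit_succ_mul hα hβ n (hasDerivAt_jacUnit_succ α β m)
    (continuous_const.mul (continuous_jacUnit _ _ _)), ← intervalIntegral.integral_const_mul]
  congr 1
  ext u
  ring

lemma integral_jacUnit_sq {α β : ℝ} (hα : -1 < α) (hβ : -1 < β) (n : ℕ) :
    ∫ u in (0 : ℝ)..1, u ^ β * (1 - u) ^ α * (jacUnit α β n u * jacUnit α β n u) =
      jacUnitNormSq α β n := by
  induction n generalizing α β with
  | zero => simpa [jacUnitNormSq] using integral_rpow_mul_one_sub_rpow hα hβ
  | succ n ih =>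
    have h := integral_jacUnit_mul_jacUnit_succ hα hβ n n
    rw [ih (by linarith) (by linarith), ← jacUnitNormSq_succ hα hβ] at h
    exact mul_left_cancel₀ (by positivity) h

lemma integral_jacUnit_mul_of_lt {α β : ℝ} (hα : -1 < α) (hβ : -1 < β) {m n : ℕ} (h : m < n) :
    ∫ u in (0 : ℝ)..1, u ^ β * (1 - u) ^ α * (jacUnit α β n u * jacUnit α β m u) = 0 := by
  induction m generalizing α β n with
  | zero =>
    obtain ⟨k, rfl⟩ := Nat.exists_eq_succ_of_ne_zero h.ne'
    have := integral_jacUnit_succ_mul hα hβ k (g := fun _ => 1) (g' := fun _ => 0)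
      (fun u => hasDerivAt_const _ _) continuous_const
    simp only [mul_zero, intervalIntegral.integral_zero] at this
    simpa using (mul_eq_zero.1 this).resolve_left (by positivity)
  | succ m ih =>
    obtain ⟨k, rfl⟩ := Nat.exists_eq_succ_of_ne_zero (Nat.ne_of_gt (Nat.zero_lt_of_lt h))
    have := integral_jacUnit_mul_jacUnit_succ hα hβ k m
    rw [ih (by linarith) (by linarith) (by omega), mul_zero] at this
    exact (mul_eq_zero.1 this).resolve_left (by positivity)

lemma integral_jacUnit_mul_jacUnit {α β : ℝ} (hα : -1 < α) (hβ : -1 < β) (m n : ℕ) :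
    ∫ u in (0 : ℝ)..1, u ^ β * (1 - u) ^ α * (jacUnit α β m u * jacUnit α β n u) =
      if m = n then jacUnitNormSq α β n else 0 := by
  rcases lt_trichotomy m n with h | rfl | h
  · rw [if_neg h.ne]
    simpa only [mul_comm (jacUnit α β m _)] using integral_jacUnit_mul_of_lt hα hβ h
  · rw [if_pos rfl, integral_jacUnit_sq hα hβ]
  · rw [if_neg h.ne', integral_jacUnit_mul_of_lt hα hβ h]

/-! ### The weighted measure and the substitution u = t² -/

lemma measurable_weight (lam mu : ℝ) : Measurable (weight lam mu) := by
  unfold weight; fun_prop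

lemma weight_nonneg (lam mu : ℝ) {t : ℝ} (ht : t ∈ Set.Icc (-1 : ℝ) 1) : 0 ≤ weight lam mu t := by
  have : 0 ≤ 1 - t ^ 2 := by nlinarith [ht.1, ht.2]
  unfold weight; positivity

lemma integral_weightMeasure (lam mu : ℝ) (g : ℝ → ℝ) :
    ∫ t, g t ∂(weightMeasure lam mu) = ∫ t in Set.Icc (-1 : ℝ) 1, weight lam mu t * g t := by
  rw [weightMeasure, integral_withDensity_eq_integral_toReal_smul
    (measurable_weight lam mu).ennreal_ofReal (Eventually.of_forall fun _ => ENNReal.ofReal_lt_top)]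
  refine setIntegral_congr_fun measurableSet_Icc fun t ht => ?_
  simp [ENNReal.toReal_ofReal (weight_nonneg lam mu ht)]

/-- The even integrand folds onto the half line, where u = t² applies; du = 2t dt absorbs one power
of t and turns |t|^(2μ) into u^(μ-1/2). No integrability of g is needed, since the change of
variables holds for the total integral. -/
lemma setIntegral_weight_mul_comp_sq (lam mu : ℝ) (g : ℝ → ℝ) :
    ∫ t in Set.Icc (-1 : ℝ) 1, weight lam mu t * g (t ^ 2) =
      ∫ u in (0 : ℝ)..1, u ^ (mu - 1 / 2) * (1 - u) ^ (lam - 1 / 2) * g u := by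
  set G : ℝ → ℝ := fun s => (Set.Icc (-1 : ℝ) 1).indicator (fun t => weight lam mu t * g (t ^ 2)) s
    with hG
  set H : ℝ → ℝ := fun u => (Set.Ioc (0 : ℝ) 1).indicator
    (fun u => u ^ (mu - 1 / 2) * (1 - u) ^ (lam - 1 / 2) * g u) u with hH
  have hGabs : ∀ t, G |t| = G t := by
    intro t
    rcases abs_choice t with h | h
    · rw [h]
    · rw [h]
      simp only [hG, Set.indicator, weight, Set.mem_Icc, abs_neg, neg_sq]
      have : (-1 ≤ -t ∧ -t ≤ 1) ↔ (-1 ≤ t ∧ t ≤ 1) := by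
        constructor <;> rintro ⟨h1, h2⟩ <;> constructor <;> linarith
      simp only [this]
  have h1 : ∫ t in Set.Icc (-1 : ℝ) 1, weight lam mu t * g (t ^ 2) = 2 * ∫ s in Set.Ioi 0, G s := by
    rw [← integral_comp_abs, ← integral_indicator measurableSet_Icc]
    exact integral_congr_ae (Eventually.of_forall fun t => (hGabs t).symm)
  have h2 : ∫ u in (0 : ℝ)..1, u ^ (mu - 1 / 2) * (1 - u) ^ (lam - 1 / 2) * g u =
      ∫ u in Set.Ioi 0, H u := by
    rw [intervalIntegral.integral_of_le zero_le_one, hH,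
      setIntegral_indicator measurableSet_Ioc]
    congr 2
    ext x; simp +contextual
  rw [h1, h2, ← integral_comp_rpow_Ioi_of_pos (g := H) (p := 2) two_pos, ← integral_const_mul]
  refine setIntegral_congr_fun measurableSet_Ioi fun t ht => ?_
  have ht : 0 < t := ht
  have hm : t ∈ Set.Icc (-1 : ℝ) 1 ↔ t ^ (2 : ℝ) ∈ Set.Ioc (0 : ℝ) 1 := by
    rw [Real.rpow_two]
    constructor
    · intro h; exact ⟨by positivity, by nlinarith [h.2]⟩
    · intro h; exact ⟨by linarith, by nlinarith [h.2]⟩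
  simp only [hG, hH, smul_eq_mul]
  by_cases h : t ∈ Set.Icc (-1 : ℝ) 1
  · rw [Set.indicator_of_mem h, Set.indicator_of_mem (hm.1 h), weight, abs_of_pos ht,
      ← Real.rpow_mul ht.le, Real.rpow_two, show (2 : ℝ) * (mu - 1 / 2) = 2 * mu - 1 by ring,
      Real.rpow_sub_one ht.ne', Real.rpow_sub_one ht.ne', Real.rpow_two]
    field_simp
  · rw [Set.indicator_of_notMem h, Set.indicator_of_notMem (fun h' => h (hm.2 h'))]
    simp

lemma integral_comp_sq_weightMeasure (lam mu : ℝ) (g : ℝ → ℝ) :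
    ∫ t, g (t ^ 2) ∂(weightMeasure lam mu) =
      ∫ u in (0 : ℝ)..1, u ^ (mu - 1 / 2) * (1 - u) ^ (lam - 1 / 2) * g u := by
  rw [integral_weightMeasure, setIntegral_weight_mul_comp_sq]

/-- The product of two odd polynomials carries t², which raises the Jacobi parameter μ-1/2 to μ+1/2.
-/
lemma integral_sq_mul_comp_sq_weightMeasure (lam mu : ℝ) (g : ℝ → ℝ) :
    ∫ t, t ^ 2 * g (t ^ 2) ∂(weightMeasure lam mu) =
      ∫ u in (0 : ℝ)..1, u ^ (mu + 1 / 2) * (1 - u) ^ (lam - 1 / 2) * g u := by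
  rw [integral_comp_sq_weightMeasure lam mu (fun u => u * g u),
    intervalIntegral.integral_of_le zero_le_one, intervalIntegral.integral_of_le zero_le_one]
  refine setIntegral_congr_fun measurableSet_Ioc fun u hu => ?_
  have : u ^ (mu + 1 / 2) = u ^ (mu - 1 / 2) * u := by
    rw [← Real.rpow_add_one hu.1.ne']; congr 1; ring
  simp only [this]
  ring

lemma integral_mul_comp_sq_weightMeasure (lam mu : ℝ) (g : ℝ → ℝ) :
    ∫ t, t * g (t ^ 2) ∂(weightMeasure lam mu) = 0 := by
  rw [integral_weightMeasure, ← integral_indicator measurableSet_Icc]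
  set F := (Set.Icc (-1 : ℝ) 1).indicator fun t => weight lam mu t * (t * g (t ^ 2)) with hF
  have hodd : ∀ t, F (-t) = -F t := by
    intro t
    have : (-1 ≤ -t ∧ -t ≤ 1) ↔ (-1 ≤ t ∧ t ≤ 1) := by
      constructor <;> rintro ⟨h1, h2⟩ <;> constructor <;> linarith
    simp only [hF, Set.indicator, Set.mem_Icc, this, weight, abs_neg, neg_sq]
    split_ifs <;> ring
  have h := integral_neg_eq_self F volume
  simp only [hodd, integral_neg] at h
  linarith

variable {lam mu : ℝ}

lemma integral_one_weightMeasure_pos (hlam : -(1 / 2) < lam) (hmu : 0 ≤ mu) :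
    0 < ∫ _, (1 : ℝ) ∂(weightMeasure lam mu) := by
  rw [integral_comp_sq_weightMeasure lam mu (fun _ => 1)]
  simp only [mul_one]
  rw [integral_rpow_mul_one_sub_rpow (by linarith) (by linarith)]
  exact div_pos (mul_pos (Real.Gamma_pos_of_pos (by linarith)) (Real.Gamma_pos_of_pos
    (by linarith))) (Real.Gamma_pos_of_pos (by linarith))

/-- A function with nonzero Bochner integral is integrable; here the function is the constant 1,
whose integral is a positive Beta value. -/
lemma isFiniteMeasure_weightMeasure (hlam : -(1 / 2) < lam) (hmu : 0 ≤ mu) :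
    IsFiniteMeasure (weightMeasure lam mu) := by
  have h := Integrable.of_integral_ne_zero (integral_one_weightMeasure_pos hlam hmu).ne'
  rwa [integrable_const_iff_isFiniteMeasure one_ne_zero] at h

lemma weightMeasure_ne_zero (hlam : -(1 / 2) < lam) (hmu : 0 ≤ mu) :
    weightMeasure lam mu ≠ 0 := by
  intro h
  have := integral_one_weightMeasure_pos hlam hmu
  simp [h] at this

lemma ae_weightMeasure_mem_Icc (lam mu : ℝ) :
    ∀ᵐ t ∂(weightMeasure lam mu), t ∈ Set.Icc (-1 : ℝ) 1 :=
  (withDensity_absolutelyContinuous _ _).ae_le (ae_restrict_mem measurableSet_Icc)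

/-! ### Orthonormality of the generalized Gegenbauer polynomials -/

lemma orthoGegenbauer_two_mul (m : ℕ) (t : ℝ) : orthoGegenbauer lam mu (2 * m) t =
    evenCoeff lam mu m * jacUnit (lam - 1 / 2) (mu - 1 / 2) m (t ^ 2) := by
  rw [orthoGegenbauer, if_pos (by simp), jacobi_two_mul_sub_one,
    Nat.mul_div_cancel_left m two_pos]

lemma orthoGegenbauer_two_mul_add_one (m : ℕ) (t : ℝ) : orthoGegenbauer lam mu (2 * m + 1) t =
    oddCoeff lam mu m * (t * jacUnit (lam - 1 / 2) (mu + 1 / 2) m (t ^ 2)) := by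
  have : (2 * m + 1) / 2 = m := by omega
  rw [orthoGegenbauer, if_neg (by simp), jacobi_two_mul_sub_one, this]

lemma continuous_orthoGegenbauer (lam mu : ℝ) (n : ℕ) :
    Continuous (orthoGegenbauer lam mu n) := by
  rcases n.even_or_odd' with ⟨m, rfl | rfl⟩
  · simp only [funext (orthoGegenbauer_two_mul (lam := lam) (mu := mu) m)]
    exact continuous_const.mul ((continuous_jacUnit _ _ _).comp (continuous_pow 2))
  · simp only [funext (orthoGegenbauer_two_mul_add_one (lam := lam) (mu := mu) m)]
    exact continuous_const.mul
      (continuous_id.mul ((continuous_jacUnit _ _ _).comp (continuous_pow 2)))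

lemma evenCoeff_sq_mul_jacUnitNormSq (hlam : -(1 / 2) < lam) (hmu : 0 ≤ mu) (m : ℕ) :
    evenCoeff lam mu m ^ 2 * jacUnitNormSq (lam - 1 / 2) (mu - 1 / 2) m = 1 := by
  have hm : (0 : ℝ) ≤ m := m.cast_nonneg
  have g1 : 0 < Real.Gamma (m + lam + 1 / 2) := Real.Gamma_pos_of_pos (by linarith)
  have g2 : 0 < Real.Gamma (m + mu + 1 / 2) := Real.Gamma_pos_of_pos (by linarith)
  rw [evenCoeff, jacUnitNormSq]
  split_ifs with h0
  · subst h0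
    simp only [Nat.cast_zero, zero_add] at g1 g2 ⊢
    have g3 : 0 < Real.Gamma (lam + mu + 1) := Real.Gamma_pos_of_pos (by linarith)
    rw [Real.sq_sqrt (by positivity), show lam - 1 / 2 + 1 = lam + 1 / 2 by ring,
      show mu - 1 / 2 + 1 = mu + 1 / 2 by ring,
      show lam - 1 / 2 + (mu - 1 / 2) + 2 = lam + mu + 1 by ring]
    generalize Real.Gamma (lam + 1 / 2) = x at g1 ⊢
    field_simp
  · have hm1 : (1 : ℝ) ≤ m := by exact_mod_cast Nat.one_le_iff_ne_zero.2 h0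
    have g3 : 0 < Real.Gamma (m + lam + mu) := Real.Gamma_pos_of_pos (by linarith)
    have g4 : 0 < Real.Gamma ((m : ℝ) + 1) := Real.Gamma_pos_of_pos (by linarith)
    have g5 : 0 < 2 * (m : ℝ) + lam + mu := by linarith
    rw [Real.sq_sqrt (by positivity), show m + (lam - 1 / 2) + 1 = m + lam + 1 / 2 by ring,
      show m + (mu - 1 / 2) + 1 = m + mu + 1 / 2 by ring,
      show m + (lam - 1 / 2) + (mu - 1 / 2) + 1 = m + lam + mu by ring,
      show 2 * m + (lam - 1 / 2) + (mu - 1 / 2) + 1 = 2 * m + lam + mu by ring]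
    generalize Real.Gamma (m + lam + 1 / 2) = x at g1 ⊢
    field_simp

lemma oddCoeff_sq_mul_jacUnitNormSq (hlam : -(1 / 2) < lam) (hmu : 0 ≤ mu) (m : ℕ) :
    oddCoeff lam mu m ^ 2 * jacUnitNormSq (lam - 1 / 2) (mu + 1 / 2) m = 1 := by
  have hm : (0 : ℝ) ≤ m := m.cast_nonneg
  have g1 : 0 < Real.Gamma (m + lam + 1 / 2) := Real.Gamma_pos_of_pos (by linarith)
  have g2 : 0 < Real.Gamma (m + mu + 3 / 2) := Real.Gamma_pos_of_pos (by linarith)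
  have g3 : 0 < Real.Gamma (m + lam + mu + 1) := Real.Gamma_pos_of_pos (by linarith)
  have g4 : 0 < Real.Gamma ((m : ℝ) + 1) := Real.Gamma_pos_of_pos (by linarith)
  have g5 : 0 < 2 * (m : ℝ) + lam + mu + 1 := by linarith
  rw [oddCoeff, Real.sq_sqrt (by positivity), jacUnitNormSq]
  split_ifs with h0
  · subst h0
    simp only [Nat.cast_zero, zero_add, mul_zero] at g1 g2 g3 g5 ⊢
    rw [show lam - 1 / 2 + 1 = lam + 1 / 2 by ring,
      show mu + 1 / 2 + 1 = mu + 3 / 2 by ring,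
      show lam - 1 / 2 + (mu + 1 / 2) + 2 = lam + mu + 1 + 1 by ring,
      Real.Gamma_add_one (by linarith : lam + mu + 1 ≠ 0), Real.Gamma_one]
    generalize Real.Gamma (lam + 1 / 2) = x at g1 ⊢
    field_simp
  · rw [show m + (lam - 1 / 2) + 1 = m + lam + 1 / 2 by ring,
      show m + (mu + 1 / 2) + 1 = m + mu + 3 / 2 by ring,
      show m + (lam - 1 / 2) + (mu + 1 / 2) + 1 = m + lam + mu + 1 by ring,
      show 2 * m + (lam - 1 / 2) + (mu + 1 / 2) + 1 = 2 * m + lam + mu + 1 by ring]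
    generalize Real.Gamma (m + lam + 1 / 2) = x at g1 ⊢
    field_simp

/-- Opposite parities integrate to zero by oddness. Equal parities reduce through u = t² to Jacobi
orthogonality with second parameter μ-1/2 (even) or μ+1/2 (odd). -/
lemma integral_orthoGegenbauer_mul (hlam : -(1 / 2) < lam) (hmu : 0 ≤ mu) (m n : ℕ) :
    ∫ t, orthoGegenbauer lam mu m t * orthoGegenbauer lam mu n t ∂(weightMeasure lam mu) =
      if m = n then 1 else 0 := by
  rcases m.even_or_odd' with ⟨k, rfl | rfl⟩ <;> rcases n.even_or_odd' with ⟨l, rfl | rfl⟩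
  · have h := integral_comp_sq_weightMeasure lam mu (fun u =>
      jacUnit (lam - 1 / 2) (mu - 1 / 2) k u * jacUnit (lam - 1 / 2) (mu - 1 / 2) l u)
    rw [integral_jacUnit_mul_jacUnit (by linarith) (by linarith)] at h
    simp only [orthoGegenbauer_two_mul, mul_mul_mul_comm (evenCoeff lam mu k)]
    rw [integral_const_mul, h]
    by_cases hkl : k = l
    · subst hkl
      simpa [← sq] using evenCoeff_sq_mul_jacUnitNormSq hlam hmu k
    · simp [hkl]
  · rw [if_neg (by omega), ← mul_zero (evenCoeff lam mu k * oddCoeff lam mu l),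
      ← integral_mul_comp_sq_weightMeasure lam mu (fun u =>
        jacUnit (lam - 1 / 2) (mu - 1 / 2) k u * jacUnit (lam - 1 / 2) (mu + 1 / 2) l u),
      ← integral_const_mul]
    congr 1; ext t
    rw [orthoGegenbauer_two_mul, orthoGegenbauer_two_mul_add_one]; ring
  · rw [if_neg (by omega), ← mul_zero (oddCoeff lam mu k * evenCoeff lam mu l),
      ← integral_mul_comp_sq_weightMeasure lam mu (fun u =>
        jacUnit (lam - 1 / 2) (mu + 1 / 2) k u * jacUnit (lam - 1 / 2) (mu - 1 / 2) l u),
      ← integral_const_mul]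
    congr 1; ext t
    rw [orthoGegenbauer_two_mul, orthoGegenbauer_two_mul_add_one]; ring
  · have h := integral_sq_mul_comp_sq_weightMeasure lam mu (fun u =>
      jacUnit (lam - 1 / 2) (mu + 1 / 2) k u * jacUnit (lam - 1 / 2) (mu + 1 / 2) l u)
    rw [integral_jacUnit_mul_jacUnit (by linarith) (by linarith)] at h
    have e : ∀ t : ℝ, orthoGegenbauer lam mu (2 * k + 1) t * orthoGegenbauer lam mu (2 * l + 1) t =
        oddCoeff lam mu k * oddCoeff lam mu l * (t ^ 2 *
          (jacUnit (lam - 1 / 2) (mu + 1 / 2) k (t ^ 2) *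
            jacUnit (lam - 1 / 2) (mu + 1 / 2) l (t ^ 2))) := by
      intro t; rw [orthoGegenbauer_two_mul_add_one, orthoGegenbauer_two_mul_add_one]; ring
    simp only [e]
    rw [integral_const_mul, h]
    by_cases hkl : k = l
    · subst hkl
      simpa [← sq] using oddCoeff_sq_mul_jacUnitNormSq hlam hmu k
    · simp [hkl]

/-! ### Growth of Gamma quotients and of the end point values -/

lemma Gamma_add_natCast_eq_prod {c : ℝ} (hc : 0 < c) (n : ℕ) :
    Real.Gamma (n + c) = Real.Gamma c * ∏ j ∈ Finset.range n, (c + j) := by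
  induction n with
  | zero => simp
  | succ n ih =>
    rw [Finset.prod_range_succ, Nat.cast_succ, add_right_comm, Real.Gamma_add_one (by positivity),
      ih]
    ring

/-- Euler's limit formula: the quotient is Γ(c)/`GammaSeq c n` times (n/(n+1))^(c-1) and n/(n+c),
and all three factors tend to 1. -/
lemma tendsto_Gamma_div_rpow_mul_factorial {c : ℝ} (hc : 0 < c) :
    Tendsto (fun n : ℕ => Real.Gamma (n + c) / (((n : ℝ) + 1) ^ (c - 1) * n.factorial)) atTop
      (𝓝 1) := by
  have hG := Real.Gamma_pos_of_pos hc
  have h1 := (tendsto_const_nhds (x := Real.Gamma c)).div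
    (Real.GammaSeq_tendsto_Gamma c) hG.ne'
  have h2 := (tendsto_natCast_div_add_atTop (1 : ℝ)).rpow_const (p := c - 1)
    (Or.inl one_ne_zero)
  have h3 := tendsto_natCast_div_add_atTop (c : ℝ)
  have h := (h1.mul h2).mul h3
  rw [div_self hG.ne', Real.one_rpow, mul_one, mul_one] at h
  refine h.congr' ?_
  filter_upwards [eventually_ge_atTop 1] with n hn
  have hn : (0 : ℝ) < n := by exact_mod_cast hn
  have hf : (0 : ℝ) < n.factorial := by positivity
  have hp : 0 < ∏ j ∈ Finset.range n, (c + j) :=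
    Finset.prod_pos fun j _ => by positivity
  change Real.Gamma c / Real.GammaSeq c n * ((n : ℝ) / (n + 1)) ^ (c - 1) * (n / (n + c)) = _
  rw [Real.GammaSeq, Gamma_add_natCast_eq_prod hc, Finset.prod_range_succ,
    Real.div_rpow hn.le (by positivity), Real.rpow_sub_one hn.ne']
  have : (0 : ℝ) < (n : ℝ) ^ c := by positivity
  have : (0 : ℝ) < ((n : ℝ) + 1) ^ (c - 1) := by positivity
  field_simp
  ring

lemma exists_Gamma_le {c : ℝ} (hc : 0 < c) :
    ∃ K : ℝ, 0 < K ∧ ∀ n : ℕ, Real.Gamma (n + c) ≤ K * (((n : ℝ) + 1) ^ (c - 1) * n.factorial) := by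
  obtain ⟨K, hK⟩ := (tendsto_Gamma_div_rpow_mul_factorial hc).bddAbove_range
  refine ⟨max K 1, by positivity, fun n => ?_⟩
  rw [← div_le_iff₀ (by positivity)]
  exact (hK ⟨n, rfl⟩).trans (le_max_left _ _)

lemma exists_le_Gamma {c : ℝ} (hc : 0 < c) :
    ∃ K : ℝ, 0 < K ∧ ∀ n : ℕ, ((n : ℝ) + 1) ^ (c - 1) * n.factorial ≤ K * Real.Gamma (n + c) := by
  obtain ⟨K, hK⟩ := ((tendsto_Gamma_div_rpow_mul_factorial hc).inv₀ one_ne_zero).bddAbove_range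
  refine ⟨max K 1, by positivity, fun n => ?_⟩
  have hG : 0 < Real.Gamma (n + c) := Real.Gamma_pos_of_pos (by positivity)
  have := (hK ⟨n, rfl⟩).trans (le_max_left K 1)
  simp only [inv_div] at this
  rwa [div_le_iff₀ hG] at this

/-- This is the value of the Jacobi polynomial at an end point, up to sign; the Gamma form shows
that it grows like n^α. -/
lemma choose_natCast_add_eq_Gamma {α : ℝ} (hα : -1 < α) (n : ℕ) :
    Ring.choose ((n : ℝ) + α) n = Real.Gamma (n + (α + 1)) / (Real.Gamma (α + 1) * n.factorial) := by
  have hG : 0 < Real.Gamma (α + 1) := Real.Gamma_pos_of_pos (by linarith)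
  induction n with
  | zero => simp [hG.ne']
  | succ n ih =>
    have hn : (0 : ℝ) ≤ n := n.cast_nonneg
    have h := succ_mul_choose_succ_succ ((n : ℝ) + α) n
    rw [ih] at h
    have hf : (0 : ℝ) < n.factorial := by positivity
    rw [Nat.cast_succ, add_right_comm (n : ℝ) 1 α, add_right_comm (n : ℝ) 1 (α + 1),
      Real.Gamma_add_one (by linarith), Nat.factorial_succ, Nat.cast_mul, Nat.cast_succ]
    apply mul_left_cancel₀ (by positivity : (n : ℝ) + 1 ≠ 0)
    rw [h]
    field_simp
    ring

lemma exists_choose_natCast_add_le {α : ℝ} (hα : -1 < α) :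
    ∃ K : ℝ, 0 < K ∧ ∀ n : ℕ, |Ring.choose ((n : ℝ) + α) n| ≤ K * ((n : ℝ) + 1) ^ α := by
  obtain ⟨K, hK, h⟩ := exists_Gamma_le (c := α + 1) (by linarith)
  have hG : 0 < Real.Gamma (α + 1) := Real.Gamma_pos_of_pos (by linarith)
  refine ⟨K / Real.Gamma (α + 1), by positivity, fun n => ?_⟩
  have hf : (0 : ℝ) < n.factorial := by positivity
  have hG' : 0 < Real.Gamma (n + (α + 1)) :=
    Real.Gamma_pos_of_pos (by have : (0 : ℝ) ≤ n := n.cast_nonneg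
                              linarith)
  rw [choose_natCast_add_eq_Gamma hα, abs_of_pos (by positivity), div_le_iff₀ (by positivity)]
  refine (h n).trans_eq ?_
  rw [add_sub_cancel_right]
  field_simp

/-! ### Sonin's argument and the uniform bound -/

/-- The Sonin function of a Jacobi polynomial takes its maximum at an end point. -/
lemma jacUnit_sonin_le {α β M : ℝ} (hβ : -(1 / 2) ≤ β) (n : ℕ) (hc : 0 ≤ n + 2 + α + β)
    (h0 : |jacUnit α β (n + 1) 0| ≤ M) (h1 : -(1 / 2) ≤ α → |jacUnit α β (n + 1) 1| ≤ M)
    {u : ℝ} (hu : u ∈ Set.Icc (0 : ℝ) 1) :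
    jacUnit α β (n + 1) u ^ 2 +
      u * (1 - u) * ((n + 2 + α + β) / (n + 1)) * jacUnit (α + 1) (β + 1) n u ^ 2 ≤ M ^ 2 := by
  obtain ⟨q, hq⟩ : ∃ q : ℝ → ℝ, ∀ u, HasDerivAt (jacUnit (α + 1) (β + 1) n) (q u) u := by
    rcases n with _ | n
    · exact ⟨fun _ => 0, fun u => by
        have : jacUnit (α + 1) (β + 1) 0 = fun _ => 1 := by ext; simp
        rw [this]; exact hasDerivAt_const _ _⟩
    · exact ⟨_, fun u => hasDerivAt_jacUnit_succ (α + 1) (β + 1) n u⟩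
  set f : ℝ → ℝ := fun u => jacUnit α β (n + 1) u ^ 2 +
      u * (1 - u) * ((n + 2 + α + β) / (n + 1)) * jacUnit (α + 1) (β + 1) n u ^ 2 with hf
  -- By `jacUnit_rodrigues` the mixed terms cancel, leaving a nonnegative factor times a linear
  -- function of u, so monotonicity depends only on the sign of the latter.
  have hd : ∀ u, HasDerivAt f ((n + 2 + α + β) / (n + 1) * jacUnit (α + 1) (β + 1) n u ^ 2 *
      (-(2 * β + 1) * (1 - u) + (2 * α + 1) * u)) u := by
    intro u
    have d1 := (hasDerivAt_jacUnit_succ α β n u).fun_pow 2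
    have d2 : HasDerivAt (fun u : ℝ => u * (1 - u) * ((n + 2 + α + β) / (n + 1)))
        ((1 * (1 - u) + u * (-1)) * ((n + 2 + α + β) / (n + 1))) u :=
      ((hasDerivAt_id u).fun_mul ((hasDerivAt_id u).const_sub 1)).mul_const _
    have d3 := (hq u).fun_pow 2
    convert! d1.fun_add (d2.fun_mul d3) using 1
    have r := jacUnit_rodrigues (α := α) (β := β) (hq u)
    have hn : (n : ℝ) + 1 ≠ 0 := by positivity
    simp only [Nat.cast_ofNat, Nat.reduceSub, pow_one]
    field_simp
    linear_combination (-(2 * (n + 2 + α + β) * jacUnit (α + 1) (β + 1) n u)) * r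
  have hcont : Continuous f := continuous_iff_continuousAt.2 fun u => (hd u).continuousAt
  have hcn : 0 ≤ ((n : ℝ) + 2 + α + β) / (n + 1) := by positivity
  have hf0 : f 0 ≤ M ^ 2 := by
    simpa [hf, sq_abs] using pow_le_pow_left₀ (abs_nonneg _) h0 2
  have hf1 : -(1 / 2) ≤ α → f 1 ≤ M ^ 2 := by
    intro hα
    simpa [hf, sq_abs] using pow_le_pow_left₀ (abs_nonneg _) (h1 hα) 2
  change f u ≤ M ^ 2
  obtain ⟨hu0, hu1⟩ := hu
  -- The linear factor is nonpositive at 0 because β ≥ -1/2. If it is nonpositive at u too, it is so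
  -- on [0, u], and f decreases from its value at 0.
  by_cases hl : -(2 * β + 1) * (1 - u) + (2 * α + 1) * u ≤ 0
  · refine le_trans ?_ hf0
    refine antitoneOn_of_deriv_nonpos (convex_Icc 0 u) hcont.continuousOn
      (fun x _ => (hd x).differentiableAt.differentiableWithinAt) (fun x hx => ?_)
      (Set.left_mem_Icc.2 hu0) (Set.right_mem_Icc.2 hu0) hu0
    rw [interior_Icc] at hx
    rw [(hd x).deriv]
    refine mul_nonpos_of_nonneg_of_nonpos (by positivity) ?_
    rcases hu0.eq_or_lt with rfl | hu0'
    · exact absurd (hx.1.trans hx.2) (lt_irrefl _)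
    · by_cases hs : 0 ≤ 2 * α + 1 + (2 * β + 1)
      · nlinarith [mul_le_mul_of_nonneg_left hx.2.le hs]
      · nlinarith [hx.1, hx.2, mul_nonneg hx.1.le (by linarith : 0 ≤ -(2 * α + 1 + (2 * β + 1)))]
  -- A positive value at u forces α ≥ -1/2, so the bound at 1 becomes available, and f increases on
  -- [u, 1].
  · push Not at hl
    have hα : -(1 / 2) ≤ α := by
      by_contra hα
      nlinarith [mul_nonneg hu0 (by linarith : 0 ≤ -(2 * α + 1)),
        mul_nonneg (sub_nonneg.2 hu1) (by linarith : 0 ≤ 2 * β + 1)]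
    refine le_trans ?_ (hf1 hα)
    refine monotoneOn_of_deriv_nonneg (convex_Icc u 1) hcont.continuousOn
      (fun x _ => (hd x).differentiableAt.differentiableWithinAt) (fun x hx => ?_)
      (Set.left_mem_Icc.2 hu1) (Set.right_mem_Icc.2 hu1) hu1
    rw [interior_Icc] at hx
    rw [(hd x).deriv]
    refine mul_nonneg (by positivity) ?_
    nlinarith [mul_nonneg (sub_nonneg.2 hx.1.le) (by linarith : 0 ≤ 2 * α + 1 + (2 * β + 1))]

lemma add_two_rpow_le (s : ℝ) (m : ℕ) :
    ((m : ℝ) + 2) ^ s ≤ 2 ^ |s| * ((m : ℝ) + 1) ^ s := by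
  have hm : (0 : ℝ) ≤ m := m.cast_nonneg
  rcases le_total 0 s with hs | hs
  · rw [abs_of_nonneg hs, ← Real.mul_rpow two_pos.le (by positivity)]
    exact Real.rpow_le_rpow (by positivity) (by linarith) hs
  · calc ((m : ℝ) + 2) ^ s ≤ ((m : ℝ) + 1) ^ s :=
        Real.rpow_le_rpow_of_nonpos (by positivity) (by linarith) hs
      _ ≤ _ := le_mul_of_one_le_left (by positivity)
        (Real.one_le_rpow one_le_two (abs_nonneg s))

/-- The derivative term of the Sonin function is nonnegative, so the polynomial itself is bounded by
the end point values, of orders m^α and m^β. -/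
lemma exists_abs_jacUnit_le {α β : ℝ} (hα : -1 < α) (hβ : -(1 / 2) ≤ β) :
    ∃ K : ℝ, 0 < K ∧ ∀ (m : ℕ), ∀ u ∈ Set.Icc (0 : ℝ) 1,
      |jacUnit α β m u| ≤ K * ((m : ℝ) + 1) ^ max α β := by
  obtain ⟨K₁, hK₁, h₁⟩ := exists_choose_natCast_add_le hα
  obtain ⟨K₂, hK₂, h₂⟩ := exists_choose_natCast_add_le (α := β) (by linarith)
  refine ⟨max 1 (max K₁ K₂), by positivity, fun m u hu => ?_⟩
  rcases m with _ | n
  · simp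
  · set M := max 1 (max K₁ K₂) * (((n + 1 : ℕ) : ℝ) + 1) ^ max α β with hM
    have hb : (1 : ℝ) ≤ ((n + 1 : ℕ) : ℝ) + 1 := by simp; positivity
    have h0 : |jacUnit α β (n + 1) 0| ≤ M := by
      rw [jacUnit_zero, abs_mul, abs_pow, abs_neg, abs_one, one_pow, one_mul]
      refine (h₂ _).trans (mul_le_mul ?_ ?_ (by positivity) (by positivity))
      · exact (le_max_right _ _).trans (le_max_right _ _)
      · exact Real.rpow_le_rpow_of_exponent_le hb (le_max_right _ _)
    have h1 : |jacUnit α β (n + 1) 1| ≤ M := by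
      rw [jacUnit_one]
      refine (h₁ _).trans (mul_le_mul ?_ ?_ (by positivity) (by positivity))
      · exact (le_max_left _ _).trans (le_max_right _ _)
      · exact Real.rpow_le_rpow_of_exponent_le hb (le_max_left _ _)
    have hn : (0 : ℝ) ≤ n := n.cast_nonneg
    have hc : (0 : ℝ) ≤ n + 2 + α + β := by linarith
    have h := jacUnit_sonin_le hβ n hc h0 (fun _ => h1) hu
    have hx : 0 ≤ u * (1 - u) * ((n + 2 + α + β) / (n + 1)) * jacUnit (α + 1) (β + 1) n u ^ 2 :=
      mul_nonneg (mul_nonneg (mul_nonneg hu.1 (sub_nonneg.2 hu.2)) (by positivity)) (sq_nonneg _)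
    exact abs_le_of_sq_le_sq (by linarith) (by positivity)

/-- Needed for odd degrees: the factor √u saves a power over the growth m^(β+1) at u = 0. For u ≤
1/2 the derivative term of the Sonin function with parameters (α-1, β) is exactly of this shape; for
u ≥ 1/2 `jacUnit_contiguous` reduces to parameters (α, β). As α-1 may lie below -1/2, the Sonin
bound must not ask for a value at 1 in that case. -/
lemma exists_mul_jacUnit_sq_le {α β : ℝ} (hα : -1 < α) (hβ : -(1 / 2) ≤ β) :
    ∃ K : ℝ, 0 < K ∧ ∀ (m : ℕ), ∀ u ∈ Set.Icc (0 : ℝ) 1,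
      u * jacUnit α (β + 1) m u ^ 2 ≤ (K * ((m : ℝ) + 1) ^ max α β) ^ 2 := by
  obtain ⟨K₁, hK₁, h₁⟩ : ∃ K : ℝ, 0 < K ∧ (-(1 / 2) ≤ α - 1 →
      ∀ n : ℕ, |Ring.choose ((n : ℝ) + (α - 1)) n| ≤ K * ((n : ℝ) + 1) ^ (α - 1)) := by
    by_cases h : -(1 / 2) ≤ α - 1
    · obtain ⟨K, hK, h'⟩ := exists_choose_natCast_add_le (α := α - 1) (by linarith)
      exact ⟨K, hK, fun _ => h'⟩
    · exact ⟨1, one_pos, fun h' => absurd h' h⟩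
  obtain ⟨K₂, hK₂, h₂⟩ := exists_choose_natCast_add_le (α := β) (by linarith)
  obtain ⟨K₃, hK₃, h₃⟩ := exists_abs_jacUnit_le hα hβ
  set s := max α β with hs
  set T : ℝ := 2 ^ |s| with hT
  have hT1 : 1 ≤ T := Real.one_le_rpow one_le_two (abs_nonneg s)
  -- One summand per case: 1 for degree 0; 3 because the Sonin bound gives 8M² ≤ (3M)²; 4 because
  -- |up| is at most twice (2 + |β|) K₃ T R and u p² ≤ (2|up|)².
  set L := 1 + 3 * (max K₁ K₂ * T) + 4 * ((2 + |β|) * K₃ * T) with hL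
  refine ⟨L, by positivity, fun m u hu => ?_⟩
  have hm : (0 : ℝ) ≤ m := m.cast_nonneg
  set R := ((m : ℝ) + 1) ^ s with hR
  have hR0 : 0 < R := by positivity
  rcases le_total u (1 / 2) with hu2 | hu2
  · rcases m with _ | m
    · simp only [jacUnit_degree_zero, hR, Nat.cast_zero, zero_add, Real.one_rpow]
      have : 1 ≤ L := by
        rw [hL, add_assoc]
        exact le_add_of_nonneg_right (by positivity)
      nlinarith [hu.2]
    · have hb : (1 : ℝ) ≤ ((m + 1 : ℕ) : ℝ) + 2 := by linarith
      set M := max K₁ K₂ * (T * R) with hM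
      have hMle : ∀ (K e : ℝ), 0 < K → K ≤ max K₁ K₂ → e ≤ s →
          K * (((m + 1 + 1 : ℕ) : ℝ) + 1) ^ e ≤ M := by
        intro K e hK hK' he
        have e1 : ((m + 1 + 1 : ℕ) : ℝ) + 1 = ((m + 1 : ℕ) : ℝ) + 2 := by push_cast; ring
        rw [e1]
        refine mul_le_mul hK' ?_ (by positivity) (by positivity)
        exact (Real.rpow_le_rpow_of_exponent_le hb he).trans (add_two_rpow_le s (m + 1))
      have hm1 : (1 : ℝ) ≤ ((m + 1 : ℕ) : ℝ) := by push_cast; linarith [m.cast_nonneg (α := ℝ)]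
      have hc : 0 ≤ ((m + 1 : ℕ) : ℝ) + 2 + (α - 1) + β := by linarith
      have h := jacUnit_sonin_le (α := α - 1) hβ (m + 1) hc (M := M)
        (by
          rw [jacUnit_zero, abs_mul, abs_pow, abs_neg, abs_one, one_pow, one_mul]
          exact (h₂ _).trans (hMle K₂ β hK₂ (le_max_right _ _) (le_max_right _ _)))
        (fun h => by
          rw [jacUnit_one]
          exact (h₁ h _).trans (hMle K₁ (α - 1) hK₁ (le_max_left _ _)
            ((sub_le_self _ zero_le_one).trans (le_max_left _ _)))) hu
      rw [sub_add_cancel] at h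
      set p := jacUnit α (β + 1) (m + 1) u
      -- The worst case is degree 1, where the quotient is (2+α+β)/2 and α+β > -3/2.
      have hr : 1 / 4 ≤ (((m + 1 : ℕ) : ℝ) + 2 + (α - 1) + β) / (((m + 1 : ℕ) : ℝ) + 1) := by
        rw [le_div_iff₀ (by positivity)]
        linarith
      have h5 : u * (1 / 2) * (1 / 4) * p ^ 2 ≤ u * (1 - u) *
          ((((m + 1 : ℕ) : ℝ) + 2 + (α - 1) + β) / (((m + 1 : ℕ) : ℝ) + 1)) * p ^ 2 := by
        refine mul_le_mul_of_nonneg_right (mul_le_mul ?_ hr (by norm_num) ?_) (sq_nonneg _)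
        · exact mul_le_mul_of_nonneg_left (by linarith) hu.1
        · exact mul_nonneg hu.1 (by linarith [hu.2])
      have h6 : u * p ^ 2 ≤ 8 * M ^ 2 := by
        nlinarith [sq_nonneg (jacUnit (α - 1) β (m + 1 + 1) u)]
      refine h6.trans ?_
      have h7 : 3 * M ≤ L * R := by
        rw [hL, hM]
        have : 0 ≤ (1 + 4 * ((2 + |β|) * K₃ * T)) * R := by positivity
        linarith
      have hM0 : 0 ≤ M := by positivity
      nlinarith
  · have hi := jacUnit_contiguous α β m u
    set p := jacUnit α (β + 1) m u
    have b1 := h₃ m u hu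
    have b2 : |jacUnit α β (m + 1) u| ≤ K₃ * (T * R) := by
      refine (h₃ (m + 1) u hu).trans (mul_le_mul_of_nonneg_left ?_ hK₃.le)
      have e1 : ((m + 1 : ℕ) : ℝ) + 1 = (m : ℝ) + 2 := by push_cast; ring
      rw [e1]
      exact add_two_rpow_le s m
    have b1' : |jacUnit α β m u| ≤ K₃ * (T * R) :=
      b1.trans (mul_le_mul_of_nonneg_left (le_mul_of_one_le_left hR0.le hT1) hK₃.le)
    have h5 : (m + 1) / 2 * |u * p| ≤ (m + 1) * ((2 + |β|) * (K₃ * (T * R))) := by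
      calc (m + 1) / 2 * |u * p| ≤ (2 * m + α + β + 2) * |u * p| :=
            mul_le_mul_of_nonneg_right (by linarith) (abs_nonneg _)
        _ = |(m + β + 1) * jacUnit α β m u + (m + 1) * jacUnit α β (m + 1) u| := by
            rw [← hi, abs_mul (2 * m + α + β + 2), abs_of_pos (by linarith : 0 < 2 * m + α + β + 2)]
        _ ≤ |m + β + 1| * |jacUnit α β m u| + (m + 1) * |jacUnit α β (m + 1) u| := by
            refine (abs_add_le _ _).trans_eq ?_
            rw [abs_mul, abs_mul, abs_of_pos (by positivity : 0 < (m : ℝ) + 1)]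
        _ ≤ ((m + 1) * (1 + |β|)) * (K₃ * (T * R)) + (m + 1) * (K₃ * (T * R)) := by
            refine add_le_add (mul_le_mul ?_ b1' (abs_nonneg _) (by positivity))
              (mul_le_mul_of_nonneg_left b2 (by positivity))
            have : |(m : ℝ) + β + 1| ≤ m + 1 + |β| := by
              rw [add_right_comm]
              refine (abs_add_le _ _).trans_eq ?_
              rw [abs_of_pos (by positivity : 0 < (m : ℝ) + 1)]
            nlinarith [abs_nonneg β]
        _ = _ := by ring
    have h6 : |u * p| ≤ 2 * ((2 + |β|) * (K₃ * (T * R))) := by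
      have : 0 < (m : ℝ) + 1 := by positivity
      nlinarith
    have h7 : 2 * |u * p| ≤ L * R := by
      have : 0 ≤ (1 + 3 * (max K₁ K₂ * T)) * R := by positivity
      rw [hL]
      linarith
    have h8 : u * p ^ 2 ≤ 2 * |u * p| ^ 2 := by
      rw [sq_abs, mul_pow]
      nlinarith [mul_nonneg (mul_nonneg hu.1 (by linarith : 0 ≤ 2 * u - 1)) (sq_nonneg p)]
    nlinarith [abs_nonneg (u * p)]


/-- Count powers of m+1 in the Gamma quotient: (λ+μ) - (λ-1/2) - (μ-1/2) = 1, and the square root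
halves it; the factorials cancel. -/
lemma exists_evenCoeff_le (hlam : -(1 / 2) < lam) (hmu : 0 ≤ mu) :
    ∃ K : ℝ, 0 < K ∧ ∀ m : ℕ, evenCoeff lam mu m ≤ K * ((m : ℝ) + 1) ^ (1 / 2 : ℝ) := by
  obtain ⟨K, hK, h⟩ := exists_Gamma_le (c := lam + mu + 1) (by linarith)
  obtain ⟨k₁, hk₁, h₁⟩ := exists_le_Gamma (c := lam + 1 / 2) (by linarith)
  obtain ⟨k₂, hk₂, h₂⟩ := exists_le_Gamma (c := mu + 1 / 2) (by linarith)
  refine ⟨Real.sqrt (3 * K * k₁ * k₂), by positivity, fun m => ?_⟩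
  have hm : (0 : ℝ) ≤ m := m.cast_nonneg
  have hf : (0 : ℝ) < m.factorial := by positivity
  have g1 : 0 < Real.Gamma (m + lam + 1 / 2) := Real.Gamma_pos_of_pos (by linarith)
  have g2 : 0 < Real.Gamma (m + mu + 1 / 2) := Real.Gamma_pos_of_pos (by linarith)
  have g3 : 0 < Real.Gamma (m + lam + mu + 1) := Real.Gamma_pos_of_pos (by linarith)
  have h := h m
  have h₁ := h₁ m
  have h₂ := h₂ m
  rw [← add_assoc, ← add_assoc] at h
  rw [← add_assoc] at h₁ h₂
  -- Merges both clauses of the definition. The factor 3 works since 2m+λ+μ ≤ 3(m+λ+μ) when m ≥ 1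
  -- and λ+μ > -1/2.
  have hnum : (if m = 0 then Real.Gamma (lam + mu + 1)
      else (2 * m + lam + mu) * Real.Gamma (m + 1) * Real.Gamma (m + lam + mu)) ≤
      3 * m.factorial * Real.Gamma (m + lam + mu + 1) := by
    split_ifs with h0
    · subst h0
      simp only [Nat.cast_zero, zero_add, Nat.factorial_zero, Nat.cast_one] at g3 ⊢
      linarith
    · have hm1 : (1 : ℝ) ≤ m := by exact_mod_cast Nat.one_le_iff_ne_zero.2 h0
      have g4 : 0 < Real.Gamma (m + lam + mu) := Real.Gamma_pos_of_pos (by linarith)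
      rw [Real.Gamma_nat_eq_factorial, Real.Gamma_add_one (by linarith : (m : ℝ) + lam + mu ≠ 0)]
      have : 0 < m.factorial * Real.Gamma (m + lam + mu) := by positivity
      nlinarith
  rw [evenCoeff, ← Real.sqrt_eq_rpow, ← Real.sqrt_mul (by positivity)]
  apply Real.sqrt_le_sqrt
  rw [div_le_iff₀ (by positivity)]
  refine hnum.trans ?_
  set r := (m : ℝ) + 1 with hr
  have hr0 : 0 < r := by positivity
  have hr' : r ^ (lam + mu + 1 - 1) = r * (r ^ (lam + 1 / 2 - 1) * r ^ (mu + 1 / 2 - 1)) := by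
    rw [← Real.rpow_add hr0, mul_comm, ← Real.rpow_add_one hr0.ne']
    congr 1; ring
  calc 3 * m.factorial * Real.Gamma (m + lam + mu + 1)
      ≤ 3 * m.factorial * (K * (r ^ (lam + mu + 1 - 1) * m.factorial)) :=
        mul_le_mul_of_nonneg_left h (by positivity)
    _ = 3 * K * r * ((r ^ (lam + 1 / 2 - 1) * m.factorial) *
          (r ^ (mu + 1 / 2 - 1) * m.factorial)) := by rw [hr']; ring
    _ ≤ 3 * K * r * ((k₁ * Real.Gamma (m + lam + 1 / 2)) *
          (k₂ * Real.Gamma (m + mu + 1 / 2))) :=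
        mul_le_mul_of_nonneg_left (mul_le_mul h₁ h₂ (by positivity) (by positivity))
          (by positivity)
    _ = _ := by ring

lemma exists_oddCoeff_le (hlam : -(1 / 2) < lam) (hmu : 0 ≤ mu) :
    ∃ K : ℝ, 0 < K ∧ ∀ m : ℕ, oddCoeff lam mu m ≤ K * ((m : ℝ) + 1) ^ (1 / 2 : ℝ) := by
  obtain ⟨K, hK, h⟩ := exists_Gamma_le (c := lam + mu + 1) (by linarith)
  obtain ⟨k₁, hk₁, h₁⟩ := exists_le_Gamma (c := lam + 1 / 2) (by linarith)
  obtain ⟨k₂, hk₂, h₂⟩ := exists_le_Gamma (c := mu + 3 / 2) (by linarith)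
  set D := 2 + |lam + mu| with hD
  refine ⟨Real.sqrt (D * K * k₁ * k₂), by positivity, fun m => ?_⟩
  have hm : (0 : ℝ) ≤ m := m.cast_nonneg
  have hf : (0 : ℝ) < m.factorial := by positivity
  have g1 : 0 < Real.Gamma (m + lam + 1 / 2) := Real.Gamma_pos_of_pos (by linarith)
  have g2 : 0 < Real.Gamma (m + mu + 3 / 2) := Real.Gamma_pos_of_pos (by linarith)
  have g3 : 0 < Real.Gamma (m + lam + mu + 1) := Real.Gamma_pos_of_pos (by linarith)
  have h := h m
  have h₁ := h₁ m
  have h₂ := h₂ m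
  rw [← add_assoc, ← add_assoc] at h
  rw [← add_assoc] at h₁ h₂
  rw [oddCoeff, ← Real.sqrt_eq_rpow, ← Real.sqrt_mul (by positivity)]
  apply Real.sqrt_le_sqrt
  rw [div_le_iff₀ (by positivity), Real.Gamma_nat_eq_factorial]
  set r := (m : ℝ) + 1 with hr
  have hr0 : 0 < r := by positivity
  have hr' : r * r ^ (lam + mu + 1 - 1) = r * (r ^ (lam + 1 / 2 - 1) * r ^ (mu + 3 / 2 - 1)) := by
    rw [← Real.rpow_add hr0]
    congr 2; ring
  have hl : 2 * (m : ℝ) + lam + mu + 1 ≤ D * r := by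
    rw [hD, hr]
    nlinarith [le_abs_self (lam + mu), mul_nonneg (abs_nonneg (lam + mu)) hm]
  calc (2 * m + lam + mu + 1) * m.factorial * Real.Gamma (m + lam + mu + 1)
      ≤ (D * r) * m.factorial * (K * (r ^ (lam + mu + 1 - 1) * m.factorial)) := by gcongr
    _ = D * K * (r * r ^ (lam + mu + 1 - 1)) * m.factorial * m.factorial := by ring
    _ = D * K * r * ((r ^ (lam + 1 / 2 - 1) * m.factorial) *
          (r ^ (mu + 3 / 2 - 1) * m.factorial)) := by rw [hr']; ring
    _ ≤ D * K * r * ((k₁ * Real.Gamma (m + lam + 1 / 2)) *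
          (k₂ * Real.Gamma (m + mu + 3 / 2))) :=
        mul_le_mul_of_nonneg_left (mul_le_mul h₁ h₂ (by positivity) (by positivity))
          (by positivity)
    _ = _ := by ring

/-- The uniform bound `|C̃_n(t)| ≤ K (n + 1)^σ` on `[-1, 1]`. -/
lemma exists_abs_orthoGegenbauer_le (hlam : -(1 / 2) < lam) (hmu : 0 ≤ mu) :
    ∃ K : ℝ, 0 < K ∧ ∀ (n : ℕ), ∀ t ∈ Set.Icc (-1 : ℝ) 1,
      |orthoGegenbauer lam mu n t| ≤ K * ((n : ℝ) + 1) ^ max lam mu := by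
  obtain ⟨K₁, hK₁, h₁⟩ := exists_evenCoeff_le hlam hmu
  obtain ⟨K₂, hK₂, h₂⟩ := exists_oddCoeff_le hlam hmu
  obtain ⟨K₃, hK₃, h₃⟩ := exists_abs_jacUnit_le (α := lam - 1 / 2) (β := mu - 1 / 2)
    (by linarith) (by linarith)
  obtain ⟨K₄, hK₄, h₄⟩ := exists_mul_jacUnit_sq_le (α := lam - 1 / 2) (β := mu - 1 / 2)
    (by linarith) (by linarith)
  rw [show mu - 1 / 2 + 1 = mu + 1 / 2 by ring] at h₄
  have hσ : 0 ≤ max lam mu := hmu.trans (le_max_right _ _)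
  -- The half power of the normalizing factor exactly makes up for the shift by 1/2 in the Jacobi
  -- parameters.
  have hpow : ∀ m : ℕ, ((m : ℝ) + 1) ^ (1 / 2 : ℝ) *
      ((m : ℝ) + 1) ^ max (lam - 1 / 2) (mu - 1 / 2) = ((m : ℝ) + 1) ^ max lam mu := by
    intro m
    rw [← Real.rpow_add (by positivity), max_sub_sub_right]
    congr 1; ring
  have hmono : ∀ m n : ℕ, m ≤ n → ((m : ℝ) + 1) ^ max lam mu ≤ ((n : ℝ) + 1) ^ max lam mu := by
    intro m n h
    exact Real.rpow_le_rpow (by positivity) (by gcongr) hσ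
  refine ⟨K₁ * K₃ + K₂ * K₄, by positivity, fun n t ht => ?_⟩
  have ht2 : t ^ 2 ∈ Set.Icc (0 : ℝ) 1 := ⟨sq_nonneg t, by nlinarith [ht.1, ht.2]⟩
  rcases n.even_or_odd' with ⟨m, rfl | rfl⟩
  · rw [orthoGegenbauer_two_mul, abs_mul,
      abs_of_nonneg (show 0 ≤ evenCoeff lam mu m from Real.sqrt_nonneg _)]
    calc evenCoeff lam mu m * |jacUnit (lam - 1 / 2) (mu - 1 / 2) m (t ^ 2)|
        ≤ (K₁ * ((m : ℝ) + 1) ^ (1 / 2 : ℝ)) *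
          (K₃ * ((m : ℝ) + 1) ^ max (lam - 1 / 2) (mu - 1 / 2)) :=
          mul_le_mul (h₁ m) (h₃ m _ ht2) (abs_nonneg _) (by positivity)
      _ = K₁ * K₃ * ((m : ℝ) + 1) ^ max lam mu := by rw [← hpow]; ring
      _ ≤ (K₁ * K₃ + K₂ * K₄) * (((2 * m : ℕ) : ℝ) + 1) ^ max lam mu := by
          refine mul_le_mul ?_ (hmono _ _ (by omega)) (by positivity) (by positivity)
          exact le_add_of_nonneg_right (by positivity)
  · have h5 : |t * jacUnit (lam - 1 / 2) (mu + 1 / 2) m (t ^ 2)| ≤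
        K₄ * ((m : ℝ) + 1) ^ max (lam - 1 / 2) (mu - 1 / 2) := by
      refine abs_le_of_sq_le_sq ?_ (by positivity)
      rw [mul_pow]
      exact h₄ m _ ht2
    rw [orthoGegenbauer_two_mul_add_one, abs_mul,
      abs_of_nonneg (show 0 ≤ oddCoeff lam mu m from Real.sqrt_nonneg _)]
    calc oddCoeff lam mu m * |t * jacUnit (lam - 1 / 2) (mu + 1 / 2) m (t ^ 2)|
        ≤ (K₂ * ((m : ℝ) + 1) ^ (1 / 2 : ℝ)) *
          (K₄ * ((m : ℝ) + 1) ^ max (lam - 1 / 2) (mu - 1 / 2)) :=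
          mul_le_mul (h₂ m) h5 (abs_nonneg _) (by positivity)
      _ = K₂ * K₄ * ((m : ℝ) + 1) ^ max lam mu := by rw [← hpow]; ring
      _ ≤ (K₁ * K₃ + K₂ * K₄) * (((2 * m + 1 : ℕ) : ℝ) + 1) ^ max lam mu := by
          refine mul_le_mul ?_ (hmono _ _ (by omega)) (by positivity) (by positivity)
          exact le_add_of_nonneg_left (by positivity)

/-! ### Fourier coefficients: the L₁ bound and Bessel's inequality -/

lemma ae_norm_orthoGegenbauer_le {K : ℝ}
    (hK : ∀ (n : ℕ), ∀ t ∈ Set.Icc (-1 : ℝ) 1,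
      |orthoGegenbauer lam mu n t| ≤ K * ((n : ℝ) + 1) ^ max lam mu) (n : ℕ) :
    ∀ᵐ t ∂(weightMeasure lam mu),
      ‖(orthoGegenbauer lam mu n t : ℂ)‖ ≤ K * ((n : ℝ) + 1) ^ max lam mu := by
  filter_upwards [ae_weightMeasure_mem_Icc lam mu] with t ht
  rw [Complex.norm_real, Real.norm_eq_abs]
  exact hK n t ht

lemma continuous_ofReal_orthoGegenbauer (lam mu : ℝ) (n : ℕ) :
    Continuous fun t => (orthoGegenbauer lam mu n t : ℂ) :=
  Complex.continuous_ofReal.comp (continuous_orthoGegenbauer lam mu n)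

lemma memLp_orthoGegenbauer (hlam : -(1 / 2) < lam) (hmu : 0 ≤ mu) (n : ℕ) (p : ENNReal) :
    MemLp (fun t => (orthoGegenbauer lam mu n t : ℂ)) p (weightMeasure lam mu) := by
  have := isFiniteMeasure_weightMeasure hlam hmu
  obtain ⟨K, -, hK⟩ := exists_abs_orthoGegenbauer_le hlam hmu
  exact MemLp.of_bound (continuous_ofReal_orthoGegenbauer lam mu n).aestronglyMeasurable _
    (ae_norm_orthoGegenbauer_le hK n)

lemma integrable_mul_orthoGegenbauer (hlam : -(1 / 2) < lam) (hmu : 0 ≤ mu) {f : ℝ → ℂ}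
    (hf : Integrable f (weightMeasure lam mu)) (n : ℕ) :
    Integrable (fun t => f t * (orthoGegenbauer lam mu n t : ℂ)) (weightMeasure lam mu) := by
  obtain ⟨K, -, hK⟩ := exists_abs_orthoGegenbauer_le hlam hmu
  exact hf.mul_bdd (continuous_ofReal_orthoGegenbauer lam mu n).aestronglyMeasurable
    (ae_norm_orthoGegenbauer_le hK n)

/-- The L₁ endpoint for both interpolations. -/
lemma norm_fourierCoeff_le {K : ℝ}
    (hK : ∀ (n : ℕ), ∀ t ∈ Set.Icc (-1 : ℝ) 1,
      |orthoGegenbauer lam mu n t| ≤ K * ((n : ℝ) + 1) ^ max lam mu) {f : ℝ → ℂ}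
    (hf : Integrable f (weightMeasure lam mu)) (n : ℕ) :
    ‖fourierCoeff lam mu f n‖ ≤
      K * ((n : ℝ) + 1) ^ max lam mu * ∫ t, ‖f t‖ ∂(weightMeasure lam mu) := by
  rw [fourierCoeff, ← integral_const_mul]
  refine norm_integral_le_of_norm_le (hf.norm.const_mul _) ?_
  filter_upwards [ae_norm_orthoGegenbauer_le hK n] with t ht
  rw [norm_mul, mul_comm]
  exact mul_le_mul_of_nonneg_right ht (norm_nonneg _)

lemma fourierCoeff_add (hlam : -(1 / 2) < lam) (hmu : 0 ≤ mu) {f g : ℝ → ℂ}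
    (hf : Integrable f (weightMeasure lam mu)) (hg : Integrable g (weightMeasure lam mu)) (n : ℕ) :
    fourierCoeff lam mu (fun t => f t + g t) n =
      fourierCoeff lam mu f n + fourierCoeff lam mu g n := by
  simp only [fourierCoeff, add_mul]
  exact integral_add (integrable_mul_orthoGegenbauer hlam hmu hf n)
    (integrable_mul_orthoGegenbauer hlam hmu hg n)

lemma fourierCoeff_congr_ae {f g : ℝ → ℂ} (h : f =ᵐ[weightMeasure lam mu] g) (n : ℕ) :
    fourierCoeff lam mu f n = fourierCoeff lam mu g n :=
  integral_congr_ae (by filter_upwards [h] with t ht; rw [ht])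

lemma orthonormal_toLp_orthoGegenbauer (hlam : -(1 / 2) < lam) (hmu : 0 ≤ mu) :
    Orthonormal ℂ fun n => (memLp_orthoGegenbauer hlam hmu n 2).toLp := by
  rw [orthonormal_iff_ite]
  intro m n
  rw [L2.inner_def]
  have : ∀ᵐ t ∂(weightMeasure lam mu),
      inner ℂ ((memLp_orthoGegenbauer hlam hmu m 2).toLp _ t)
        ((memLp_orthoGegenbauer hlam hmu n 2).toLp _ t) =
      ((orthoGegenbauer lam mu m t * orthoGegenbauer lam mu n t : ℝ) : ℂ) := by
    filter_upwards [(memLp_orthoGegenbauer hlam hmu m 2).coeFn_toLp,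
      (memLp_orthoGegenbauer hlam hmu n 2).coeFn_toLp] with t h1 h2
    rw [h1, h2]
    simp [mul_comm]
  rw [integral_congr_ae this, integral_complex_ofReal, integral_orthoGegenbauer_mul hlam hmu]
  split_ifs <;> simp

/-- Bessel's inequality. -/
lemma tsum_norm_fourierCoeff_sq_le (hlam : -(1 / 2) < lam) (hmu : 0 ≤ mu) {f : ℝ → ℂ}
    (hf : MemLp f 2 (weightMeasure lam mu)) :
    ∑' n, ENNReal.ofReal (‖fourierCoeff lam mu f n‖ ^ 2) ≤
      ∫⁻ t, ENNReal.ofReal (‖f t‖ ^ 2) ∂(weightMeasure lam mu) := by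
  have ho := orthonormal_toLp_orthoGegenbauer hlam hmu
  have hc : ∀ n, inner ℂ (memLp_orthoGegenbauer hlam hmu n 2).toLp hf.toLp =
      fourierCoeff lam mu f n := by
    intro n
    rw [L2.inner_def, fourierCoeff]
    refine integral_congr_ae ?_
    filter_upwards [(memLp_orthoGegenbauer hlam hmu n 2).coeFn_toLp, hf.coeFn_toLp] with t h1 h2
    rw [h1, h2]
    simp
  have h1 := ho.tsum_inner_products_le hf.toLp
  have h2 := ho.inner_products_summable hf.toLp
  simp only [hc] at h1 h2
  rw [← ENNReal.ofReal_tsum_of_nonneg (fun _ => by positivity) h2]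
  refine (ENNReal.ofReal_le_ofReal h1).trans_eq ?_
  rw [Lp.norm_toLp, ENNReal.ofReal_pow ENNReal.toReal_nonneg, ENNReal.ofReal_toReal hf.2.ne,
    ← ENNReal.rpow_natCast,
    eLpNorm_eq_lintegral_rpow_enorm_toReal two_ne_zero ENNReal.ofNat_ne_top, ← ENNReal.rpow_mul]
  simp [ENNReal.ofReal_pow, ofReal_norm]

/-! ### Integrals over the truncation height -/

section PowerIntegrals

lemma lintegral_Ioc_rpow {r b : ℝ} (hr : -1 < r) (hb : 0 ≤ b) :
    ∫⁻ y in Set.Ioc 0 b, ENNReal.ofReal (y ^ r) = ENNReal.ofReal (b ^ (r + 1) / (r + 1)) := by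
  have hi : IntegrableOn (fun y : ℝ => y ^ r) (Set.Ioc 0 b) :=
    (intervalIntegrable_iff_integrableOn_Ioc_of_le hb).1 (intervalIntegral.intervalIntegrable_rpow' hr)
  rw [← ofReal_integral_eq_lintegral_ofReal hi, ← intervalIntegral.integral_of_le hb,
    integral_rpow (Or.inl hr), Real.zero_rpow (by linarith), sub_zero]
  exact (ae_restrict_mem measurableSet_Ioc).mono fun y hy => Real.rpow_nonneg hy.1.le _

lemma lintegral_Ioi_rpow {r b : ℝ} (hr : r < -1) (hb : 0 < b) :
    ∫⁻ y in Set.Ioi b, ENNReal.ofReal (y ^ r) = ENNReal.ofReal (-b ^ (r + 1) / (r + 1)) := by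
  rw [← ofReal_integral_eq_lintegral_ofReal (integrableOn_Ioi_rpow_of_lt hr hb),
    integral_Ioi_rpow_of_lt hr hb]
  exact (ae_restrict_mem measurableSet_Ioi).mono fun y hy =>
    Real.rpow_nonneg (hb.trans hy).le _

variable {X : Type*} [MeasurableSpace X] {κ : Measure X} [SFinite κ] {F : X → ℝ}

/-- By Tonelli the inner integral is F · ∫_0^F y^(p-2) dy = F^p/(p-1), convergent at 0 because p >
1. -/
lemma lintegral_rpow_mul_lintegral_high (hF : Measurable F) (hF0 : ∀ x, 0 ≤ F x) {p : ℝ}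
    (hp : 1 < p) :
    ∫⁻ y in Set.Ioi (0 : ℝ), (∫⁻ x, (if y < F x then ENNReal.ofReal (F x) else 0) ∂κ) *
        ENNReal.ofReal (y ^ (p - 2)) ≤
      ENNReal.ofReal (1 / (p - 1)) * ∫⁻ x, ENNReal.ofReal (F x ^ p) ∂κ := by
  have hm : Measurable fun z : ℝ × X =>
      (if z.1 < F z.2 then ENNReal.ofReal (F z.2) else 0) * ENNReal.ofReal (z.1 ^ (p - 2)) := by
    refine Measurable.mul (Measurable.ite ?_ (hF.comp measurable_snd).ennreal_ofReal
      measurable_const) (by fun_prop)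
    exact measurableSet_lt measurable_fst (hF.comp measurable_snd)
  have h1 : ∀ y : ℝ, (∫⁻ x, (if y < F x then ENNReal.ofReal (F x) else 0) ∂κ) *
        ENNReal.ofReal (y ^ (p - 2)) =
      ∫⁻ x, (if y < F x then ENNReal.ofReal (F x) else 0) * ENNReal.ofReal (y ^ (p - 2)) ∂κ := by
    intro y
    rw [lintegral_mul_const' _ _ ENNReal.ofReal_ne_top]
  simp only [h1]
  rw [lintegral_lintegral_swap hm.aemeasurable,
    ← lintegral_const_mul' _ _ ENNReal.ofReal_ne_top]
  refine lintegral_mono fun x => ?_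
  calc ∫⁻ y in Set.Ioi (0 : ℝ), (if y < F x then ENNReal.ofReal (F x) else 0) *
        ENNReal.ofReal (y ^ (p - 2))
      ≤ ∫⁻ y in Set.Ioi (0 : ℝ), (Set.Ioc 0 (F x)).indicator
          (fun y => ENNReal.ofReal (F x) * ENNReal.ofReal (y ^ (p - 2))) y := by
        refine setLIntegral_mono' measurableSet_Ioi fun y hy => ?_
        split_ifs with h
        · rw [Set.indicator_of_mem (show y ∈ Set.Ioc 0 (F x) from ⟨hy, h.le⟩)]
        · simp
    _ ≤ ∫⁻ y in Set.Ioc 0 (F x), ENNReal.ofReal (F x) * ENNReal.ofReal (y ^ (p - 2)) := by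
        refine (setLIntegral_le_lintegral _ _).trans_eq ?_
        rw [lintegral_indicator measurableSet_Ioc]
    _ = ENNReal.ofReal (1 / (p - 1)) * ENNReal.ofReal (F x ^ p) := by
        rw [lintegral_const_mul' _ _ ENNReal.ofReal_ne_top,
          lintegral_Ioc_rpow (by linarith) (hF0 x), ← ENNReal.ofReal_mul (hF0 x),
          ← ENNReal.ofReal_mul (by rw [one_div]; exact inv_nonneg.2 (by linarith))]
        congr 1
        rw [show p - 2 + 1 = p - 1 by ring]
        rcases (hF0 x).eq_or_lt with h | h
        · rw [← h, Real.zero_rpow (by linarith : p ≠ 0)]; simp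
        · rw [Real.rpow_sub_one h.ne']
          field_simp

/-- By Tonelli the inner integral is F² · ∫_F^∞ y^(p-3) dy = F^p/(2-p), convergent at infinity
because p < 2. -/
lemma lintegral_rpow_mul_lintegral_low (hF : Measurable F) (hF0 : ∀ x, 0 ≤ F x) {p : ℝ}
    (hp : p < 2) :
    ∫⁻ y in Set.Ioi (0 : ℝ), (∫⁻ x, (if F x ≤ y then ENNReal.ofReal (F x ^ 2) else 0) ∂κ) *
        ENNReal.ofReal (y ^ (p - 3)) ≤
      ENNReal.ofReal (1 / (2 - p)) * ∫⁻ x, ENNReal.ofReal (F x ^ p) ∂κ := by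
  have hm : Measurable fun z : ℝ × X =>
      (if F z.2 ≤ z.1 then ENNReal.ofReal (F z.2 ^ 2) else 0) * ENNReal.ofReal (z.1 ^ (p - 3)) := by
    refine Measurable.mul (Measurable.ite ?_ ((hF.comp measurable_snd).pow_const 2).ennreal_ofReal
      measurable_const) (by fun_prop)
    exact measurableSet_le (hF.comp measurable_snd) measurable_fst
  have h1 : ∀ y : ℝ, (∫⁻ x, (if F x ≤ y then ENNReal.ofReal (F x ^ 2) else 0) ∂κ) *
        ENNReal.ofReal (y ^ (p - 3)) =
      ∫⁻ x, (if F x ≤ y then ENNReal.ofReal (F x ^ 2) else 0) *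
        ENNReal.ofReal (y ^ (p - 3)) ∂κ := by
    intro y
    rw [lintegral_mul_const' _ _ ENNReal.ofReal_ne_top]
  simp only [h1]
  rw [lintegral_lintegral_swap hm.aemeasurable,
    ← lintegral_const_mul' _ _ ENNReal.ofReal_ne_top]
  refine lintegral_mono fun x => ?_
  rcases (hF0 x).eq_or_lt with h0 | h0
  · simp [← h0]
  calc ∫⁻ y in Set.Ioi (0 : ℝ), (if F x ≤ y then ENNReal.ofReal (F x ^ 2) else 0) *
        ENNReal.ofReal (y ^ (p - 3))
      ≤ ∫⁻ y in Set.Ioi (0 : ℝ), (Set.Ici (F x)).indicator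
          (fun y => ENNReal.ofReal (F x ^ 2) * ENNReal.ofReal (y ^ (p - 3))) y := by
        refine lintegral_mono fun y => ?_
        by_cases h : F x ≤ y
        · rw [if_pos h, Set.indicator_of_mem (show y ∈ Set.Ici (F x) from h)]
        · simp [h]
    _ ≤ ∫⁻ y in Set.Ioi (F x), ENNReal.ofReal (F x ^ 2) * ENNReal.ofReal (y ^ (p - 3)) := by
        refine (setLIntegral_le_lintegral _ _).trans_eq ?_
        rw [lintegral_indicator measurableSet_Ici, setLIntegral_congr Ioi_ae_eq_Ici]
    _ = ENNReal.ofReal (1 / (2 - p)) * ENNReal.ofReal (F x ^ p) := by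
        have h2 : 0 < 2 - p := by linarith
        rw [lintegral_const_mul' _ _ ENNReal.ofReal_ne_top,
          lintegral_Ioi_rpow (by linarith) h0, ← ENNReal.ofReal_mul (by positivity),
          ← ENNReal.ofReal_mul (by positivity)]
        congr 1
        rw [show p - 3 + 1 = p - 2 by ring, Real.rpow_sub h0, Real.rpow_two,
          show p - 2 = -(2 - p) by ring, neg_div_neg_eq]
        field_simp

/-- The low part for the Hausdorff–Young cut. For F > 0 the condition on y forces y ≤ D F^(1-p), and
integrating y^(q-3) up to there gives F^(2+(1-p)(q-2)) = F^p; `hpq` is conjugacy of p and q in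
polynomial form. -/
lemma lintegral_rpow_mul_lintegral_of_le (hF : Measurable F) (hF0 : ∀ x, 0 ≤ F x) {p q D : ℝ}
    (hp : 1 < p) (hq : 2 < q) (hpq : (1 - p) * (q - 2) = p - 2) (hD : 0 < D) :
    ∫⁻ y in Set.Ioi (0 : ℝ),
      (∫⁻ x, (if F x ≤ (y / D) ^ (-(1 / (p - 1))) then ENNReal.ofReal (F x ^ 2) else 0) ∂κ) *
        ENNReal.ofReal (y ^ (q - 3)) ≤
      ENNReal.ofReal (D ^ (q - 2) / (q - 2)) * ∫⁻ x, ENNReal.ofReal (F x ^ p) ∂κ := by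
  have hp1 : 0 < p - 1 := by linarith
  have hq2 : 0 < q - 2 := by linarith
  have hm : Measurable fun z : ℝ × X =>
      (if F z.2 ≤ (z.1 / D) ^ (-(1 / (p - 1))) then ENNReal.ofReal (F z.2 ^ 2) else 0) *
        ENNReal.ofReal (z.1 ^ (q - 3)) := by
    refine Measurable.mul (Measurable.ite ?_ ((hF.comp measurable_snd).pow_const 2).ennreal_ofReal
      measurable_const) (by fun_prop)
    exact measurableSet_le (hF.comp measurable_snd) (by fun_prop)
  have h1 : ∀ y : ℝ, (∫⁻ x, (if F x ≤ (y / D) ^ (-(1 / (p - 1))) then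
        ENNReal.ofReal (F x ^ 2) else 0) ∂κ) * ENNReal.ofReal (y ^ (q - 3)) =
      ∫⁻ x, (if F x ≤ (y / D) ^ (-(1 / (p - 1))) then ENNReal.ofReal (F x ^ 2) else 0) *
        ENNReal.ofReal (y ^ (q - 3)) ∂κ := by
    intro y
    rw [lintegral_mul_const' _ _ ENNReal.ofReal_ne_top]
  simp only [h1]
  rw [lintegral_lintegral_swap hm.aemeasurable,
    ← lintegral_const_mul' _ _ ENNReal.ofReal_ne_top]
  refine lintegral_mono fun x => ?_
  rcases (hF0 x).eq_or_lt with h0 | h0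
  · simp [← h0]
  set b := D * F x ^ (1 - p) with hb
  have hb0 : 0 < b := by positivity
  calc ∫⁻ y in Set.Ioi (0 : ℝ), (if F x ≤ (y / D) ^ (-(1 / (p - 1))) then
        ENNReal.ofReal (F x ^ 2) else 0) * ENNReal.ofReal (y ^ (q - 3))
      ≤ ∫⁻ y in Set.Ioi (0 : ℝ), (Set.Ioc 0 b).indicator
          (fun y => ENNReal.ofReal (F x ^ 2) * ENNReal.ofReal (y ^ (q - 3))) y := by
        refine setLIntegral_mono' measurableSet_Ioi fun y hy => ?_
        have hy : 0 < y := hy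
        split_ifs with h
        · have hyb : y ≤ b := by
            have := Real.rpow_le_rpow_of_nonpos h0 h (by linarith : 1 - p ≤ 0)
            rw [← Real.rpow_mul (by positivity),
              show -(1 / (p - 1)) * (1 - p) = 1 by field_simp; ring, Real.rpow_one,
              div_le_iff₀ hD] at this
            rw [hb]; linarith
          rw [Set.indicator_of_mem (show y ∈ Set.Ioc 0 b from ⟨hy, hyb⟩)]
        · simp
    _ ≤ ∫⁻ y in Set.Ioc 0 b, ENNReal.ofReal (F x ^ 2) * ENNReal.ofReal (y ^ (q - 3)) := by
        refine (setLIntegral_le_lintegral _ _).trans_eq ?_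
        rw [lintegral_indicator measurableSet_Ioc]
    _ = ENNReal.ofReal (D ^ (q - 2) / (q - 2)) * ENNReal.ofReal (F x ^ p) := by
        rw [lintegral_const_mul' _ _ ENNReal.ofReal_ne_top,
          lintegral_Ioc_rpow (by linarith) hb0.le, ← ENNReal.ofReal_mul (by positivity),
          ← ENNReal.ofReal_mul (by positivity)]
        congr 1
        rw [show q - 3 + 1 = q - 2 by ring, hb, Real.mul_rpow hD.le (by positivity),
          ← Real.rpow_mul h0.le, hpq, Real.rpow_sub h0, Real.rpow_two]
        field_simp

end PowerIntegrals

/-! ### Weighted counting measures on ℕ -/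

section WeightedCount

/-- The measure on `ℕ` giving mass `w n` to `n`. -/
def weightedCount (w : ℕ → ENNReal) : Measure ℕ := Measure.sum fun n => w n • Measure.dirac n

lemma lintegral_weightedCount (w g : ℕ → ENNReal) :
    ∫⁻ n, g n ∂(weightedCount w) = ∑' n, w n * g n := by
  simp [weightedCount, lintegral_sum_measure, lintegral_smul_measure]

/-- Makes the tail sums telescope. Bernoulli's inequality, valid for τ ≥ 1, bounds (x+1)^τ - x^τ
from below, and x+1 ≤ 2x costs the factor 2^τ. -/
lemma rpow_tail_step {τ x : ℝ} (hτ : 1 ≤ τ) (hx : 1 ≤ x) :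
    x ^ (-τ - 1) ≤ 2 ^ τ * (x ^ (-τ) - (x + 1) ^ (-τ)) := by
  have hx0 : 0 < x := by linarith
  have hb := one_add_mul_self_le_rpow_one_add (s := 1 / x) (by
    have : 0 < 1 / x := by positivity
    linarith) hτ
  have e : (x + 1) ^ τ = x ^ τ * (1 + 1 / x) ^ τ := by
    rw [← Real.mul_rpow hx0.le (by positivity)]; congr 1; field_simp
  have h2 : (x + 1) ^ τ ≤ 2 ^ τ * x ^ τ := by
    rw [← Real.mul_rpow two_pos.le hx0.le]
    exact Real.rpow_le_rpow (by positivity) (by linarith) (by linarith)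
  have hxt : 0 < x ^ τ := by positivity
  have hxt' : 0 < (x + 1) ^ τ := by positivity
  have h3 : x ^ τ * (1 / x) ≤ (x + 1) ^ τ - x ^ τ := by
    have : x ^ τ * (1 + 1 / x) ≤ (x + 1) ^ τ := by
      rw [e]
      refine mul_le_mul_of_nonneg_left (le_trans ?_ hb) hxt.le
      have : 0 < 1 / x := by positivity
      nlinarith
    linarith
  rw [Real.rpow_sub_one hx0.ne', Real.rpow_neg hx0.le, Real.rpow_neg (by positivity)]
  have h4 : 2 ^ τ * ((x ^ τ)⁻¹ - ((x + 1) ^ τ)⁻¹) =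
      2 ^ τ * ((x + 1) ^ τ - x ^ τ) / (x ^ τ * (x + 1) ^ τ) := by field_simp
  rw [h4, le_div_iff₀ (by positivity)]
  calc (x ^ τ)⁻¹ / x * (x ^ τ * (x + 1) ^ τ) = (x + 1) ^ τ * (1 / x) := by field_simp
    _ ≤ 2 ^ τ * x ^ τ * (1 / x) := mul_le_mul_of_nonneg_right h2 (by positivity)
    _ = 2 ^ τ * (x ^ τ * (1 / x)) := by ring
    _ ≤ _ := mul_le_mul_of_nonneg_left h3 (by positivity)

lemma sum_range_rpow_le {τ : ℝ} (hτ : 1 ≤ τ) (n₀ M : ℕ) :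
    ∑ k ∈ Finset.range M, ((k + n₀ : ℕ) + 1 : ℝ) ^ (-τ - 1) ≤ 2 ^ τ * ((n₀ : ℝ) + 1) ^ (-τ) := by
  have h : ∑ k ∈ Finset.range M, ((k + n₀ : ℕ) + 1 : ℝ) ^ (-τ - 1) ≤
      2 ^ τ * (((n₀ : ℝ) + 1) ^ (-τ) - ((M + n₀ : ℕ) + 1 : ℝ) ^ (-τ)) := by
    induction M with
    | zero => simp
    | succ M ih =>
      rw [Finset.sum_range_succ]
      have := rpow_tail_step hτ (x := ((M + n₀ : ℕ) : ℝ) + 1) (by simp; positivity)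
      have e : ((M + 1 + n₀ : ℕ) : ℝ) = ((M + n₀ : ℕ) : ℝ) + 1 := by push_cast; ring
      rw [e]
      linarith
  refine h.trans (mul_le_mul_of_nonneg_left ?_ (by positivity))
  exact sub_le_self _ (by positivity)

lemma weightedCount_Ici_le (w : ℕ → ENNReal) (n₀ : ℕ) :
    weightedCount w (Set.Ici n₀) ≤ ∑' k, w (k + n₀) := by
  have h1 : weightedCount w (Set.Ici n₀) =
      ∑' n, w n * (Set.Ici n₀).indicator (fun _ => (1 : ENNReal)) n := by
    rw [← lintegral_weightedCount, lintegral_indicator MeasurableSet.of_discrete]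
    simp
  have hz : ∑ i ∈ Finset.range n₀, w i * (Set.Ici n₀).indicator (fun _ => (1 : ENNReal)) i = 0 := by
    refine Finset.sum_eq_zero fun i hi => ?_
    have : i ∉ Set.Ici n₀ := by simpa using hi
    rw [Set.indicator_of_notMem this, mul_zero]
  rw [h1, ← Summable.sum_add_tsum_nat_add' (k := n₀) ENNReal.summable, hz, zero_add]
  refine ENNReal.tsum_le_tsum fun k => ?_
  have : k + n₀ ∈ Set.Ici n₀ := by simp
  rw [Set.indicator_of_mem this, mul_one]

/-- The set lies in the tail starting at its least element n₀, whose mass is at most 2^τ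
(n₀+1)^(-τ). This says that (n+1)^τ is in weak L₁ for these masses. -/
lemma weightedCount_lt_rpow_le {τ z : ℝ} (hτ : 1 ≤ τ) (hz : 0 < z) :
    weightedCount (fun n => ENNReal.ofReal (((n : ℝ) + 1) ^ (-τ - 1)))
      {n : ℕ | z < ((n : ℝ) + 1) ^ τ} ≤ ENNReal.ofReal (2 ^ τ / z) := by
  by_cases hne : ∃ n : ℕ, z < ((n : ℝ) + 1) ^ τ
  swap
  · have : {n : ℕ | z < ((n : ℝ) + 1) ^ τ} = ∅ := by
      ext n
      simpa using fun h => hne ⟨n, h⟩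
    rw [this, measure_empty]
    exact zero_le
  obtain ⟨n₀, h0, hmin⟩ : ∃ n₀ : ℕ, z < ((n₀ : ℝ) + 1) ^ τ ∧
      ∀ i < n₀, ¬ z < ((i : ℝ) + 1) ^ τ := by
    classical
    exact ⟨Nat.find hne, Nat.find_spec hne, fun i hi => Nat.find_min hne hi⟩
  have hsub : {n : ℕ | z < ((n : ℝ) + 1) ^ τ} ⊆ Set.Ici n₀ := by
    intro n hn
    by_contra h
    exact hmin n (not_le.1 h) hn
  refine ((measure_mono hsub).trans (weightedCount_Ici_le _ n₀)).trans ?_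
  refine ENNReal.tsum_le_of_sum_range_le fun M => ?_
  rw [← ENNReal.ofReal_sum_of_nonneg fun _ _ => by positivity]
  refine ENNReal.ofReal_le_ofReal ((sum_range_rpow_le hτ n₀ M).trans ?_)
  rw [Real.rpow_neg (by positivity), div_eq_mul_inv]
  exact mul_le_mul_of_nonneg_left (inv_anti₀ hz h0.le) (by positivity)

end WeightedCount

/-! ### Reduction to measurable functions and distribution estimates -/

/-- Truncation by height needs genuinely measurable level sets, so f is replaced by a measurable
representative. A bound in `ENNReal` contains the convergence of the series. -/
lemma coeffInequality_of_measurable {p s C : ℝ} (hs : 0 < s) (hC : 0 ≤ C)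
    (h : ∀ f : ℝ → ℂ, Measurable f → MemLpW lam mu p f →
      ∑' n : ℕ, ENNReal.ofReal
        ((((n : ℝ) + 1) ^ coeffExponent lam mu p s * ‖fourierCoeff lam mu f n‖) ^ s) ≤
      ENNReal.ofReal ((C * normLpW lam mu p f) ^ s)) :
    CoeffInequality lam mu p s C := by
  intro f hf
  have hg : Measurable (hf.1.mk f) := hf.1.stronglyMeasurable_mk.measurable
  have hfg : f =ᵐ[weightMeasure lam mu] hf.1.mk f := hf.1.ae_eq_mk
  have h := h _ hg ((memLp_congr_ae hfg).1 hf)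
  have hn : normLpW lam mu p (hf.1.mk f) = normLpW lam mu p f :=
    congrArg ENNReal.toReal (eLpNorm_congr_ae hfg).symm
  simp only [hn, ← fourierCoeff_congr_ae hfg] at h
  have h0 : ∀ n : ℕ, 0 ≤
      (((n : ℝ) + 1) ^ coeffExponent lam mu p s * ‖fourierCoeff lam mu f n‖) ^ s :=
    fun n => by positivity
  have hN : 0 ≤ normLpW lam mu p f := ENNReal.toReal_nonneg
  have hsum : Summable fun n : ℕ =>
      (((n : ℝ) + 1) ^ coeffExponent lam mu p s * ‖fourierCoeff lam mu f n‖) ^ s := by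
    have := ENNReal.summable_toReal (h.trans_lt ENNReal.ofReal_lt_top).ne
    simpa only [ENNReal.toReal_ofReal (h0 _)] using this
  refine ⟨hsum, ?_⟩
  rw [← ENNReal.ofReal_tsum_of_nonneg h0 hsum,
    ENNReal.ofReal_le_ofReal_iff (by positivity)] at h
  calc _ ≤ ((C * normLpW lam mu p f) ^ s) ^ (1 / s) :=
        Real.rpow_le_rpow (tsum_nonneg h0) h (by positivity)
    _ = _ := by rw [← Real.rpow_mul (by positivity), mul_one_div_cancel hs.ne', Real.rpow_one]

lemma lintegral_norm_rpow_eq {p : ℝ} (hp : 0 < p) {f : ℝ → ℂ} (hf : MemLpW lam mu p f) :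
    ∫⁻ t, ENNReal.ofReal (‖f t‖ ^ p) ∂(weightMeasure lam mu) =
      ENNReal.ofReal (normLpW lam mu p f ^ p) := by
  have h1 : ENNReal.ofReal p ≠ 0 := by simpa using hp
  rw [normLpW, ← ENNReal.ofReal_rpow_of_nonneg ENNReal.toReal_nonneg hp.le,
    ENNReal.ofReal_toReal hf.2.ne,
    eLpNorm_eq_lintegral_rpow_enorm_toReal h1 ENNReal.ofReal_ne_top, ← ENNReal.rpow_mul,
    ENNReal.toReal_ofReal hp.le, one_div_mul_cancel hp.ne', ENNReal.rpow_one]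
  refine lintegral_congr fun t => ?_
  rw [← ENNReal.ofReal_rpow_of_nonneg (norm_nonneg _) hp.le, ofReal_norm]

lemma integrable_of_memLpW (hlam : -(1 / 2) < lam) (hmu : 0 ≤ mu) {p : ℝ} (hp : 1 ≤ p)
    {f : ℝ → ℂ} (hf : MemLpW lam mu p f) : Integrable f (weightMeasure lam mu) := by
  have := isFiniteMeasure_weightMeasure hlam hmu
  exact MemLp.integrable (by simpa using ENNReal.ofReal_le_ofReal hp) hf

/-- Chebyshev's inequality for the square, then Bessel: since ν w² = 1, the weighted square sum is
the plain square sum of the coefficients. -/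
lemma weightedCount_truncated_le (hlam : -(1 / 2) < lam) (hmu : 0 ≤ mu) {f : ℝ → ℂ}
    (hf : Measurable f) {w : ℕ → ℝ} {ν : ℕ → ENNReal}
    (hν : ∀ n, ν n * ENNReal.ofReal (w n ^ 2) = 1) (a : ℝ) {y : ℝ} (hy : 0 < y) :
    weightedCount ν
      {n | y / 2 < w n * ‖fourierCoeff lam mu (fun t => if ‖f t‖ ≤ a then f t else 0) n‖} ≤
    ENNReal.ofReal (4 / y ^ 2) *
      ∫⁻ t, (if ‖f t‖ ≤ a then ENNReal.ofReal (‖f t‖ ^ 2) else 0) ∂(weightMeasure lam mu) := by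
  have := isFiniteMeasure_weightMeasure hlam hmu
  set g : ℝ → ℂ := fun t => if ‖f t‖ ≤ a then f t else 0 with hg
  have hgm : Measurable g :=
    Measurable.ite (measurableSet_le hf.norm measurable_const) hf measurable_const
  have hg2 : MemLp g 2 (weightMeasure lam mu) := by
    refine MemLp.of_bound hgm.aestronglyMeasurable (max a 0) (Eventually.of_forall fun t => ?_)
    simp only [hg]
    split_ifs with h
    · exact h.trans (le_max_left _ _)
    · simp
  have hint : ∫⁻ t, ENNReal.ofReal (‖g t‖ ^ 2) ∂(weightMeasure lam mu) =
      ∫⁻ t, (if ‖f t‖ ≤ a then ENNReal.ofReal (‖f t‖ ^ 2) else 0) ∂(weightMeasure lam mu) := by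
    refine lintegral_congr fun t => ?_
    simp only [hg]
    split_ifs <;> simp
  have hB := tsum_norm_fourierCoeff_sq_le hlam hmu hg2
  rw [hint] at hB
  have hM := mul_meas_ge_le_lintegral (μ := weightedCount ν)
    (f := fun n => ENNReal.ofReal ((w n * ‖fourierCoeff lam mu g n‖) ^ 2)) Measurable.of_discrete
    (ENNReal.ofReal (y ^ 2 / 4))
  rw [lintegral_weightedCount] at hM
  have hsum : ∑' n, ν n * ENNReal.ofReal ((w n * ‖fourierCoeff lam mu g n‖) ^ 2) =
      ∑' n, ENNReal.ofReal (‖fourierCoeff lam mu g n‖ ^ 2) := by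
    refine tsum_congr fun n => ?_
    rw [mul_pow, ENNReal.ofReal_mul (by positivity), ← mul_assoc, hν, one_mul]
  rw [hsum] at hM
  calc _ ≤ weightedCount ν {n | ENNReal.ofReal (y ^ 2 / 4) ≤
          ENNReal.ofReal ((w n * ‖fourierCoeff lam mu g n‖) ^ 2)} := by
        refine measure_mono fun n hn => ENNReal.ofReal_le_ofReal ?_
        have hn : y / 2 < w n * ‖fourierCoeff lam mu g n‖ := hn
        nlinarith
    _ = ENNReal.ofReal (4 / y ^ 2) * (ENNReal.ofReal (y ^ 2 / 4) *
          weightedCount ν {n | ENNReal.ofReal (y ^ 2 / 4) ≤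
          ENNReal.ofReal ((w n * ‖fourierCoeff lam mu g n‖) ^ 2)}) := by
        rw [← mul_assoc, ← ENNReal.ofReal_mul (by positivity)]
        have : 4 / y ^ 2 * (y ^ 2 / 4) = 1 := by field_simp
        rw [this, ENNReal.ofReal_one, one_mul]
    _ ≤ _ := by gcongr; exact hM.trans hB

/-- Split f at height a: where the whole exceeds y, one of the two pieces exceeds y/2. The cut a is
left free because the two interpolations choose it differently. -/
lemma weightedCount_lt_le_add (hlam : -(1 / 2) < lam) (hmu : 0 ≤ mu) {f : ℝ → ℂ}
    (hf : Measurable f) (hfi : Integrable f (weightMeasure lam mu)) {w : ℕ → ℝ}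
    {ν : ℕ → ENNReal} (hw : ∀ n, 0 ≤ w n)
    (hν : ∀ n, ν n * ENNReal.ofReal (w n ^ 2) = 1) (a : ℝ) {y : ℝ} (hy : 0 < y) :
    weightedCount ν {n | y < w n * ‖fourierCoeff lam mu f n‖} ≤
    weightedCount ν
      {n | y / 2 < w n * ‖fourierCoeff lam mu (fun t => if a < ‖f t‖ then f t else 0) n‖} +
    ENNReal.ofReal (4 / y ^ 2) *
      ∫⁻ t, (if ‖f t‖ ≤ a then ENNReal.ofReal (‖f t‖ ^ 2) else 0) ∂(weightMeasure lam mu) := by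
  refine le_trans ?_ (add_le_add_right
    (weightedCount_truncated_le hlam hmu hf hν a hy) _)
  refine le_trans (measure_mono ?_) (measure_union_le _ _)
  intro n hn
  have hn : y < w n * ‖fourierCoeff lam mu f n‖ := hn
  have hsum : fourierCoeff lam mu f n =
      fourierCoeff lam mu (fun t => if a < ‖f t‖ then f t else 0) n +
      fourierCoeff lam mu (fun t => if ‖f t‖ ≤ a then f t else 0) n := by
    rw [← fourierCoeff_add hlam hmu]
    · congr 1
      ext t
      by_cases h : a < ‖f t‖
      · simp [h, not_le.2 h]
      · simp [h, not_lt.1 h]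
    · have := hfi.indicator (measurableSet_lt (measurable_const (a := a)) hf.norm)
      exact this.congr (Eventually.of_forall fun t => by simp [Set.indicator])
    · have := hfi.indicator (measurableSet_le hf.norm (measurable_const (a := a)))
      exact this.congr (Eventually.of_forall fun t => by simp [Set.indicator])
  by_contra hcon
  simp only [Set.mem_union, Set.mem_ofPred_eq, not_or, not_lt] at hcon
  have h1 := mul_le_mul_of_nonneg_left (norm_add_le
    (fourierCoeff lam mu (fun t => if a < ‖f t‖ then f t else 0) n)
    (fourierCoeff lam mu (fun t => if ‖f t‖ ≤ a then f t else 0) n)) (hw n)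
  rw [← hsum, mul_add] at h1
  linarith [hcon.1, hcon.2]

lemma integrable_high {f : ℝ → ℂ} (hf : Measurable f)
    (hfi : Integrable f (weightMeasure lam mu)) (a : ℝ) :
    Integrable (fun t => if a < ‖f t‖ then f t else 0) (weightMeasure lam mu) :=
  (hfi.indicator (measurableSet_lt (measurable_const (a := a)) hf.norm)).congr
    (Eventually.of_forall fun t => by simp [Set.indicator])

lemma ofReal_integral_norm_high {f : ℝ → ℂ} (hf : Measurable f)
    (hfi : Integrable f (weightMeasure lam mu)) (a : ℝ) :
    ENNReal.ofReal (∫ t, ‖(if a < ‖f t‖ then f t else 0)‖ ∂(weightMeasure lam mu)) =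
      ∫⁻ t, (if a < ‖f t‖ then ENNReal.ofReal ‖f t‖ else 0) ∂(weightMeasure lam mu) := by
  rw [ofReal_integral_eq_lintegral_ofReal (integrable_high hf hfi a).norm
    (Eventually.of_forall fun _ => norm_nonneg _)]
  refine lintegral_congr fun t => ?_
  split_ifs <;> simp

lemma natCast_add_one_rpow_weight (n : ℕ) (s : ℝ) :
    ENNReal.ofReal (((n : ℝ) + 1) ^ (-2 * s)) * ENNReal.ofReal ((((n : ℝ) + 1) ^ s) ^ 2) = 1 := by
  have hn : (0 : ℝ) < (n : ℝ) + 1 := by positivity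
  rw [← ENNReal.ofReal_mul (by positivity), ← Real.rpow_natCast, ← Real.rpow_mul hn.le,
    ← Real.rpow_add hn, show -2 * s + s * ((2 : ℕ) : ℝ) = 0 by push_cast; ring, Real.rpow_zero,
    ENNReal.ofReal_one]

/-! ### Marcinkiewicz interpolation -/

/-- The Hardy–Littlewood–Paley inequality as an inequality of Lebesgue integrals. -/
lemma exists_lintegral_hardyLittlewood_le (hlam : -(1 / 2) < lam) (hmu : 0 ≤ mu) {p : ℝ}
    (hp : 1 < p) (hp2 : p < 2) :
    ∃ C : ℝ, 0 < C ∧ ∀ f : ℝ → ℂ, Measurable f → MemLpW lam mu p f →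
      ∫⁻ n, ENNReal.ofReal ((((n : ℝ) + 1) ^ (max lam mu + 1) * ‖fourierCoeff lam mu f n‖) ^ p)
        ∂(weightedCount fun n => ENNReal.ofReal (((n : ℝ) + 1) ^ (-2 * (max lam mu + 1)))) ≤
      ENNReal.ofReal C * ∫⁻ t, ENNReal.ofReal (‖f t‖ ^ p) ∂(weightMeasure lam mu) := by
  have := isFiniteMeasure_weightMeasure hlam hmu
  obtain ⟨K, hK0, hK⟩ := exists_abs_orthoGegenbauer_le hlam hmu
  set σ := max lam mu with hσ
  have hσ0 : 0 ≤ σ := hmu.trans (le_max_right _ _)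
  set τ := 2 * σ + 1 with hτ
  have hτ1 : 1 ≤ τ := by linarith
  have hp1 : 0 < p - 1 := by linarith
  have hp3 : 0 < 2 - p := by linarith
  refine ⟨p * (2 ^ τ * (2 * K) * (1 / (p - 1)) + 4 * (1 / (2 - p))), by positivity,
    fun f hfm hf => ?_⟩
  have hfi := integrable_of_memLpW hlam hmu hp.le hf
  set ν : ℕ → ENNReal := fun n => ENNReal.ofReal (((n : ℝ) + 1) ^ (-2 * (σ + 1))) with hν
  have hνw : ∀ n : ℕ, ν n * ENNReal.ofReal ((((n : ℝ) + 1) ^ (σ + 1)) ^ 2) = 1 :=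
    fun n => natCast_add_one_rpow_weight n (σ + 1)
  -- Layer-cake formula: the p-th power integral is p times the integral of y^(p-1) against the
  -- distribution function.
  rw [lintegral_rpow_eq_lintegral_meas_lt_mul _ (Eventually.of_forall fun n => by positivity)
    Measurable.of_discrete.aemeasurable (by linarith)]
  set κ := weightMeasure lam mu with hκ
  set H : ℝ → ENNReal := fun y => (∫⁻ x, (if y < ‖f x‖ then ENNReal.ofReal ‖f x‖ else 0) ∂κ) *
        ENNReal.ofReal (y ^ (p - 2)) with hH
  set L : ℝ → ENNReal := fun y =>
    (∫⁻ x, (if ‖f x‖ ≤ y then ENNReal.ofReal (‖f x‖ ^ 2) else 0) ∂κ) *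
        ENNReal.ofReal (y ^ (p - 3)) with hL
  have hHm : Measurable H := by
    refine Measurable.mul (Antitone.measurable fun y y' h => lintegral_mono fun x => ?_)
      (by fun_prop)
    by_cases h1 : y' < ‖f x‖
    · simp [h1, h.trans_lt h1]
    · simp [h1]
  have key : ∀ y ∈ Set.Ioi (0 : ℝ),
      weightedCount ν {n | y < ((n : ℝ) + 1) ^ (σ + 1) * ‖fourierCoeff lam mu f n‖} *
        ENNReal.ofReal (y ^ (p - 1)) ≤
      ENNReal.ofReal (2 ^ τ * (2 * K)) * H y + ENNReal.ofReal 4 * L y := by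
    intro y hy
    have hy : 0 < y := hy
    -- The cut is at height y itself, as for an operator of weak type (1,1) and type (2,2).
    have h1 := weightedCount_lt_le_add hlam hmu hfm hfi (w := fun n : ℕ => ((n : ℝ) + 1) ^ (σ + 1))
      (fun n => by positivity) hνw y hy
    have h2 : weightedCount ν {n | y / 2 < ((n : ℝ) + 1) ^ (σ + 1) *
        ‖fourierCoeff lam mu (fun t => if y < ‖f t‖ then f t else 0) n‖} ≤
        ENNReal.ofReal (2 ^ τ * (2 * K)) * ((∫⁻ x, (if y < ‖f x‖ then
          ENNReal.ofReal ‖f x‖ else 0) ∂κ) * ENNReal.ofReal (1 / y)) := by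
      rw [← ofReal_integral_norm_high hfm hfi y]
      set I := ∫ t, ‖(if y < ‖f t‖ then f t else 0)‖ ∂κ with hI
      have hI0 : 0 ≤ I := integral_nonneg fun _ => norm_nonneg _
      have hco := norm_fourierCoeff_le hK (integrable_high hfm hfi y)
      -- The L₁ bound adds σ to the exponent σ+1, giving τ = 2σ+1, while the masses are
      -- (n+1)^(-τ-1): the pairing needed for `weightedCount_lt_rpow_le`.
      have hpt : ∀ n : ℕ, ((n : ℝ) + 1) ^ (σ + 1) *
          ‖fourierCoeff lam mu (fun t => if y < ‖f t‖ then f t else 0) n‖ ≤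
          ((n : ℝ) + 1) ^ τ * (K * I) := by
        intro n
        have hn : (0 : ℝ) < (n : ℝ) + 1 := by positivity
        refine (mul_le_mul_of_nonneg_left (hco n) (by positivity)).trans_eq ?_
        rw [hτ, show 2 * σ + 1 = (σ + 1) + σ by ring, Real.rpow_add hn (σ + 1) σ]
        ring
      rcases hI0.eq_or_lt with h0 | h0
      · have : {n : ℕ | y / 2 < ((n : ℝ) + 1) ^ (σ + 1) *
            ‖fourierCoeff lam mu (fun t => if y < ‖f t‖ then f t else 0) n‖} = ∅ := by
          ext n
          have := hpt n
          rw [← h0, mul_zero, mul_zero] at this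
          simp only [Set.mem_ofPred_eq, Set.mem_empty_iff_false, iff_false, not_lt]
          linarith
        rw [this, measure_empty]
        exact zero_le
      · have hz : 0 < y / (2 * K * I) := by positivity
        have hsub : {n : ℕ | y / 2 < ((n : ℝ) + 1) ^ (σ + 1) *
            ‖fourierCoeff lam mu (fun t => if y < ‖f t‖ then f t else 0) n‖} ⊆
            {n : ℕ | y / (2 * K * I) < ((n : ℝ) + 1) ^ τ} := by
          intro n hn
          have hn : y / 2 < _ := hn
          have := hn.trans_le (hpt n)
          simp only [Set.mem_ofPred_eq]
          rw [div_lt_iff₀ (by positivity)]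
          linarith
        have hνe : ν = fun n : ℕ => ENNReal.ofReal (((n : ℝ) + 1) ^ (-τ - 1)) := by
          rw [hν, hτ]
          ext n
          congr 2
          ring
        refine (measure_mono hsub).trans ?_
        rw [hνe]
        refine (weightedCount_lt_rpow_le hτ1 hz).trans_eq ?_
        rw [← ENNReal.ofReal_mul hI0, ← ENNReal.ofReal_mul (by positivity)]
        congr 1
        field_simp
    have e1 : ENNReal.ofReal (1 / y) * ENNReal.ofReal (y ^ (p - 1)) =
        ENNReal.ofReal (y ^ (p - 2)) := by
      rw [← ENNReal.ofReal_mul (by positivity)]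
      congr 1
      rw [show p - 2 = p - 1 - 1 by ring, Real.rpow_sub_one hy.ne' (p - 1)]
      ring
    have e2 : ENNReal.ofReal (4 / y ^ 2) * ENNReal.ofReal (y ^ (p - 1)) =
        ENNReal.ofReal 4 * ENNReal.ofReal (y ^ (p - 3)) := by
      rw [← ENNReal.ofReal_mul (by positivity), ← ENNReal.ofReal_mul (by positivity)]
      congr 1
      rw [show p - 3 = p - 1 - 2 by ring, Real.rpow_sub hy (p - 1), Real.rpow_two]
      ring
    calc _ ≤ (_ + _) * ENNReal.ofReal (y ^ (p - 1)) :=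
          mul_le_mul_left (h1.trans (add_le_add_left h2 _)) _
      _ = _ := by
        rw [add_mul, hH, hL]
        simp only
        rw [← e1, mul_right_comm (ENNReal.ofReal (4 / y ^ 2)), e2]
        ring
  have hH1 := lintegral_rpow_mul_lintegral_high (κ := κ) hfm.norm (fun _ => norm_nonneg _) hp
  have hL1 := lintegral_rpow_mul_lintegral_low (κ := κ) hfm.norm (fun _ => norm_nonneg _) hp2
  calc _ ≤ ENNReal.ofReal p * ∫⁻ y in Set.Ioi (0 : ℝ),
          (ENNReal.ofReal (2 ^ τ * (2 * K)) * H y + ENNReal.ofReal 4 * L y) := by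
        exact mul_le_mul_right (setLIntegral_mono' measurableSet_Ioi key) _
    _ = ENNReal.ofReal p * (ENNReal.ofReal (2 ^ τ * (2 * K)) * (∫⁻ y in Set.Ioi (0 : ℝ), H y) +
          ENNReal.ofReal 4 * ∫⁻ y in Set.Ioi (0 : ℝ), L y) := by
        rw [lintegral_add_left (hHm.const_mul _), lintegral_const_mul' _ _ ENNReal.ofReal_ne_top,
          lintegral_const_mul' _ _ ENNReal.ofReal_ne_top]
    _ ≤ ENNReal.ofReal p * (ENNReal.ofReal (2 ^ τ * (2 * K)) * (ENNReal.ofReal (1 / (p - 1)) *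
            ∫⁻ x, ENNReal.ofReal (‖f x‖ ^ p) ∂κ) +
          ENNReal.ofReal 4 * (ENNReal.ofReal (1 / (2 - p)) *
            ∫⁻ x, ENNReal.ofReal (‖f x‖ ^ p) ∂κ)) := by gcongr
    _ = _ := by
        rw [ENNReal.ofReal_mul (by linarith : 0 ≤ p), ENNReal.ofReal_add (by positivity)
          (by positivity), ENNReal.ofReal_mul (by positivity : (0 : ℝ) ≤ 2 ^ τ * (2 * K)),
          ENNReal.ofReal_mul (by norm_num : (0 : ℝ) ≤ 4)]
        ring

/-- The Hausdorff–Young inequality as an inequality of Lebesgue integrals. -/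
lemma exists_lintegral_hausdorffYoung_le (hlam : -(1 / 2) < lam) (hmu : 0 ≤ mu) {p q : ℝ}
    (hp : 1 < p) (hq : 2 < q) (hpq : (1 - p) * (q - 2) = p - 2) :
    ∃ C : ℝ, 0 < C ∧ ∀ f : ℝ → ℂ, Measurable f → MemLpW lam mu p f →
      ∫⁻ n, ENNReal.ofReal ((((n : ℝ) + 1) ^ (-max lam mu) * ‖fourierCoeff lam mu f n‖) ^ q)
        ∂(weightedCount fun n => ENNReal.ofReal (((n : ℝ) + 1) ^ (-2 * -max lam mu))) ≤
      ENNReal.ofReal (C * normLpW lam mu p f ^ q) := by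
  have := isFiniteMeasure_weightMeasure hlam hmu
  obtain ⟨K, hK0, hK⟩ := exists_abs_orthoGegenbauer_le hlam hmu
  set σ := max lam mu with hσ
  have hp1 : 0 < p - 1 := by linarith
  have hq2 : 0 < q - 2 := by linarith
  refine ⟨q * (4 * ((2 * K) ^ (q - 2) / (q - 2))), by positivity, fun f hfm hf => ?_⟩
  have hfi := integrable_of_memLpW hlam hmu hp.le hf
  set ν : ℕ → ENNReal := fun n => ENNReal.ofReal (((n : ℝ) + 1) ^ (-2 * -σ)) with hν
  have hνw : ∀ n : ℕ, ν n * ENNReal.ofReal ((((n : ℝ) + 1) ^ (-σ)) ^ 2) = 1 :=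
    fun n => natCast_add_one_rpow_weight n (-σ)
  have hNeq := lintegral_norm_rpow_eq (by linarith : 0 < p) hf
  set κ := weightMeasure lam mu with hκ
  have hn0 : 0 ≤ normLpW lam mu p f := ENNReal.toReal_nonneg
  set M := normLpW lam mu p f with hM
  -- A vanishing norm is treated apart because the cut height divides by D = 2KN.
  rcases hn0.eq_or_lt with h0 | h0
  · have hz : f =ᵐ[κ] fun _ => 0 := by
      have h1 : eLpNorm f (ENNReal.ofReal p) κ = 0 := by
        rcases (ENNReal.toReal_eq_zero_iff _).1 h0.symm with h | h
        · exact h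
        · exact absurd h hf.2.ne
      exact (eLpNorm_eq_zero_iff hf.1 (by simpa using (by linarith : 0 < p))).1 h1
    have hz' : ∀ n, fourierCoeff lam mu f n = 0 := by
      intro n
      rw [fourierCoeff_congr_ae hz]
      simp [fourierCoeff]
    simp [hz', Real.zero_rpow (by linarith : q ≠ 0)]
  set N := M ^ p with hN
  have hN0 : 0 < N := by positivity
  set D := 2 * K * N with hD
  have hD0 : 0 < D := by positivity
  rw [lintegral_rpow_eq_lintegral_meas_lt_mul _ (Eventually.of_forall fun n => by positivity)
    Measurable.of_discrete.aemeasurable (by linarith)]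
  have key : ∀ y ∈ Set.Ioi (0 : ℝ),
      weightedCount ν {n | y < ((n : ℝ) + 1) ^ (-σ) * ‖fourierCoeff lam mu f n‖} *
        ENNReal.ofReal (y ^ (q - 1)) ≤
      ENNReal.ofReal 4 * ((∫⁻ x, (if ‖f x‖ ≤ (y / D) ^ (-(1 / (p - 1))) then
        ENNReal.ofReal (‖f x‖ ^ 2) else 0) ∂κ) * ENNReal.ofReal (y ^ (q - 3))) := by
    intro y hy
    have hy : 0 < y := hy
    -- Chosen so that a^(1-p) = y/D: the high part then has L₁ norm at most yN/D = y/(2K), its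
    -- weighted coefficients never exceed y/2, and its level set is empty.
    set a := (y / D) ^ (-(1 / (p - 1))) with ha
    have ha0 : 0 < a := by positivity
    have h1 := weightedCount_lt_le_add hlam hmu hfm hfi (w := fun n : ℕ => ((n : ℝ) + 1) ^ (-σ))
      (fun n => by positivity) hνw a hy
    have hI : ∫ t, ‖(if a < ‖f t‖ then f t else 0)‖ ∂κ ≤ y / D * N := by
      have hpi : Integrable (fun t => ‖f t‖ ^ p) κ := by
        have := hf.integrable_norm_rpow (by simpa using (by linarith : 0 < p))
          ENNReal.ofReal_ne_top
        rwa [ENNReal.toReal_ofReal (by linarith)] at this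
      have hNi : ∫ t, ‖f t‖ ^ p ∂κ = N := by
        rw [integral_eq_lintegral_of_nonneg_ae (Eventually.of_forall fun t => by positivity)
          hpi.aestronglyMeasurable, hNeq, ENNReal.toReal_ofReal hN0.le]
      rw [← hNi, ← integral_const_mul]
      refine integral_mono (integrable_high hfm hfi a).norm (hpi.const_mul _) fun t => ?_
      simp only
      split_ifs with h
      · have h3 : ‖f t‖ ^ (1 - p) ≤ a ^ (1 - p) :=
          Real.rpow_le_rpow_of_nonpos ha0 h.le (by linarith)
        have h4 : a ^ (1 - p) = y / D := by
          rw [ha, ← Real.rpow_mul (by positivity),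
            show -(1 / (p - 1)) * (1 - p) = 1 by field_simp; ring, Real.rpow_one]
        have h5 : 0 < ‖f t‖ := ha0.trans h
        calc ‖f t‖ = ‖f t‖ ^ (1 - p) * ‖f t‖ ^ p := by
              rw [← Real.rpow_add h5]; simp
          _ ≤ y / D * ‖f t‖ ^ p := by rw [← h4]; gcongr
      · rw [norm_zero]; positivity
    have h2 : {n : ℕ | y / 2 < ((n : ℝ) + 1) ^ (-σ) *
        ‖fourierCoeff lam mu (fun t => if a < ‖f t‖ then f t else 0) n‖} = ∅ := by
      ext n
      have hn : (0 : ℝ) < (n : ℝ) + 1 := by positivity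
      have hco := norm_fourierCoeff_le hK (integrable_high hfm hfi a) n
      simp only [Set.mem_ofPred_eq, Set.mem_empty_iff_false, iff_false, not_lt]
      calc _ ≤ ((n : ℝ) + 1) ^ (-σ) * (K * ((n : ℝ) + 1) ^ σ * (y / D * N)) := by
            refine mul_le_mul_of_nonneg_left (hco.trans ?_) (by positivity)
            exact mul_le_mul_of_nonneg_left hI (by positivity)
        _ = y / 2 := by
            rw [Real.rpow_neg hn.le, hD]
            field_simp
    rw [h2, measure_empty, zero_add] at h1
    have e2 : ENNReal.ofReal (4 / y ^ 2) * ENNReal.ofReal (y ^ (q - 1)) =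
        ENNReal.ofReal 4 * ENNReal.ofReal (y ^ (q - 3)) := by
      rw [← ENNReal.ofReal_mul (by positivity), ← ENNReal.ofReal_mul (by positivity)]
      congr 1
      rw [show q - 3 = q - 1 - 2 by ring, Real.rpow_sub hy (q - 1), Real.rpow_two]
      ring
    refine (mul_le_mul_left h1 _).trans_eq ?_
    rw [mul_right_comm, e2]
    ring
  have hL1 := lintegral_rpow_mul_lintegral_of_le (κ := κ) hfm.norm (fun _ => norm_nonneg _) hp hq
    hpq hD0
  calc _ ≤ ENNReal.ofReal q * ∫⁻ y in Set.Ioi (0 : ℝ),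
        ENNReal.ofReal 4 * ((∫⁻ x, (if ‖f x‖ ≤ (y / D) ^ (-(1 / (p - 1))) then
        ENNReal.ofReal (‖f x‖ ^ 2) else 0) ∂κ) * ENNReal.ofReal (y ^ (q - 3))) := by
        exact mul_le_mul_right (setLIntegral_mono' measurableSet_Ioi key) _
    _ ≤ ENNReal.ofReal q * (ENNReal.ofReal 4 * (ENNReal.ofReal (D ^ (q - 2) / (q - 2)) *
          ENNReal.ofReal N)) := by
        rw [lintegral_const_mul' _ _ ENNReal.ofReal_ne_top, ← hNeq]
        gcongr
    _ = _ := by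
        rw [← ENNReal.ofReal_mul (by positivity), ← ENNReal.ofReal_mul (by norm_num),
          ← ENNReal.ofReal_mul (by linarith)]
        congr 1
        -- By conjugacy p(q-1) = q, so the powers of the norm collected in D and N add up to M^q.
        have e : M ^ q = N ^ (q - 2) * N := by
          rw [hN, ← Real.rpow_mul h0.le, ← Real.rpow_add h0]
          congr 1
          linarith
        rw [e, hD, Real.mul_rpow (by positivity) hN0.le]
        ring

/-! ### Existence of the constants -/

lemma coeffInequality_two (hlam : -(1 / 2) < lam) (hmu : 0 ≤ mu) :
    CoeffInequality lam mu 2 2 1 := by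
  refine coeffInequality_of_measurable two_pos zero_le_one fun f hfm hf => ?_
  have he : coeffExponent lam mu 2 2 = 0 := by
    rw [coeffExponent, Real.conjExponent]; norm_num
  have h2 : MemLp f 2 (weightMeasure lam mu) := by
    simpa [MemLpW] using hf
  have hB := tsum_norm_fourierCoeff_sq_le hlam hmu h2
  have hN := lintegral_norm_rpow_eq two_pos hf
  simp only [Real.rpow_two] at hN
  rw [hN] at hB
  simpa [he] using hB

lemma exists_hardyLittlewood (hlam : -(1 / 2) < lam) (hmu : 0 ≤ mu) {p : ℝ}
    (hp : 1 < p) (hp2 : p < 2) : ∃ A : ℝ, 0 < A ∧ CoeffInequality lam mu p p A := by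
  obtain ⟨C, hC, h⟩ := exists_lintegral_hardyLittlewood_le hlam hmu hp hp2
  have hp0 : 0 < p := by linarith
  refine ⟨C ^ (1 / p), by positivity, coeffInequality_of_measurable hp0 (by positivity)
    fun f hfm hf => ?_⟩
  have hN : 0 ≤ normLpW lam mu p f := ENNReal.toReal_nonneg
  have h1 := h f hfm hf
  rw [lintegral_norm_rpow_eq hp0 hf, ← ENNReal.ofReal_mul hC.le, lintegral_weightedCount] at h1
  rw [Real.mul_rpow (by positivity) hN, ← Real.rpow_mul hC.le, one_div_mul_cancel hp0.ne',
    Real.rpow_one]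
  refine le_trans (le_of_eq (tsum_congr fun n => ?_)) h1
  have hn : (0 : ℝ) < (n : ℝ) + 1 := by positivity
  rw [← ENNReal.ofReal_mul (by positivity), Real.mul_rpow (by positivity) (norm_nonneg _),
    Real.mul_rpow (by positivity) (norm_nonneg _), ← mul_assoc, ← Real.rpow_mul hn.le,
    ← Real.rpow_mul hn.le, ← Real.rpow_add hn]
  congr 3
  -- Total exponent of n+1: p(1/p'-1/p)(σ+1) = (p-2)(σ+1), where -2(σ+1) comes from the masses.
  rw [coeffExponent, Real.conjExponent]
  have hp1 : p - 1 ≠ 0 := by linarith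
  field_simp
  ring

lemma exists_hausdorffYoung (hlam : -(1 / 2) < lam) (hmu : 0 ≤ mu) {p : ℝ}
    (hp : 1 < p) (hp2 : p < 2) :
    ∃ B : ℝ, 0 < B ∧ CoeffInequality lam mu p p.conjExponent B := by
  have hp1 : 0 < p - 1 := by linarith
  have hq : 2 < p.conjExponent := by
    rw [Real.conjExponent, lt_div_iff₀ hp1]; linarith
  obtain ⟨C, hC, h⟩ := exists_lintegral_hausdorffYoung_le hlam hmu hp hq (by
    rw [Real.conjExponent]; field_simp; ring)
  have hq0 : 0 < p.conjExponent := by linarith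
  refine ⟨C ^ (1 / p.conjExponent), by positivity,
    coeffInequality_of_measurable hq0 (by positivity) fun f hfm hf => ?_⟩
  have hN : 0 ≤ normLpW lam mu p f := ENNReal.toReal_nonneg
  have h1 := h f hfm hf
  rw [lintegral_weightedCount] at h1
  rw [Real.mul_rpow (by positivity) hN, ← Real.rpow_mul hC.le, one_div_mul_cancel hq0.ne',
    Real.rpow_one]
  refine le_trans (le_of_eq (tsum_congr fun n => ?_)) h1
  have hn : (0 : ℝ) < (n : ℝ) + 1 := by positivity
  rw [← ENNReal.ofReal_mul (by positivity), Real.mul_rpow (by positivity) (norm_nonneg _),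
    Real.mul_rpow (by positivity) (norm_nonneg _), ← mul_assoc, ← Real.rpow_mul hn.le,
    ← Real.rpow_mul hn.le, ← Real.rpow_add hn]
  congr 3
  -- Here p'(1/p'-1/p)σ = (2-p')σ, where 2σ comes from the masses.
  rw [coeffExponent, Real.conjExponent]
  have hp1 : p - 1 ≠ 0 := by linarith
  field_simp
  ring

lemma exists_coeffInequality_constants (hlam : -(1 / 2) < lam) (hmu : 0 ≤ mu) :
    ∃ A B : ℝ → ℝ, A 2 = 1 ∧ B 2 = 1 ∧
      ∀ p : ℝ, 1 < p → p ≤ 2 → 0 < A p ∧ 0 < B p ∧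
        CoeffInequality lam mu p p (A p) ∧
        CoeffInequality lam mu p p.conjExponent (B p) := by
  -- Stated for every real p so that `choose` yields functions; outside (1, 2] the pair (1, 1) is a
  -- filler.
  have h : ∀ p : ℝ, ∃ ab : ℝ × ℝ, (p = 2 → ab = (1, 1)) ∧ (1 < p → p ≤ 2 → 0 < ab.1 ∧ 0 < ab.2 ∧
      CoeffInequality lam mu p p ab.1 ∧ CoeffInequality lam mu p p.conjExponent ab.2) := by
    intro p
    by_cases h2 : p = 2
    · subst h2
      have hc : (2 : ℝ).conjExponent = 2 := by rw [Real.conjExponent]; norm_num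
      refine ⟨(1, 1), fun _ => rfl, fun _ _ => ⟨one_pos, one_pos, ?_, ?_⟩⟩
      · exact coeffInequality_two hlam hmu
      · rw [hc]; exact coeffInequality_two hlam hmu
    · by_cases hp : 1 < p ∧ p < 2
      · obtain ⟨a, ha, ha'⟩ := exists_hardyLittlewood hlam hmu hp.1 hp.2
        obtain ⟨b, hb, hb'⟩ := exists_hausdorffYoung hlam hmu hp.1 hp.2
        exact ⟨(a, b), fun h => absurd h h2, fun _ _ => ⟨ha, hb, ha', hb'⟩⟩
      · exact ⟨(1, 1), fun _ => rfl, fun h1 h3 => absurd ⟨h1, lt_of_le_of_ne h3 h2⟩ hp⟩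
  choose F hF2 hF using h
  exact ⟨fun p => (F p).1, fun p => (F p).2, congrArg Prod.fst (hF2 2 rfl),
    congrArg Prod.snd (hF2 2 rfl), hF⟩

/-! ### Interpolation of the coefficient inequalities -/

/-- Test with f = 1, whose norm is positive. The given constants come without a sign, and their real
powers are only manageable when they are nonnegative. -/
lemma CoeffInequality.constant_nonneg (hlam : -(1 / 2) < lam) (hmu : 0 ≤ mu) {p s C : ℝ}
    (hp : 0 < p) (h : CoeffInequality lam mu p s C) : 0 ≤ C := by
  have := isFiniteMeasure_weightMeasure hlam hmu
  have hp' : ENNReal.ofReal p ≠ 0 := by simpa using hp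
  have h1 : MemLpW lam mu p fun _ => 1 := memLp_const 1
  have hpos : 0 < normLpW lam mu p fun _ => 1 := by
    refine ENNReal.toReal_pos ?_ h1.2.ne
    rw [Ne, eLpNorm_eq_zero_iff h1.1 hp']
    intro h0
    have : NeZero (weightMeasure lam mu) := ⟨weightMeasure_ne_zero hlam hmu⟩
    obtain ⟨x, hx⟩ := h0.exists
    simp at hx
  refine nonneg_of_mul_nonneg_left (le_trans ?_ (h _ h1).2) hpos
  exact Real.rpow_nonneg (tsum_nonneg fun n => by positivity) _

/-- Interpolation between the Hausdorff–Young and the Hardy–Littlewood inequalities by Hölder's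
inequality for series. -/
lemma CoeffInequality.interpolate (hlam : -(1 / 2) < lam) (hmu : 0 ≤ mu) {p s t A B : ℝ}
    (hp : 1 < p) (hA : CoeffInequality lam mu p p A)
    (hB : CoeffInequality lam mu p p.conjExponent B) (hs : 0 < s) (ht0 : 0 ≤ t) (ht1 : t ≤ 1)
    (hst : 1 / s = (1 - t) / p.conjExponent + t / p) :
    CoeffInequality lam mu p s (B ^ (1 - t) * A ^ t) := by
  have hp0 : 0 < p := by linarith
  have hq0 : 0 < p.conjExponent := div_pos hp0 (by linarith)
  have hA0 := hA.constant_nonneg hlam hmu hp0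
  have hB0 := hB.constant_nonneg hlam hmu hp0
  -- The end points t = 0 and t = 1 are the hypotheses themselves; Hölder below uses the exponents
  -- p'/(1-t) and p/t.
  rcases ht0.eq_or_lt with rfl | ht0'
  · have : s = p.conjExponent := by
      rw [sub_zero, zero_div, add_zero] at hst
      simpa using hst
    rw [this, sub_zero, Real.rpow_one, Real.rpow_zero, mul_one]
    exact hB
  rcases ht1.eq_or_lt with rfl | ht1'
  · have : s = p := by
      rw [sub_self, zero_div, zero_add] at hst
      simpa using hst
    rw [this, sub_self, Real.rpow_one, Real.rpow_zero, one_mul]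
    exact hA
  have ht1' : 0 < 1 - t := by linarith
  intro f hf
  obtain ⟨sA, iA⟩ := hA f hf
  obtain ⟨sB, iB⟩ := hB f hf
  set a : ℕ → ℝ := fun n =>
    ((n : ℝ) + 1) ^ coeffExponent lam mu p p * ‖fourierCoeff lam mu f n‖ with ha
  set b : ℕ → ℝ := fun n =>
    ((n : ℝ) + 1) ^ coeffExponent lam mu p p.conjExponent * ‖fourierCoeff lam mu f n‖ with hb
  have ha0 : ∀ n, 0 ≤ a n := fun n => by positivity
  have hb0 : ∀ n, 0 ≤ b n := fun n => by positivity
  -- The exponent is affine in 1/s, so the weighted coefficients for s are geometric means of those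
  -- for p' and p.
  have hE : coeffExponent lam mu p s = (1 - t) * coeffExponent lam mu p p.conjExponent +
      t * coeffExponent lam mu p p := by
    simp only [coeffExponent, hst]
    ring
  have hab : ∀ n : ℕ, ((n : ℝ) + 1) ^ coeffExponent lam mu p s * ‖fourierCoeff lam mu f n‖ =
      b n ^ (1 - t) * a n ^ t := by
    intro n
    have hn : (0 : ℝ) < (n : ℝ) + 1 := by positivity
    have hf0 := norm_nonneg (fourierCoeff lam mu f n)
    have h1 : ‖fourierCoeff lam mu f n‖ =
        ‖fourierCoeff lam mu f n‖ ^ (1 - t) * ‖fourierCoeff lam mu f n‖ ^ t := by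
      rw [← Real.rpow_add_of_nonneg hf0 ht1'.le ht0]; simp
    simp only [ha, hb]
    rw [Real.mul_rpow (by positivity) hf0, Real.mul_rpow (by positivity) hf0,
      ← Real.rpow_mul hn.le, ← Real.rpow_mul hn.le, hE, Real.rpow_add hn,
      mul_mul_mul_comm, ← h1, mul_comm (1 - t), mul_comm t]
  have hH : (p.conjExponent / (1 - t)).HolderTriple (p / t) s :=
    ⟨by rw [inv_div, inv_div, ← hst, one_div], by positivity, by positivity⟩
  have pb : ∀ n, (b n ^ (1 - t)) ^ (p.conjExponent / (1 - t)) = b n ^ p.conjExponent := by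
    intro n
    rw [← Real.rpow_mul (hb0 n), mul_div_cancel₀ _ ht1'.ne']
  have pa : ∀ n, (a n ^ t) ^ (p / t) = a n ^ p := by
    intro n
    rw [← Real.rpow_mul (ha0 n), mul_div_cancel₀ _ ht0'.ne']
  obtain ⟨hsum, hle⟩ := Real.summable_and_Lr_rpow_le_Lp_mul_Lq_tsum_of_nonneg hH
    (f := fun n => b n ^ (1 - t)) (g := fun n => a n ^ t)
    (fun n => Real.rpow_nonneg (hb0 n) _) (fun n => Real.rpow_nonneg (ha0 n) _)
    (by simpa only [pb] using sB) (by simpa only [pa] using sA)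
  simp only [pa, pb] at hle
  simp only [hab]
  refine ⟨hsum, ?_⟩
  set SA := ∑' n, a n ^ p with hSA
  set SB := ∑' n, b n ^ p.conjExponent with hSB
  have hSA0 : 0 ≤ SA := tsum_nonneg fun n => Real.rpow_nonneg (ha0 n) _
  have hSB0 : 0 ≤ SB := tsum_nonneg fun n => Real.rpow_nonneg (hb0 n) _
  have hN : 0 ≤ normLpW lam mu p f := ENNReal.toReal_nonneg
  set M := normLpW lam mu p f
  calc (∑' n, (b n ^ (1 - t) * a n ^ t) ^ s) ^ (1 / s)
      ≤ (SB ^ (s / (p.conjExponent / (1 - t))) * SA ^ (s / (p / t))) ^ (1 / s) :=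
        Real.rpow_le_rpow (tsum_nonneg fun n => Real.rpow_nonneg (mul_nonneg
          (Real.rpow_nonneg (hb0 n) _) (Real.rpow_nonneg (ha0 n) _)) _) hle (by positivity)
    _ = (SB ^ (1 / p.conjExponent)) ^ (1 - t) * (SA ^ (1 / p)) ^ t := by
        rw [Real.mul_rpow (by positivity) (by positivity), ← Real.rpow_mul hSB0,
          ← Real.rpow_mul hSA0, ← Real.rpow_mul hSB0, ← Real.rpow_mul hSA0]
        congr 2 <;> field_simp
    _ ≤ (B * M) ^ (1 - t) * (A * M) ^ t := by gcongr
    _ = B ^ (1 - t) * A ^ t * M := by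
        rw [Real.mul_rpow hB0 hN, Real.mul_rpow hA0 hN, mul_mul_mul_comm,
          ← Real.rpow_add_of_nonneg hN ht1'.le ht0]
        simp

/-! ### Synthesis by duality -/

section Synthesis

/-- A finite combination of the orthonormal polynomials. -/
def synth (lam mu : ℝ) (φ : ℕ → ℂ) (S : Finset ℕ) (t : ℝ) : ℂ :=
  ∑ n ∈ S, φ n * (orthoGegenbauer lam mu n t : ℂ)

lemma continuous_synth (lam mu : ℝ) (φ : ℕ → ℂ) (S : Finset ℕ) :
    Continuous (synth lam mu φ S) :=
  continuous_finsetSum _ fun n _ =>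
    continuous_const.mul (continuous_ofReal_orthoGegenbauer lam mu n)

lemma memLp_of_continuous (hlam : -(1 / 2) < lam) (hmu : 0 ≤ mu) {g : ℝ → ℂ}
    (hg : Continuous g) (p : ENNReal) : MemLp g p (weightMeasure lam mu) := by
  have := isFiniteMeasure_weightMeasure hlam hmu
  obtain ⟨C, hC⟩ := isCompact_Icc.exists_bound_of_continuousOn
    (s := Set.Icc (-1 : ℝ) 1) hg.continuousOn
  refine MemLp.of_bound hg.aestronglyMeasurable C ?_
  filter_upwards [ae_weightMeasure_mem_Icc lam mu] with t ht using hC t ht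

lemma integral_synth_mul (hlam : -(1 / 2) < lam) (hmu : 0 ≤ mu) (φ : ℕ → ℂ) (S : Finset ℕ)
    {g : ℝ → ℂ} (hg : Integrable g (weightMeasure lam mu)) :
    ∫ t, synth lam mu φ S t * g t ∂(weightMeasure lam mu) =
      ∑ n ∈ S, φ n * fourierCoeff lam mu g n := by
  have h : ∀ t, synth lam mu φ S t * g t =
      ∑ n ∈ S, φ n * (g t * (orthoGegenbauer lam mu n t : ℂ)) := by
    intro t
    rw [synth, Finset.sum_mul]
    exact Finset.sum_congr rfl fun n _ => by ring
  simp only [h]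
  rw [integral_finsetSum _ fun n _ => (integrable_mul_orthoGegenbauer hlam hmu hg n).const_mul _]
  simp only [integral_const_mul, fourierCoeff]

lemma fourierCoeff_orthoGegenbauer (hlam : -(1 / 2) < lam) (hmu : 0 ≤ mu) (m n : ℕ) :
    fourierCoeff lam mu (fun t => (orthoGegenbauer lam mu m t : ℂ)) n = if m = n then 1 else 0 := by
  rw [fourierCoeff]
  simp only [← Complex.ofReal_mul]
  rw [integral_complex_ofReal, integral_orthoGegenbauer_mul hlam hmu]
  split_ifs <;> simp

lemma fourierCoeff_synth (hlam : -(1 / 2) < lam) (hmu : 0 ≤ mu) (φ : ℕ → ℂ) (S : Finset ℕ)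
    (n : ℕ) : fourierCoeff lam mu (synth lam mu φ S) n = if n ∈ S then φ n else 0 := by
  have := isFiniteMeasure_weightMeasure hlam hmu
  rw [fourierCoeff, integral_synth_mul hlam hmu φ S
    (memLp_one_iff_integrable.1 (memLp_orthoGegenbauer hlam hmu n 1))]
  simp [fourierCoeff_orthoGegenbauer hlam hmu]

/-- Duality: an inequality for the coefficients gives an inequality for finite sums. -/
lemma normLpW_synth_le (hlam : -(1 / 2) < lam) (hmu : 0 ≤ mu) {q r C : ℝ} (hq : 2 ≤ q)
    (hr : 1 < r) (h : CoeffInequality lam mu q.conjExponent r C) (φ : ℕ → ℂ) (S : Finset ℕ) :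
    normLpW lam mu q (synth lam mu φ S) ≤
      C * (∑ n ∈ S, (((n : ℝ) + 1) ^ synthExponent lam mu q r * ‖φ n‖) ^ r.conjExponent) ^
        (1 / r.conjExponent) := by
  have hq0 : 0 < q := by linarith
  have hq1 : 0 < q - 1 := by linarith
  set p := q.conjExponent with hp
  have hp1 : 1 ≤ p := by rw [hp, Real.conjExponent, le_div_iff₀ hq1]; linarith
  have hp0 : 0 < p := by linarith
  have hqp : (q - 1) * p = q := by rw [hp, Real.conjExponent]; field_simp
  have hC := h.constant_nonneg hlam hmu hp0
  set Φ := synth lam mu φ S with hΦ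
  have hΦc : Continuous Φ := continuous_synth lam mu φ S
  -- The extremal function for L_q duality: Φ g = |Φ|^q, and |g|^p = |Φ|^q because (q-1)p = q.
  set g : ℝ → ℂ := fun t => (starRingEnd ℂ) (Φ t) * ((‖Φ t‖ ^ (q - 2) : ℝ) : ℂ) with hg
  have hgc : Continuous g := (Complex.continuous_conj.comp hΦc).mul
    (Complex.continuous_ofReal.comp (hΦc.norm.rpow_const fun _ => Or.inr (by linarith)))
  have hΦp : MemLpW lam mu q Φ := memLp_of_continuous hlam hmu hΦc _
  have hgp : MemLpW lam mu p g := memLp_of_continuous hlam hmu hgc _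
  have hgi : Integrable g (weightMeasure lam mu) :=
    memLp_one_iff_integrable.1 (memLp_of_continuous hlam hmu hgc 1)
  have hgn : ∀ t, ‖g t‖ = ‖Φ t‖ ^ (q - 1) := by
    intro t
    rw [hg]
    simp only [norm_mul, RCLike.norm_conj, Complex.norm_real, Real.norm_eq_abs]
    rw [abs_of_nonneg (by positivity)]
    nth_rewrite 1 [← Real.rpow_one ‖Φ t‖]
    rw [← Real.rpow_add_of_nonneg (norm_nonneg _) zero_le_one (by linarith)]
    congr 1; ring
  have hΦg : ∀ t, Φ t * g t = ((‖Φ t‖ ^ q : ℝ) : ℂ) := by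
    intro t
    rw [hg]
    simp only
    rw [← mul_assoc, Complex.mul_conj, Complex.normSq_eq_norm_sq, ← Complex.ofReal_mul,
      ← Real.rpow_two, ← Real.rpow_add_of_nonneg (norm_nonneg _) two_pos.le (by linarith)]
    congr 2; ring
  set X := normLpW lam mu q Φ with hX
  set Y := normLpW lam mu p g with hY
  have hX0 : 0 ≤ X := ENNReal.toReal_nonneg
  have hY0 : 0 ≤ Y := ENNReal.toReal_nonneg
  have hXY : Y = X ^ (q - 1) := by
    have e1 := lintegral_norm_rpow_eq hq0 hΦp
    have e2 := lintegral_norm_rpow_eq hp0 hgp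
    simp only [hgn, ← Real.rpow_mul (norm_nonneg _), hqp] at e2
    rw [e1, ENNReal.ofReal_eq_ofReal_iff (by positivity) (by positivity)] at e2
    calc Y = (Y ^ p) ^ (1 / p) := by
          rw [← Real.rpow_mul hY0, mul_one_div_cancel hp0.ne', Real.rpow_one]
      _ = X ^ (q - 1) := by
          rw [← e2, ← Real.rpow_mul hX0]
          congr 1
          nth_rewrite 1 [← hqp]
          field_simp
  have hint : ∫ t, Φ t * g t ∂(weightMeasure lam mu) = ((X ^ q : ℝ) : ℂ) := by
    simp only [hΦg]
    rw [integral_complex_ofReal, integral_eq_lintegral_of_nonneg_ae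
      (Eventually.of_forall fun t => by positivity)
      (hΦc.norm.rpow_const fun _ => Or.inr hq0.le).aestronglyMeasurable,
      lintegral_norm_rpow_eq hq0 hΦp, ENNReal.toReal_ofReal (by positivity)]
  obtain ⟨hsum, hle⟩ := h g hgp
  have hr0 : 0 < r := by linarith
  have hrc : r.HolderConjugate r.conjExponent := Real.HolderConjugate.conjExponent hr
  set E := synthExponent lam mu q r with hE
  have hpc : p.conjExponent = q := by
    rw [hp, Real.conjExponent, Real.conjExponent]
    have : q / (q - 1) - 1 = 1 / (q - 1) := by field_simp; ring
    rw [this]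
    field_simp
  -- The two weights are reciprocal, so they cancel when φ is paired with the coefficients of g.
  have hEneg : coeffExponent lam mu p r = -E := by
    rw [coeffExponent, hpc, hE, synthExponent, ← hp]
    ring
  rw [hEneg] at hsum hle
  set R := (∑ n ∈ S, (((n : ℝ) + 1) ^ E * ‖φ n‖) ^ r.conjExponent) ^ (1 / r.conjExponent) with hR
  have hR0 : 0 ≤ R := Real.rpow_nonneg (Finset.sum_nonneg fun n _ => by positivity) _
  have hmain : X ^ q ≤ R * (C * Y) := by
    have e3 : X ^ q = ‖∑ n ∈ S, φ n * fourierCoeff lam mu g n‖ := by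
      rw [← integral_synth_mul hlam hmu φ S hgi, hint, Complex.norm_real, Real.norm_eq_abs,
        abs_of_nonneg (by positivity)]
    rw [e3]
    calc ‖∑ n ∈ S, φ n * fourierCoeff lam mu g n‖
        ≤ ∑ n ∈ S, (((n : ℝ) + 1) ^ E * ‖φ n‖) *
            (((n : ℝ) + 1) ^ (-E) * ‖fourierCoeff lam mu g n‖) := by
          refine (norm_sum_le _ _).trans_eq (Finset.sum_congr rfl fun n _ => ?_)
          have hn : (0 : ℝ) < (n : ℝ) + 1 := by positivity
          rw [mul_mul_mul_comm, ← Real.rpow_add hn, add_neg_cancel, Real.rpow_zero, one_mul,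
            norm_mul]
      _ ≤ R * (∑ n ∈ S, (((n : ℝ) + 1) ^ (-E) * ‖fourierCoeff lam mu g n‖) ^ r) ^ (1 / r) :=
          Real.inner_le_Lp_mul_Lq_of_nonneg S hrc.symm (fun n _ => by positivity)
            (fun n _ => by positivity)
      _ ≤ R * (C * Y) := by
          refine mul_le_mul_of_nonneg_left (le_trans ?_ hle) hR0
          refine Real.rpow_le_rpow (Finset.sum_nonneg fun n _ => by positivity) ?_ (by positivity)
          exact hsum.sum_le_tsum S fun n _ => by positivity
  rcases hX0.eq_or_lt with h0 | h0
  · rw [← h0]; positivity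
  · have e4 : X ^ q = X * X ^ (q - 1) := by
      nth_rewrite 2 [← Real.rpow_one X]
      rw [← Real.rpow_add h0]
      congr 1; ring
    rw [e4, hXY] at hmain
    have : 0 < X ^ (q - 1) := by positivity
    refine le_of_mul_le_mul_right ?_ this
    linarith

/-- The measure is finite, so L_q convergence implies L₁ convergence, and each coefficient is
continuous on L₁. -/
lemma tendsto_fourierCoeff_of_tendsto_eLpNorm (hlam : -(1 / 2) < lam) (hmu : 0 ≤ mu) {q : ENNReal}
    (hq : 1 ≤ q) {F : ℕ → ℝ → ℂ} {f : ℝ → ℂ} (hF : ∀ N, MemLp (F N) q (weightMeasure lam mu))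
    (hf : MemLp f q (weightMeasure lam mu))
    (h : Tendsto (fun N => eLpNorm (F N - f) q (weightMeasure lam mu)) atTop (𝓝 0)) (n : ℕ) :
    Tendsto (fun N => fourierCoeff lam mu (F N) n) atTop (𝓝 (fourierCoeff lam mu f n)) := by
  have := isFiniteMeasure_weightMeasure hlam hmu
  obtain ⟨K, hK0, hK⟩ := exists_abs_orthoGegenbauer_le hlam hmu
  have hFi : ∀ N, Integrable (F N) (weightMeasure lam mu) := fun N => (hF N).integrable hq
  have hfi : Integrable f (weightMeasure lam mu) := hf.integrable hq
  have h1 : Tendsto (fun N => eLpNorm (F N - f) 1 (weightMeasure lam mu)) atTop (𝓝 0) := by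
    set c := weightMeasure lam mu Set.univ ^ (1 / (1 : ENNReal).toReal - 1 / q.toReal) with hc
    have hexp : 0 ≤ 1 / (1 : ENNReal).toReal - 1 / q.toReal := by
      rcases eq_or_ne q ⊤ with rfl | hqt
      · simp
      · have : 1 ≤ q.toReal := by
          simpa using (ENNReal.toReal_le_toReal ENNReal.one_ne_top hqt).2 hq
        have := div_le_one_of_le₀ this (by positivity)
        simpa using this
    have hcT : c ≠ ⊤ := ENNReal.rpow_ne_top_of_nonneg hexp (measure_ne_top _ _)
    have := ENNReal.Tendsto.mul_const h (Or.inr hcT)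
    rw [zero_mul] at this
    exact tendsto_of_tendsto_of_tendsto_of_le_of_le tendsto_const_nhds this (fun _ => zero_le)
      fun N => eLpNorm_le_eLpNorm_mul_rpow_measure_univ hq ((hF N).1.sub hf.1)
  have h2 : Tendsto (fun N => K * ((n : ℝ) + 1) ^ max lam mu *
      (eLpNorm (F N - f) 1 (weightMeasure lam mu)).toReal) atTop (𝓝 0) := by
    have := ((ENNReal.tendsto_toReal ENNReal.zero_ne_top).comp h1).const_mul
      (K * ((n : ℝ) + 1) ^ max lam mu)
    simpa using this
  rw [tendsto_iff_norm_sub_tendsto_zero]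
  refine squeeze_zero (fun _ => norm_nonneg _) (fun N => ?_) h2
  have e : fourierCoeff lam mu (F N) n - fourierCoeff lam mu f n =
      fourierCoeff lam mu (F N - f) n := by
    simp only [fourierCoeff, Pi.sub_apply, sub_mul]
    rw [integral_sub (integrable_mul_orthoGegenbauer hlam hmu (hFi N) n)
      (integrable_mul_orthoGegenbauer hlam hmu hfi n)]
  rw [e]
  refine (norm_fourierCoeff_le hK ((hFi N).sub hfi) n).trans_eq ?_
  rw [integral_norm_eq_lintegral_enorm ((hFi N).sub hfi).1, eLpNorm_one_eq_lintegral_enorm]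

/-- The dual of a coefficient inequality: synthesis of a function in `L_q` from coefficients. -/
lemma exists_synthesis (hlam : -(1 / 2) < lam) (hmu : 0 ≤ mu) {q r C : ℝ} (hq : 2 ≤ q)
    (hr : 1 < r) (h : CoeffInequality lam mu q.conjExponent r C) {φ : ℕ → ℂ}
    (hφ : Summable fun n : ℕ =>
      (((n : ℝ) + 1) ^ synthExponent lam mu q r * ‖φ n‖) ^ r.conjExponent) :
    ∃ f : ℝ → ℂ, MemLpW lam mu q f ∧
      Tendsto (fun N : ℕ => eLpNorm (fun x => partialSum lam mu φ N x - f x) (ENNReal.ofReal q)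
        (weightMeasure lam mu)) atTop (𝓝 0) ∧
      (∀ n : ℕ, fourierCoeff lam mu f n = φ n) ∧
      normLpW lam mu q f ≤ C *
        (∑' n : ℕ, (((n : ℝ) + 1) ^ synthExponent lam mu q r * ‖φ n‖) ^ r.conjExponent) ^
          (1 / r.conjExponent) := by
  have hq1 : 1 ≤ ENNReal.ofReal q := by
    simpa using ENNReal.ofReal_le_ofReal (by linarith : (1 : ℝ) ≤ q)
  have : Fact (1 ≤ ENNReal.ofReal q) := ⟨hq1⟩
  have hC := h.constant_nonneg hlam hmu (p := q.conjExponent)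
    (div_pos (by linarith) (by linarith))
  have hr' : 0 < r.conjExponent := div_pos (by linarith) (by linarith)
  set a : ℕ → ℝ := fun n =>
    (((n : ℝ) + 1) ^ synthExponent lam mu q r * ‖φ n‖) ^ r.conjExponent with ha
  have ha0 : ∀ n, 0 ≤ a n := fun n => by positivity
  have hΦ : ∀ N, MemLp (partialSum lam mu φ N) (ENNReal.ofReal q) (weightMeasure lam mu) :=
    fun N => memLp_of_continuous hlam hmu (continuous_synth lam mu φ _) _
  set u : ℕ → Lp ℂ (ENNReal.ofReal q) (weightMeasure lam mu) := fun N => (hΦ N).toLp with hu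
  have hnorm : ∀ N, ‖u N‖ = normLpW lam mu q (synth lam mu φ (Finset.range (N + 1))) :=
    fun N => Lp.norm_toLp _ _
  -- The finite-sum inequality applied to the block N < n ≤ M; its right side is dominated by a tail
  -- of the convergent series.
  have hb : ∀ N M, N ≤ M → dist (u N) (u M) ≤
      C * (∑' k, a (k + (N + 1))) ^ (1 / r.conjExponent) := by
    intro N M hNM
    have e : partialSum lam mu φ M - partialSum lam mu φ N =
        synth lam mu φ (Finset.Ico (N + 1) (M + 1)) := by
      ext t
      simp only [Pi.sub_apply, partialSum, synth]
      rw [Finset.sum_Ico_eq_sub _ (by omega)]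
    have e' : ‖u M - u N‖ = normLpW lam mu q (synth lam mu φ (Finset.Ico (N + 1) (M + 1))) := by
      rw [hu]
      simp only
      rw [← MemLp.toLp_sub, Lp.norm_toLp, e, normLpW]
    rw [dist_comm, dist_eq_norm, e']
    refine (normLpW_synth_le hlam hmu hq hr h φ _).trans (mul_le_mul_of_nonneg_left ?_ hC)
    refine Real.rpow_le_rpow (Finset.sum_nonneg fun n _ => ha0 n) ?_ (by positivity)
    rw [Finset.sum_Ico_eq_sum_range]
    simp only [add_comm (N + 1)]
    exact ((summable_nat_add_iff (N + 1)).2 hφ).sum_le_tsum _ fun n _ => ha0 _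
  have htail : Tendsto (fun N => C * (∑' k, a (k + (N + 1))) ^ (1 / r.conjExponent)) atTop
      (𝓝 0) := by
    have h1 := (tendsto_sum_nat_add a).comp (tendsto_add_atTop_nat 1)
    have h2 := (h1.rpow_const (p := 1 / r.conjExponent) (Or.inr (by positivity))).const_mul C
    rw [Real.zero_rpow (by positivity), mul_zero] at h2
    exact h2
  obtain ⟨v, hv⟩ := cauchySeq_tendsto_of_complete (cauchySeq_of_le_tendsto_0' _ hb htail)
  have hvp : MemLp v (ENNReal.ofReal q) (weightMeasure lam mu) := Lp.memLp v
  have htend : Tendsto (fun N : ℕ => eLpNorm (partialSum lam mu φ N - ⇑v) (ENNReal.ofReal q)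
      (weightMeasure lam mu)) atTop (𝓝 0) := by
    refine ((Lp.tendsto_Lp_iff_tendsto_eLpNorm' _ _).1 hv).congr fun N => ?_
    refine eLpNorm_congr_ae ?_
    filter_upwards [(hΦ N).coeFn_toLp] with t ht
    simp only [Pi.sub_apply, hu, ht]
  refine ⟨⇑v, hvp, htend, fun n => ?_, ?_⟩
  -- The n-th coefficient of the partial sums is constantly φ(n) from N = n on.
  · have h1 := tendsto_fourierCoeff_of_tendsto_eLpNorm hlam hmu hq1 hΦ hvp htend n
    refine tendsto_nhds_unique h1 (tendsto_const_nhds.congr' ?_)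
    filter_upwards [eventually_ge_atTop n] with N hN
    have h2 := fourierCoeff_synth hlam hmu φ (Finset.range (N + 1)) n
    rw [if_pos (Finset.mem_range.2 (by omega))] at h2
    exact h2.symm
  · have h1 : normLpW lam mu q ⇑v = ‖v‖ := rfl
    rw [h1]
    refine le_of_tendsto' hv.norm fun N => ?_
    rw [hnorm]
    refine (normLpW_synth_le hlam hmu hq hr h φ _).trans (mul_le_mul_of_nonneg_left ?_ hC)
    refine Real.rpow_le_rpow (Finset.sum_nonneg fun n _ => ha0 n) ?_ (by positivity)
    exact hφ.sum_le_tsum _ fun n _ => ha0 n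

end Synthesis

lemma conjExponent_conjExponent {q : ℝ} (hq : 1 < q) : q.conjExponent.conjExponent = q := by
  have : q - 1 ≠ 0 := by linarith
  have h : q / (q - 1) - 1 = 1 / (q - 1) := by field_simp; ring
  rw [Real.conjExponent, Real.conjExponent, h]
  field_simp

lemma one_lt_conjExponent {q : ℝ} (hq : 1 < q) : 1 < q.conjExponent := by
  rw [Real.conjExponent, lt_div_iff₀ (by linarith)]
  linarith

lemma conjExponent_le_two {q : ℝ} (hq : 2 ≤ q) : q.conjExponent ≤ 2 := by
  rw [Real.conjExponent, div_le_iff₀ (by linarith)]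
  linarith

end GenGegenbauer

end

/-- The first conjunct: constants `A_p`, `B_p` in the Hardy-Littlewood-type and the
Hausdorff-Young-type inequalities exist for all `1 < p ≤ 2` (equal to `1` for `p = 2`). The second:
for every choice of such constants, parts (a) and (b) hold with `C_p(s) = B_p^{1-t} A_p^t`, where
`1/s = (1-t)/p' + t/p`. -/
theorem theorem5 (lam mu : ℝ) (hlam : -(1 / 2) < lam) (hmu : 0 ≤ mu) :
    (∃ A B : ℝ → ℝ, A 2 = 1 ∧ B 2 = 1 ∧
      ∀ p : ℝ, 1 < p → p ≤ 2 → 0 < A p ∧ 0 < B p ∧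
        GenGegenbauer.CoeffInequality lam mu p p (A p) ∧
        GenGegenbauer.CoeffInequality lam mu p p.conjExponent (B p)) ∧
    (∀ A B : ℝ → ℝ,
      (∀ p : ℝ, 1 < p → p ≤ 2 →
        GenGegenbauer.CoeffInequality lam mu p p (A p) ∧
        GenGegenbauer.CoeffInequality lam mu p p.conjExponent (B p)) →
      -- part (a)
      (∀ p s t : ℝ, 1 < p → p ≤ 2 → p ≤ s → s ≤ p.conjExponent →
        0 ≤ t → t ≤ 1 → 1 / s = (1 - t) / p.conjExponent + t / p →
        GenGegenbauer.CoeffInequality lam mu p s (B p ^ (1 - t) * A p ^ t)) ∧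
      -- part (b)
      (∀ q r t : ℝ, 2 ≤ q → q.conjExponent ≤ r → r ≤ q →
        0 ≤ t → t ≤ 1 → 1 / r = (1 - t) / q + t / q.conjExponent →
        ∀ φ : ℕ → ℂ,
          Summable (fun n : ℕ =>
            (((n : ℝ) + 1) ^ GenGegenbauer.synthExponent lam mu q r * ‖φ n‖) ^
              r.conjExponent) →
          ∃ f : ℝ → ℂ, GenGegenbauer.MemLpW lam mu q f ∧
            Filter.Tendsto
              (fun N : ℕ => MeasureTheory.eLpNorm
                (fun x => GenGegenbauer.partialSum lam mu φ N x - f x) (ENNReal.ofReal q)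
                (GenGegenbauer.weightMeasure lam mu))
              Filter.atTop (nhds 0) ∧
            (∀ n : ℕ, GenGegenbauer.fourierCoeff lam mu f n = φ n) ∧
            GenGegenbauer.normLpW lam mu q f ≤
              B q.conjExponent ^ (1 - t) * A q.conjExponent ^ t *
                (∑' n : ℕ,
                  (((n : ℝ) + 1) ^ GenGegenbauer.synthExponent lam mu q r * ‖φ n‖) ^
                    r.conjExponent) ^ (1 / r.conjExponent))) := by
  refine ⟨GenGegenbauer.exists_coeffInequality_constants hlam hmu, fun A B hAB => ⟨?_, ?_⟩⟩
  · intro p s t hp hp2 hps _ ht0 ht1 hst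
    exact (hAB p hp hp2).1.interpolate hlam hmu hp (hAB p hp hp2).2 (by linarith) ht0 ht1 hst
  · intro q r t hq hr _ ht0 ht1 hst φ hφ
    have hp1 : 1 < q.conjExponent := GenGegenbauer.one_lt_conjExponent (by linarith)
    obtain ⟨hA, hB⟩ := hAB _ hp1 (GenGegenbauer.conjExponent_le_two hq)
    refine GenGegenbauer.exists_synthesis hlam hmu hq (by linarith) ?_ hφ
    -- Part (b) is the dual of part (a) at p = q' and s = r; since q'' = q, the two relations
    -- defining t coincide.
    refine hA.interpolate hlam hmu hp1 hB (by linarith) ht0 ht1 ?_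
    rw [GenGegenbauer.conjExponent_conjExponent (by linarith), hst]
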